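/- **Setting (type $C_n$, $n\ge 1$).** Let $[\overline n]=\{1<\dots<n<\overline n<\dots<\overline 1\}$, with $\overline{\overline{\imath}}=i$ and $|i|=|\overline\imath|=i$, and let $W=B_n$ be the group of signed permutations, i.e. bijections $w$ of $[\overline n]$ with $w(\overline\imath)=\overline{w(i)}$, with length $\ell(w)=\#\{(k,l)\in[n]\times[\overline n]: k\le |l|,\ w(k)>w(l)\}$. For $1\le i<j\le n$ write $(i,j)$, $(i,\overline\jmath)$ for the positive roots $\varepsilon_i-\varepsilon_j$, $\varepsilon_i+\varepsilon_j$, and $(i,\overline\imath)$ ($1\le i\le n$) for $2\varepsilon_i$; the corresponding reflections $s_\beta\in W$ are the products of transpositions $t_{ij}t_{\overline\jmath\,\overline\imath}$, $t_{i\overline\jmath}t_{j\overline\imath}$ and $t_{i\overline\imath}$. Put $\rho=(n,n-1,\dots,1)$ and $\beta^\vee=2\beta/\langle\beta,\beta\rangle$. Let $\mu=(\mu_1\ge\dots\ge\mu_n\ge 0)$ be a dominant weight, with conjugate partition $\mu'$. For $1\le k\le n$ let $\Gamma(k)=\Gamma_r(k)\Gamma_l(k)$, where $\Gamma_r(k)=\Gamma_2\cdots\Gamma_k$,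 $\Gamma_l(k)=\Gamma_{k1}\cdots\Gamma_{kk}$, with $\Gamma_i=((1,\overline\imath),\dots,(i-1,\overline\imath))$ and $$\Gamma_{ki}=\big((1,\overline\imath),\dots,(i-1,\overline\imath),\ (i,\overline{k+1}),\dots,(i,\overline n),\ (i,\overline\imath),\ (i,n),(i,n-1),\dots,(i,k+1)\big).$$ Let $\Gamma=\Gamma^{\mu_1}\cdots\Gamma^1=(\beta_1,\dots,\beta_m)$ with $\Gamma^j=\Gamma(\mu'_j)$. A folding pair is a pair $(w,J)$ with $w\in W$ and $J=\{j_1<\dots<j_s\}\subseteq[m]$; put $w_i=w\,s_{\beta_{j_1}}\cdots s_{\beta_{j_i}}$, $\mathrm{end}(w,J)=w_s$, and $J^-=\{j_i: w_{i-1}<w_i\text{ in Bruhat order}\}$. Let $\overline{\mathcal F}(\mu)$ be the set of folding pairs with $$\tfrac12\big(\ell(w)+\ell(\mathrm{end}(w,J))-\#J\big)+\sum_{j\in J^-}\langle\rho,\beta_j^\vee\rangle=0 .$$ A filling of shape $2\mu$ is a sequence of columns $C_r^{\mu_1}C_l^{\mu_1}\cdots C_r^1C_l^1$, where $C_r^j,C_l^j$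 have height $\mu_j'$ and each column has entries in $[\overline n]$ with distinct absolute values. The filling map $f$ sends $(w,J)$ to the filling with $C_r^j=\pi_r^j(1)\cdots\pi_r^j(\mu_j')$ and $C_l^j=\pi_l^j(1)\cdots\pi_l^j(\mu_j')$. Here $\pi_r^j$ is the product of $w$ with the reflections $s_{\beta_q}$, $q\in J$, over the positions $q$ in the factors $\Gamma^{\mu_1},\dots,\Gamma^{j+1}$ (multiplied on the right, in increasing order of $q$), and $\pi_l^j$ is the product of $\pi_r^j$ with those at the positions $q\in J$ in the factor $\Gamma_r(\mu_j')$ of $\Gamma^j$. *Split columns.* Let $D$ be a strictly increasing column of height $k$ with entries in $[\overline n]$, and let $z_1>\dots>z_r$ be the letters $z\in[n]$ such that $z$ and $\overline z$ both occur in $D$. The column $D$ is a Kashiwara–Nakashima (KN) column if there are letters $t_1>\dots>t_r$ in $[n]$ such that each $t_i$ is the greatest $t\in[n]$ with $t<z_i$, $t<t_{i-1}$ (if $i\ge2$), $t\notin D$ and $\overline t\notin D$. Then $rD$ (resp. $lD$) is obtained from $D$ by replacing each $\overline{z_i}$ by $\overline{t_i}$ (resp. each $z_i$ by $t_i$) and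 sorting increasingly. *Condition 1$'$* for adjacent columns $C'C$ ($C'$ immediately to the left of $C$): for all $1\le i<l\le\#C'$, neither $C(i)=C'(l)$ nor $C(i)\prec C'(l)\prec C'(i)$ holds, where $\prec$ is the circular order on $[\overline n]$ starting at $C(i)$. **Proposition.** The restriction of $f$ to $\overline{\mathcal F}(\mu)$ is injective. Its image consists exactly of the fillings $C_r^{\mu_1}C_l^{\mu_1}\cdots C_r^1C_l^1$ of shape $2\mu$ such that: (i) $C_l^1$ is increasing (a void condition if $\mu=0$); (ii) for every $j$ there is a KN column $D^j$ with $(\mathrm{ord}(C_r^j),\mathrm{ord}(C_l^j))=(rD^j,lD^j)$, where $\mathrm{ord}$ sorts a column increasingly; (iii) any two adjacent columns satisfy Condition 1$'$. -/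

import Mathlib

namespace TypeC

/-! ### Letters, signed permutations, length -/

/-- The ordered alphabet `1 < 2 < … < n < n̄ < … < 2̄ < 1̄`: the letter `i` is the element `i - 1`
of `Fin (2 * n)`, and the letter `ī` is the element `2 * n - i`. -/
abbrev Letter (n : ℕ) : Type := Fin (2 * n)

/-- The involution `x ↦ x̄`. -/
def bar {n : ℕ} (x : Letter n) : Letter n := Fin.rev x

/-- The unbarred letter `i`. -/
def unbarred {n : ℕ} (i : Fin n) : Letter n := Fin.castLE (Nat.le_mul_of_pos_left n two_pos) i

/-- `x` is one of the letters `1, …, n`. -/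
def IsUnbarred {n : ℕ} (x : Letter n) : Prop := x.val < n

/-- The absolute value of a letter: `|i| = |ī| = i`. -/
def absLetter {n : ℕ} (x : Letter n) : Letter n := min x (bar x)

/-- The group `B_n` of signed permutations: bijections `w` of the alphabet to itself such that
`w(x̄)` is the bar of `w(x)`. -/
def SignedPerm (n : ℕ) : Subgroup (Equiv.Perm (Letter n)) where
  carrier := {w | ∀ x, w (bar x) = bar (w x)}
  one_mem' := fun _ => rfl
  mul_mem' := by
    intro a b ha hb x
    rw [Equiv.Perm.mul_apply, Equiv.Perm.mul_apply, hb x, ha (b x)]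
  inv_mem' := by
    intro a ha x
    have ha' : ∀ y, a (bar y) = bar (a y) := ha
    apply a.injective
    rw [ha']
    simp

/-- The length `ℓ(w) = #{(k, l) ∈ [n] × [n̄] : k ≤ |l|, w(k) > w(l)}`. -/
def length {n : ℕ} (w : SignedPerm n) : ℕ :=
  ((Finset.univ : Finset (Fin n × Letter n)).filter
    (fun p => unbarred p.1 ≤ absLetter p.2 ∧ w.1 p.2 < w.1 (unbarred p.1))).card

/-! ### Positive roots and reflections -/

/-- The positive roots of type `C_n`. -/
inductive PosRoot (n : ℕ) : Type
  /-- the root `(i, j) = ε_i - ε_j`, for `i < j` -/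
  | sub (i j : Fin n) (h : i < j) : PosRoot n
  /-- the root `(i, j̄) = ε_i + ε_j`, for `i < j` -/
  | add (i j : Fin n) (h : i < j) : PosRoot n
  /-- the root `(i, ī) = 2 ε_i` -/
  | long (i : Fin n) : PosRoot n

/-- The root as a vector of coordinates with respect to `ε_1, …, ε_n`. -/
def PosRoot.vec {n : ℕ} : PosRoot n → (Fin n → ℚ)
  | .sub i j _ => Pi.single i 1 - Pi.single j 1
  | .add i j _ => Pi.single i 1 + Pi.single j 1
  | .long i => Pi.single i 2

/-- The vector `ρ = (n, n - 1, …, 1)`. -/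
def rho (n : ℕ) : Fin n → ℚ := fun i => (n : ℚ) - (i.val : ℚ)

/-- `⟨ρ, β^∨⟩`, where `β^∨ = 2 β / ⟨β, β⟩` is the coroot. -/
def rhoCoroot {n : ℕ} (β : PosRoot n) : ℚ :=
  2 * dotProduct (rho n) β.vec / dotProduct β.vec β.vec

/-- The permutation of the alphabet given by the reflection `s_β`. -/
def PosRoot.perm {n : ℕ} : PosRoot n → Equiv.Perm (Letter n)
  | .sub i j _ => Equiv.swap (unbarred i) (unbarred j) *
      Equiv.swap (bar (unbarred j)) (bar (unbarred i))
  | .add i j _ => Equiv.swap (unbarred i) (bar (unbarred j)) *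
      Equiv.swap (unbarred j) (bar (unbarred i))
  | .long i => Equiv.swap (unbarred i) (bar (unbarred i))

lemma bar_bar {n : ℕ} (x : Letter n) : bar (bar x) = x := Fin.rev_rev x

lemma bar_injective {n : ℕ} : Function.Injective (bar : Letter n → Letter n) :=
  Fin.rev_injective

lemma swap_bar {n : ℕ} (a b x : Letter n) :
    Equiv.swap a b (bar x) = bar (Equiv.swap (bar a) (bar b) x) := by
  rw [bar_injective.map_swap, bar_bar, bar_bar]

lemma swap_mul_swap_comm {α : Type*} [DecidableEq α] {a b c d : α}
    (hac : a ≠ c) (had : a ≠ d) (hbc : b ≠ c) (hbd : b ≠ d) :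
    Equiv.swap a b * Equiv.swap c d = Equiv.swap c d * Equiv.swap a b := by
  ext x
  simp only [Equiv.Perm.mul_apply, Equiv.swap_apply_def]
  split_ifs <;> simp_all

lemma PosRoot.perm_mem {n : ℕ} (β : PosRoot n) : β.perm ∈ SignedPerm n := by
  intro x
  cases β with
  | sub i j h =>
    have h' : i.val < j.val := h
    simp only [PosRoot.perm]
    rw [swap_mul_swap_comm, Equiv.Perm.mul_apply, Equiv.Perm.mul_apply, swap_bar, swap_bar,
      bar_bar, bar_bar, Equiv.swap_comm (bar (unbarred i)), ← Equiv.Perm.mul_apply,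
      ← Equiv.Perm.mul_apply, swap_mul_swap_comm, Equiv.swap_comm (unbarred j),
      swap_mul_swap_comm]
    all_goals
      intro e
      have := congrArg Fin.val e
      simp [bar, unbarred, Fin.val_rev] at this
      omega
  | add i j h =>
    have h' : i.val < j.val := h
    simp only [PosRoot.perm]
    rw [swap_mul_swap_comm, Equiv.Perm.mul_apply, Equiv.Perm.mul_apply, swap_bar, swap_bar,
      bar_bar, bar_bar, Equiv.swap_comm (bar (unbarred i)), Equiv.swap_comm (bar (unbarred j)),
      ← Equiv.Perm.mul_apply, ← Equiv.Perm.mul_apply, swap_mul_swap_comm]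
    all_goals
      intro e
      have := congrArg Fin.val e
      simp [bar, unbarred, Fin.val_rev] at this
      omega
  | long i =>
    simp only [PosRoot.perm]
    rw [swap_bar, bar_bar, Equiv.swap_comm]

/-- The reflection `s_β` as an element of `B_n`. -/
def PosRoot.refl {n : ℕ} (β : PosRoot n) : SignedPerm n := ⟨β.perm, β.perm_mem⟩

/-- The (strict) Bruhat order on `B_n`: the transitive closure of the relations `w < w s_β` for
positive roots `β` with `ℓ(w) < ℓ(w s_β)`. -/
def BruhatLT {n : ℕ} : SignedPerm n → SignedPerm n → Prop :=
  Relation.TransGen (fun u v => length u < length v ∧ ∃ β : PosRoot n, v = u * β.refl)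

/-! ### The chain of roots attached to a dominant weight -/

/-- `(1, ī), (2, ī), …, (i - 1, ī)`. -/
def rootsBelow {n : ℕ} (i : Fin n) : List (PosRoot n) :=
  (List.finRange n).filterMap (fun j => if h : j < i then some (PosRoot.add j i h) else none)

/-- `(i, m̄)` for `m > i`, `m = k + 1, …, n`, in increasing order of `m`. -/
def rootsAdd {n : ℕ} (k : ℕ) (i : Fin n) : List (PosRoot n) :=
  (List.finRange n).filterMap
    (fun m => if h : i < m ∧ k ≤ m.val then some (PosRoot.add i m h.1) else none)

/-- `(i, m)` for `m > i`, `m = n, n - 1, …, k + 1`, in decreasing order of `m`. -/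
def rootsSub {n : ℕ} (k : ℕ) (i : Fin n) : List (PosRoot n) :=
  (List.finRange n).reverse.filterMap
    (fun m => if h : i < m ∧ k ≤ m.val then some (PosRoot.sub i m h.1) else none)

/-- `1, …, k`, as elements of the index set of size `n`. -/
def firstRows (n k : ℕ) : List (Fin n) := (List.finRange n).filter (fun i => i.val < k)

/-- `Γ_r(k) = Γ_2 … Γ_k` (the sequence `Γ_1` is empty). -/
def gammaR (n k : ℕ) : List (PosRoot n) := (firstRows n k).flatMap rootsBelow

/-- `Γ_l(k) = Γ_{k1} … Γ_{kk}`. -/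
def gammaL (n k : ℕ) : List (PosRoot n) :=
  (firstRows n k).flatMap
    (fun i => rootsBelow i ++ rootsAdd k i ++ [PosRoot.long i] ++ rootsSub k i)

/-- `Γ(k) = Γ_r(k) Γ_l(k)`. -/
def gamma (n k : ℕ) : List (PosRoot n) := gammaR n k ++ gammaL n k

/-- The height `μ'_{c+1}` of column `c + 1` of the Young diagram of `μ`. -/
def height {n : ℕ} (μ : Fin n → ℕ) (c : ℕ) : ℕ :=
  ((Finset.univ : Finset (Fin n)).filter (fun i => c < μ i)).card

lemma height_le {n : ℕ} (μ : Fin n → ℕ) (c : ℕ) : height μ c ≤ n := by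
  simpa [height] using Finset.card_filter_le (Finset.univ : Finset (Fin n)) (fun i => c < μ i)

lemma height_antitone {n : ℕ} (μ : Fin n → ℕ) : Antitone (height μ) := by
  intro a b hab
  exact Finset.card_le_card fun i hi => by
    simp only [Finset.mem_filter] at hi ⊢
    exact ⟨hi.1, lt_of_le_of_lt hab hi.2⟩

/-- The segment `Γ^{μ_1} Γ^{μ_1 - 1} … Γ^{c+1}` of the chain of `μ`, where
`Γ^j = Γ(μ'_j)`. -/
def chainSegment {n : ℕ} [NeZero n] (μ : Fin n → ℕ) (c : ℕ) : List (PosRoot n) :=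
  (List.range' c (μ 0 - c)).reverse.flatMap (fun d => gamma n (height μ d))

/-- The chain `Γ = Γ^{μ_1} … Γ^1`. -/
def chain {n : ℕ} [NeZero n] (μ : Fin n → ℕ) : List (PosRoot n) := chainSegment μ 0

/-! ### Folding pairs -/

/-- The set `W × 2^{[m]}` of folding pairs of a sequence of `m` roots. -/
abbrev FoldingPair {n : ℕ} (Γ : List (PosRoot n)) : Type :=
  SignedPerm n × Finset (Fin Γ.length)

/-- For a folding pair `(w, J)`, the product `w r_{j_1} … r_{j_i}`, where `j_1 < … < j_i` are the
elements of `J` among the first `p` positions of the chain. -/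
def walk {n : ℕ} {Γ : List (PosRoot n)} (F : FoldingPair Γ) (p : ℕ) : SignedPerm n :=
  F.1 * (((List.finRange Γ.length).filter (fun q => q ∈ F.2 ∧ q.val < p)).map
    (fun q => (Γ.get q).refl)).prod

/-- `end(w, J)`. -/
def endPoint {n : ℕ} {Γ : List (PosRoot n)} (F : FoldingPair Γ) : SignedPerm n :=
  walk F Γ.length

open Classical in
/-- The set `J⁻` of negative foldings: the `j = j_i ∈ J` with `w_{i-1} < w_i` in Bruhat order. -/
noncomputable def negFoldings {n : ℕ} {Γ : List (PosRoot n)} (F : FoldingPair Γ) :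
    Finset (Fin Γ.length) :=
  F.2.filter (fun j => BruhatLT (walk F j.val) (walk F (j.val + 1)))

/-- The set of folding pairs `(w, J)` with
`½ (ℓ(w) + ℓ(end(w, J)) - #J) + ∑_{j ∈ J⁻} ⟨ρ, β_j^∨⟩ = 0`. -/
def FBar {n : ℕ} (Γ : List (PosRoot n)) : Set (FoldingPair Γ) :=
  {F | (1 / 2 : ℚ) * ((length F.1 : ℚ) + (length (endPoint F) : ℚ) - (F.2.card : ℚ)) +
      ∑ j ∈ negFoldings F, rhoCoroot (Γ.get j) = 0}

/-! ### Fillings and the filling map -/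

/-- A sequence of columns `C_r^{μ_1} C_l^{μ_1} … C_r^1 C_l^1` filled with letters, `C_r^j` and
`C_l^j` having height `μ'_j`; here `right c` and `left c` are `C_r^{c+1}` and `C_l^{c+1}`. -/
@[ext]
structure Filling {n : ℕ} [NeZero n] (μ : Fin n → ℕ) : Type where
  right : (c : Fin (μ 0)) → Fin (height μ c.val) → Letter n
  left : (c : Fin (μ 0)) → Fin (height μ c.val) → Letter n

/-- The entries of a column have distinct absolute values. -/
def DistinctAbs {n k : ℕ} (C : Fin k → Letter n) : Prop :=
  Function.Injective (fun i => absLetter (C i))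

/-- `u[1, k] = u(1) … u(k)`. -/
def window {n k : ℕ} (u : SignedPerm n) (hk : k ≤ n) : Fin k → Letter n :=
  fun i => u.1 (unbarred (Fin.castLE hk i))

/-- The filling map: `C_r^j = π_r^j[1, μ'_j]` and `C_l^j = π_l^j[1, μ'_j]`, where
`π_r^j = w T^{μ_1} … T^{j+1}` and `π_l^j = π_r^j T_r^j`. -/
def fillingMap {n : ℕ} [NeZero n] (μ : Fin n → ℕ) (F : FoldingPair (chain μ)) : Filling μ where
  right := fun c =>
    window (walk F (chainSegment μ (c.val + 1)).length) (height_le μ c.val)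
  left := fun c =>
    window (walk F ((chainSegment μ (c.val + 1)).length + (gammaR n (height μ c.val)).length))
      (height_le μ c.val)

/-! ### Conditions on columns -/

/-- `a ≺ b ≺ c` in the circular order starting at `a`. -/
def CircLT {n : ℕ} (a b c : Letter n) : Prop :=
  (a < b ∧ b < c) ∨ (b < c ∧ c < a) ∨ (c < a ∧ a < b)

/-- The condition on a pair of adjacent columns `C' C` (`C'` to the left of `C`, so not longer):
for `i < l ≤ #C'`, both `C(i) = C'(l)` and `C(i) ≺ C'(l) ≺ C'(i)` are false. -/
def AdjacentCond {n k' k : ℕ} (hk : k' ≤ k) (C' : Fin k' → Letter n) (C : Fin k → Letter n) :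
    Prop :=
  ∀ i l : Fin k', i < l →
    C (Fin.castLE hk i) ≠ C' l ∧ ¬ CircLT (C (Fin.castLE hk i)) (C' l) (C' i)

/-- Sorting a column increasingly. -/
def ord {n k : ℕ} (C : Fin k → Letter n) : Fin k → Letter n := C ∘ Tuple.sort C

/-- `z_1 > … > z_r` are the unbarred letters `z` such that `z` and `z̄` both occur in `D`, and
`t_1 > … > t_r` are unbarred letters such that each `t_i` is the greatest unbarred letter `t` with
`t < z_i`, `t < t_{i-1}` (if `i ≥ 2`), `t ∉ D`, and `t̄ ∉ D`. -/
def SplitData {n k r : ℕ} (D : Fin k → Letter n) (z t : Fin r → Letter n) : Prop :=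
  StrictAnti z ∧
  Set.range z = {x | IsUnbarred x ∧ x ∈ Set.range D ∧ bar x ∈ Set.range D} ∧
  ∀ i : Fin r, IsGreatest
    {x | IsUnbarred x ∧ x < z i ∧ (∀ j : Fin r, j.val + 1 = i.val → x < t j) ∧
      x ∉ Set.range D ∧ bar x ∉ Set.range D} (t i)

/-- Kashiwara-Nakashima columns: strictly increasing columns which can be split. -/
def IsKNColumn {n k : ℕ} (D : Fin k → Letter n) : Prop :=
  StrictMono D ∧ ∃ (r : ℕ) (z t : Fin r → Letter n), SplitData D z t

/-- `R = rD` and `L = lD`: the increasing columns whose entries are obtained from those of `D` by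
changing each `z̄_i` into `t̄_i`, respectively each `z_i` into `t_i`. -/
def IsSplitting {n k : ℕ} (D R L : Fin k → Letter n) : Prop :=
  ∃ (r : ℕ) (z t : Fin r → Letter n), SplitData D z t ∧
    StrictMono R ∧
    Set.range R = (Set.range D \ Set.range (fun i => bar (z i))) ∪ Set.range (fun i => bar (t i)) ∧
    StrictMono L ∧
    Set.range L = (Set.range D \ Set.range z) ∪ Set.range t

/-- Fillings of the shape `2μ` (each column having entries with distinct absolute values)
satisfying the three conditions (first left column, split columns, adjacent columns). -/
structure Admissible {n : ℕ} [NeZero n] {μ : Fin n → ℕ} (σ : Filling μ) : Prop where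
  distinct_right : ∀ c, DistinctAbs (σ.right c)
  distinct_left : ∀ c, DistinctAbs (σ.left c)
  /-- `C_l^1` is increasing. -/
  first_increasing : ∀ c : Fin (μ 0), c.val = 0 → StrictMono (σ.left c)
  /-- `(ord C_r^j, ord C_l^j) = (rD, lD)` for some KN column `D`. -/
  split : ∀ c : Fin (μ 0), ∃ D : Fin (height μ c.val) → Letter n,
    IsKNColumn D ∧ IsSplitting D (ord (σ.right c)) (ord (σ.left c))
  /-- The adjacent columns `C_r^j C_l^j` satisfy the condition. -/
  adjacent_inner : ∀ c : Fin (μ 0), AdjacentCond le_rfl (σ.right c) (σ.left c)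
  /-- The adjacent columns `C_l^{j+1} C_r^j` satisfy the condition. -/
  adjacent_outer : ∀ (c : ℕ) (h : c + 1 < μ 0),
    AdjacentCond (height_antitone μ (Nat.le_succ c))
      (σ.left ⟨c + 1, h⟩) (σ.right ⟨c, Nat.lt_of_succ_lt h⟩)

end TypeC

/-! The equation defining `FBar` is an equality case. Since `s_β` changes the length by at most
`2⟨ρ, β^∨⟩ - 1` upwards, telescoping `ℓ` along the walk turns the statistic into `ℓ(end)` plus one
nonnegative defect per folding. It vanishes exactly when the walk ends at `1` and every folding,
read backwards, is an edge of the quantum Bruhat graph (`mem_FBar_iff`). In terms of the values of a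
signed permutation, these edges are described by `sub_step`, `long_step` and `add_step`: no value of
certain later rows lies on the circular arc along which the value of a row moves; for `ε_i + ε_j`
the move must also go upwards and preserve the sign of the value.

The chain is therefore read from its right end, starting at the identity, column by column. Inside
`Γ_l(k)` and `Γ_r(k)` the rows are settled in the order `k, …, 1`. Fix a target column `d`.

Uniqueness: within the stage of row `i` the value of that row only advances, and it avoids the
values offered and refused. Two walks that part at some root would yield two arcs with the same end,
each missing the start of the other, which `Av.contra` forbids. This is the property `Separates`,
and `IsTrace.unique` turns it into injectivity.

Existence: accept a root exactly when it moves the row forward without passing its target. Condition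
1' (`RowCond`) makes each accepted move a legal edge, and it survives for the rows still to come.
That the row does reach its target follows from a counting argument on sets of letters closed under
the bar (`mem_of_target_mem`). For `Γ_r(k)` only the roots `(p, ī)` are available, so each row must
in addition move upwards within its sign and pass no letter absent from the column, nor its bar
(`FreeUp`). For a pair of columns satisfying Condition 1' this amounts to `SplitRel`, a comparison
of counts of unbarred letters, which characterises the pairs `(lD, rD)` (`splitRel_of_isSplitting`,
`exists_isSplitting`).

Necessity: composing the avoided arcs backwards along a walk gives Condition 1'
(`rowCond_of_stageL`, `rowCond_of_stageR`); the only delicate point is that the roots `(p, ī)` also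
move the rows `p` (`rowCond_of_back_below`). Next to the identity, Condition 1' says that the column
is increasing (`adjacentCond_window_one`), which is condition (i). -/

namespace TypeC

/-! ### Signed permutations through their values at `1, …, n` -/

/-- The value `w(i)` of a signed permutation at the unbarred letter `i`. -/
def ev {n : ℕ} (w : SignedPerm n) (i : Fin n) : Letter n := w.1 (unbarred i)

lemma val_bar {n : ℕ} (x : Letter n) : (bar x).val = 2 * n - 1 - x.val := by
  simp [bar, Fin.val_rev]; omega

lemma val_unbarred {n : ℕ} (i : Fin n) : (unbarred i).val = i.val := rfl

lemma apply_bar {n : ℕ} (w : SignedPerm n) (x : Letter n) : w.1 (bar x) = bar (w.1 x) := w.2 x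

lemma letter_cases {n : ℕ} (x : Letter n) : ∃ i : Fin n, x = unbarred i ∨ x = bar (unbarred i) := by
  by_cases h : x.val < n
  · exact ⟨⟨x.val, h⟩, Or.inl (Fin.ext rfl)⟩
  · refine ⟨⟨2 * n - 1 - x.val, by omega⟩, Or.inr (Fin.ext ?_)⟩
    rw [val_bar, val_unbarred]
    simp only
    omega

lemma unbarred_ne_bar {n : ℕ} (i j : Fin n) : unbarred i ≠ bar (unbarred j) := by
  intro h
  have := congrArg Fin.val h
  rw [val_bar, val_unbarred, val_unbarred] at this
  omega

lemma unbarred_injective {n : ℕ} : Function.Injective (unbarred : Fin n → Letter n) := by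
  intro i j h
  exact Fin.ext (by simpa [val_unbarred] using congrArg (Fin.val : Letter n → ℕ) h)

lemma ev_ne_bar {n : ℕ} (w : SignedPerm n) (i j : Fin n) : ev w i ≠ bar (ev w j) := by
  rw [ev, ev, ← apply_bar]
  exact fun h => unbarred_ne_bar i j (w.1.injective h)

lemma ev_injective {n : ℕ} (w : SignedPerm n) : Function.Injective (ev w) :=
  w.1.injective.comp unbarred_injective

lemma ev_surjective {n : ℕ} (w : SignedPerm n) (x : Letter n) :
    ∃ i, x = ev w i ∨ x = bar (ev w i) := by
  obtain ⟨y, rfl⟩ := w.1.surjective x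
  obtain ⟨i, rfl | rfl⟩ := letter_cases y
  · exact ⟨i, Or.inl rfl⟩
  · exact ⟨i, Or.inr (apply_bar w _)⟩

lemma ev_ext {n : ℕ} {u w : SignedPerm n} (h : ∀ i, ev u i = ev w i) : u = w := by
  apply Subtype.ext
  apply Equiv.ext
  intro x
  obtain ⟨i, rfl | rfl⟩ := letter_cases x
  · exact h i
  · rw [apply_bar, apply_bar]
    exact congrArg bar (h i)

lemma ev_one {n : ℕ} (i : Fin n) : ev (1 : SignedPerm n) i = unbarred i := rfl

lemma ev_mul_sub {n : ℕ} (w : SignedPerm n) {i j : Fin n} (h : i < j) (p : Fin n) :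
    ev (w * (PosRoot.sub i j h).refl) p =
      if p = i then ev w j else if p = j then ev w i else ev w p := by
  have h1 : Equiv.swap (bar (unbarred j)) (bar (unbarred i)) (unbarred p) = unbarred p :=
    Equiv.swap_apply_of_ne_of_ne (unbarred_ne_bar _ _) (unbarred_ne_bar _ _)
  change w.1 ((Equiv.swap (unbarred i) (unbarred j))
    (Equiv.swap (bar (unbarred j)) (bar (unbarred i)) (unbarred p))) = _
  rw [h1, Equiv.swap_apply_def]
  simp only [unbarred_injective.eq_iff]
  split_ifs <;> rfl

lemma ev_mul_add {n : ℕ} (w : SignedPerm n) {i j : Fin n} (h : i < j) (p : Fin n) :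
    ev (w * (PosRoot.add i j h).refl) p =
      if p = i then bar (ev w j) else if p = j then bar (ev w i) else ev w p := by
  change w.1 ((Equiv.swap (unbarred i) (bar (unbarred j)))
    (Equiv.swap (unbarred j) (bar (unbarred i)) (unbarred p))) = _
  by_cases hj : p = j
  · subst hj
    rw [Equiv.swap_apply_left, Equiv.swap_apply_of_ne_of_ne (unbarred_ne_bar _ _).symm
      (fun e => h.ne (unbarred_injective (bar_injective e))), apply_bar, if_neg h.ne', if_pos rfl]
    rfl
  · rw [Equiv.swap_apply_of_ne_of_ne (fun e => hj (unbarred_injective e)) (unbarred_ne_bar _ _),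
      Equiv.swap_apply_def]
    simp only [unbarred_injective.eq_iff, unbarred_ne_bar, if_false, if_neg hj]
    split_ifs
    · exact apply_bar _ _
    · rfl

lemma ev_mul_long {n : ℕ} (w : SignedPerm n) (i p : Fin n) :
    ev (w * (PosRoot.long i).refl) p = if p = i then bar (ev w i) else ev w p := by
  change w.1 (Equiv.swap (unbarred i) (bar (unbarred i)) (unbarred p)) = _
  rw [Equiv.swap_apply_def]
  simp only [unbarred_injective.eq_iff, unbarred_ne_bar, if_false]
  split_ifs
  · exact apply_bar _ _
  · rfl

lemma mul_refl_mul_refl {n : ℕ} (w : SignedPerm n) (β : PosRoot n) :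
    w * β.refl * β.refl = w := by
  apply ev_ext
  intro p
  cases β with
  | sub i j h =>
    simp only [ev_mul_sub]
    split_ifs <;> simp_all
  | add i j h =>
    simp only [ev_mul_add]
    split_ifs <;> simp_all [bar_bar]
  | long i =>
    simp only [ev_mul_long]
    split_ifs <;> simp_all [bar_bar]

lemma mul_refl_ne {n : ℕ} (w : SignedPerm n) (β : PosRoot n) : w * β.refl ≠ w := by
  intro e
  cases β with
  | sub i j h =>
    have := congrArg (fun v => ev v i) e
    simp only [ev_mul_sub, if_true] at this
    exact h.ne' (ev_injective w this)
  | add i j h =>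
    have := congrArg (fun v => ev v i) e
    simp only [ev_mul_add, if_true] at this
    exact ev_ne_bar _ _ _ this.symm
  | long i =>
    have := congrArg (fun v => ev v i) e
    simp only [ev_mul_long, if_true] at this
    exact ev_ne_bar _ _ _ this.symm

/-! ### Length in terms of the values at the unbarred letters -/

/-- The contribution of the rows `p`, `q` to the length. -/
def invTerm {n : ℕ} (a : Fin n → Letter n) (p q : Fin n) : ℤ :=
  if p ≤ q then (if (a q).val < (a p).val then 1 else 0) +
    (if 2 * n - 1 - (a q).val < (a p).val then 1 else 0) else 0

lemma sum_letter {n : ℕ} {M : Type*} [AddCommMonoid M] (f : Letter n → M) :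
    ∑ x, f x = ∑ i : Fin n, (f (unbarred i) + f (bar (unbarred i))) := by
  have key := Fintype.sum_sum_type (Sum.elim (fun i : Fin n => f (unbarred i))
    (fun i : Fin n => f (bar (unbarred i))))
  simp only [Sum.elim_inl, Sum.elim_inr] at key
  rw [Finset.sum_add_distrib, ← key]
  symm
  refine Fintype.sum_bijective (Sum.elim unbarred (fun i => bar (unbarred i))) ⟨?_, ?_⟩ _ _ ?_
  · rintro (i | i) (j | j) h
    · exact congrArg _ (unbarred_injective h)
    · exact absurd h (unbarred_ne_bar _ _)
    · exact absurd h.symm (unbarred_ne_bar _ _)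
    · exact congrArg _ (unbarred_injective (bar_injective h))
  · intro x
    obtain ⟨i, h | h⟩ := letter_cases x
    · exact ⟨Sum.inl i, h.symm⟩
    · exact ⟨Sum.inr i, h.symm⟩
  · rintro (i | i) <;> rfl

lemma absLetter_unbarred {n : ℕ} (i : Fin n) : absLetter (unbarred i) = unbarred i := by
  rw [absLetter, min_eq_left]
  rw [Fin.le_def, val_bar, val_unbarred]
  omega

lemma absLetter_bar {n : ℕ} (x : Letter n) : absLetter (bar x) = absLetter x := by
  rw [absLetter, absLetter, bar_bar, min_comm]

lemma length_eq_sum {n : ℕ} (w : SignedPerm n) :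
    (length w : ℤ) = ∑ p, ∑ q, invTerm (ev w) p q := by
  rw [length, Finset.card_filter, Nat.cast_sum, Fintype.sum_prod_type]
  refine Finset.sum_congr rfl fun p _ => ?_
  rw [sum_letter]
  refine Finset.sum_congr rfl fun q _ => ?_
  simp only [absLetter_bar, absLetter_unbarred, apply_bar, invTerm, ev, Fin.lt_def, val_bar]
  have : unbarred p ≤ unbarred q ↔ p ≤ q := Iff.rfl
  simp only [this]
  by_cases hpq : p ≤ q <;> simp [hpq]
  congr

/-- The contribution of the rows `m` and `i` to the length. -/
def pairTerm {n : ℕ} (a : Fin n → Letter n) (i m : Fin n) : ℤ := invTerm a i m + invTerm a m i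

lemma sum_sum_sub_single {n : ℕ} (a b : Fin n → Letter n) (i : Fin n)
    (h : ∀ p, p ≠ i → a p = b p) :
    ∑ p, ∑ q, invTerm a p q - ∑ p, ∑ q, invTerm b p q =
      (invTerm a i i - invTerm b i i) +
        ∑ m ∈ Finset.univ.erase i, (pairTerm a i m - pairTerm b i m) := by
  have hD : ∀ p q, p ≠ i → q ≠ i → invTerm a p q - invTerm b p q = 0 := by
    intro p q hp hq
    rw [invTerm, invTerm, h p hp, h q hq, sub_self]
  generalize hf : (fun p q => invTerm a p q - invTerm b p q) = f at hD
  have hf' : ∀ p q, invTerm a p q - invTerm b p q = f p q := fun p q => by rw [← hf]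
  have hpt : ∀ m, pairTerm a i m - pairTerm b i m = f i m + f m i := by
    intro m; rw [← hf', ← hf', pairTerm, pairTerm]; ring
  simp only [← Finset.sum_sub_distrib, hf', hpt, Finset.sum_add_distrib] at hD ⊢
  rw [← Finset.add_sum_erase _ _ (Finset.mem_univ i), ← Finset.add_sum_erase _ _ (Finset.mem_univ i)]
  rw [add_assoc]
  congr 2
  refine Finset.sum_congr rfl fun p hp => ?_
  refine Finset.sum_eq_single i (fun q _ hq => hD p q (Finset.ne_of_mem_erase hp) hq) (by simp)

/-- Row `i` is changed first, giving the intermediate `Function.update b i (a i)`, and then row `j`.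
The term of the pair `(i, j)` telescopes and is kept apart from those of the other rows. -/
lemma sum_sum_sub_pair {n : ℕ} (a b : Fin n → Letter n) (i j : Fin n) (hij : i ≠ j)
    (h : ∀ p, p ≠ i → p ≠ j → a p = b p) :
    ∑ p, ∑ q, invTerm a p q - ∑ p, ∑ q, invTerm b p q =
      (invTerm a i i - invTerm b i i) + (invTerm a j j - invTerm b j j) +
        (pairTerm a i j - pairTerm b i j) +
        ∑ m ∈ (Finset.univ.erase i).erase j,
          ((pairTerm a i m + pairTerm a j m) - (pairTerm b i m + pairTerm b j m)) := by
  have h1 := sum_sum_sub_single a (Function.update b i (a i)) j (by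
    intro p hp
    by_cases hpi : p = i
    · subst hpi; simp
    · rw [Function.update_of_ne hpi, h p hpi hp])
  have h2 := sum_sum_sub_single (Function.update b i (a i)) b i (by
    intro p hp
    rw [Function.update_of_ne hp])
  rw [← sub_add_sub_cancel, h1, h2, Finset.erase_right_comm,
    ← Finset.add_sum_erase (Finset.univ.erase j) _ (Finset.mem_erase.2 ⟨hij, Finset.mem_univ i⟩),
    ← Finset.add_sum_erase (Finset.univ.erase i) _ (Finset.mem_erase.2 ⟨hij.symm, Finset.mem_univ j⟩),
    Finset.erase_right_comm]
  have e1 : invTerm (Function.update b i (a i)) j j = invTerm b j j := by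
    simp [invTerm, Function.update_of_ne hij.symm]
  have e2 : invTerm (Function.update b i (a i)) i i = invTerm a i i := by
    simp [invTerm]
  have e3 : pairTerm a j i = pairTerm a i j := add_comm _ _
  have e4 : pairTerm (Function.update b i (a i)) j i = pairTerm (Function.update b i (a i)) i j :=
    add_comm _ _
  have e5 : ∀ m ∈ (Finset.univ.erase i).erase j,
      (pairTerm a i m + pairTerm a j m) - (pairTerm b i m + pairTerm b j m) =
      (pairTerm a j m - pairTerm (Function.update b i (a i)) j m) +
      (pairTerm (Function.update b i (a i)) i m - pairTerm b i m) := by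
    intro m hm
    simp only [Finset.mem_erase] at hm
    have : pairTerm (Function.update b i (a i)) j m = pairTerm b j m := by
      simp [pairTerm, invTerm, Function.update_of_ne hij.symm, Function.update_of_ne hm.2.1]
    rw [this]
    have : pairTerm (Function.update b i (a i)) i m = pairTerm a i m := by
      simp [pairTerm, invTerm, Function.update_of_ne hm.2.1, h m hm.2.1 hm.1]
    rw [this]
    ring
  rw [Finset.sum_congr rfl e5, Finset.sum_add_distrib, e1, e2, e3, e4, Finset.erase_right_comm]
  ring

/-! ### Coroot pairings, steps, and length changes pair by pair -/

lemma rhoCoroot_sub {n : ℕ} {i j : Fin n} (h : i < j) :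
    rhoCoroot (PosRoot.sub i j h) = (j.val : ℚ) - i.val := by
  have h1 : dotProduct (PosRoot.sub i j h).vec (PosRoot.sub i j h).vec = 2 := by
    simp only [PosRoot.vec, dotProduct_sub, dotProduct_single, Pi.sub_apply, Pi.single_eq_same,
      Pi.single_eq_of_ne h.ne, Pi.single_eq_of_ne h.ne']
    norm_num
  rw [rhoCoroot, h1]
  simp only [PosRoot.vec, dotProduct_sub, dotProduct_single, rho]
  ring

lemma rhoCoroot_add {n : ℕ} {i j : Fin n} (h : i < j) :
    rhoCoroot (PosRoot.add i j h) = 2 * (n : ℚ) - i.val - j.val := by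
  have h1 : dotProduct (PosRoot.add i j h).vec (PosRoot.add i j h).vec = 2 := by
    simp only [PosRoot.vec, dotProduct_add, dotProduct_single, Pi.add_apply, Pi.single_eq_same,
      Pi.single_eq_of_ne h.ne, Pi.single_eq_of_ne h.ne']
    norm_num
  rw [rhoCoroot, h1]
  simp only [PosRoot.vec, dotProduct_add, dotProduct_single, rho]
  ring

lemma rhoCoroot_long {n : ℕ} (i : Fin n) :
    rhoCoroot (PosRoot.long i) = (n : ℚ) - i.val := by
  simp only [rhoCoroot, PosRoot.vec, dotProduct_single, rho, Pi.single_eq_same]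
  ring

/-- The steps of the walks of the folding pairs in `FBar`: covers in decreasing direction, and
quantum steps in increasing direction. -/
def Step {n : ℕ} (w : SignedPerm n) (β : PosRoot n) : Prop :=
  (length (w * β.refl) : ℚ) - length w = -1 ∨
    (length (w * β.refl) : ℚ) - length w = 2 * rhoCoroot β - 1

/-- A step from `u s_β` to `u`. -/
def BackStep {n : ℕ} (u : SignedPerm n) (β : PosRoot n) : Prop := Step (u * β.refl) β

lemma val_ne_of_ne {n : ℕ} (w : SignedPerm n) {p q : Fin n} (h : p ≠ q) :
    (ev w p).val ≠ (ev w q).val ∧ (ev w p).val + (ev w q).val ≠ 2 * n - 1 := by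
  refine ⟨fun e => h (ev_injective w (Fin.ext e)), fun e => ev_ne_bar w p q (Fin.ext ?_)⟩
  rw [val_bar]; omega

/-- The contribution of two values `x`, `z`, in this order, to the length. -/
def invVal (n x z : ℕ) : ℤ := (if z < x then 1 else 0) + (if 2 * n - 1 - z < x then 1 else 0)

lemma invTerm_of_le {n : ℕ} (a : Fin n → Letter n) {p q : Fin n} (h : p ≤ q) :
    invTerm a p q = invVal n (a p).val (a q).val := if_pos h

lemma invTerm_of_lt {n : ℕ} (a : Fin n → Letter n) {p q : Fin n} (h : q < p) :
    invTerm a p q = 0 := if_neg h.not_ge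

/-- The second summand of `invVal` compares `x + z` with `2n - 1`, so it is symmetric; only the
first one changes. -/
lemma invVal_comm {n x z : ℕ} (hx : x < 2 * n) (hz : z < 2 * n) (h1 : x ≠ z) :
    invVal n x z = invVal n z x + if z < x then 1 else -1 := by
  simp only [invVal]
  split_ifs <;> omega

lemma invVal_bar_left {n x z : ℕ} (hx : x < 2 * n) (hz : z < 2 * n) (h1 : x ≠ z)
    (h2 : x + z ≠ 2 * n - 1) :
    invVal n (2 * n - 1 - x) z = invVal n x z + if x < z ∧ z < 2 * n - 1 - x then 2 else
      if 2 * n - 1 - x < z ∧ z < x then -2 else 0 := by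
  simp only [invVal]
  split_ifs <;> omega

/-- Barring the second value exchanges the two summands. -/
lemma invVal_bar_right {n x z : ℕ} (hx : x < 2 * n) :
    invVal n z (2 * n - 1 - x) = invVal n z x := by
  have : 2 * n - 1 - (2 * n - 1 - x) = x := by omega
  rw [invVal, invVal, this, add_comm]

/-- A row outside the interval from `i` to `j` is on the same side of both rows, so exchanging their
values changes nothing. A row in between changes its order relative to both values, and the two
changes cancel unless its value separates them. -/
lemma sub_term {n : ℕ} {i j m : Fin n} (hij : i < j) (hi : m ≠ i) (hj : m ≠ j)
    (a b : Fin n → Letter n)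
    (h1 : (a i).val ≠ (a m).val ∧ (a i).val + (a m).val ≠ 2 * n - 1)
    (h2 : (a j).val ≠ (a m).val ∧ (a j).val + (a m).val ≠ 2 * n - 1)
    (bi : b i = a j) (bj : b j = a i) (bm : b m = a m) :
    (pairTerm b i m + pairTerm b j m) - (pairTerm a i m + pairTerm a j m) =
      if i < m ∧ m < j ∧ (a i).val < (a m).val ∧ (a m).val < (a j).val then 2 else
      if i < m ∧ m < j ∧ (a j).val < (a m).val ∧ (a m).val < (a i).val then -2 else 0 := by
  have hx := (a i).isLt
  have hy := (a j).isLt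
  have hz := (a m).isLt
  simp only [pairTerm]
  rcases lt_or_gt_of_ne hi with h | h
  · have h' := h.trans hij
    simp only [invTerm_of_lt _ h, invTerm_of_lt _ h', invTerm_of_le _ h.le, invTerm_of_le _ h'.le,
      bi, bj, bm, h.not_gt, false_and, if_false]
    ring
  rcases lt_or_gt_of_ne hj with h' | h'
  · simp only [invTerm_of_lt _ h, invTerm_of_lt _ h', invTerm_of_le _ h.le, invTerm_of_le _ h'.le,
      bi, bj, bm, h, h', true_and, invVal_comm hx hz h1.1, invVal_comm hy hz h2.1]
    split_ifs <;> omega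
  · simp only [invTerm_of_lt _ h, invTerm_of_lt _ h', invTerm_of_le _ h.le, invTerm_of_le _ h'.le,
      bi, bj, bm, h'.not_gt, false_and, and_false, if_false]
    ring

/-- Rows before `i` do not notice bars, by `invVal_bar_right`. Rows between `i` and `j` behave as in
`sub_term` with the bar of `a j` in place of `a j`. For rows after `j` only the unordered pair of
letters matters, so the effect is that of barring each of the two rows separately. -/
lemma add_term {n : ℕ} {i j m : Fin n} (hij : i < j) (hi : m ≠ i) (hj : m ≠ j)
    (a b : Fin n → Letter n)
    (h1 : (a i).val ≠ (a m).val ∧ (a i).val + (a m).val ≠ 2 * n - 1)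
    (h2 : (a j).val ≠ (a m).val ∧ (a j).val + (a m).val ≠ 2 * n - 1)
    (bi : b i = bar (a j)) (bj : b j = bar (a i)) (bm : b m = a m) :
    (pairTerm b i m + pairTerm b j m) - (pairTerm a i m + pairTerm a j m) =
      (if i < m ∧ m < j then
        (if (a i).val < (a m).val ∧ (a m).val < 2 * n - 1 - (a j).val then 2 else
         if 2 * n - 1 - (a j).val < (a m).val ∧ (a m).val < (a i).val then -2 else 0) else 0) +
      (if j < m then
        (if (a i).val < (a m).val ∧ (a m).val < 2 * n - 1 - (a i).val then 2 else
         if 2 * n - 1 - (a i).val < (a m).val ∧ (a m).val < (a i).val then -2 else 0) +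
        (if (a j).val < (a m).val ∧ (a m).val < 2 * n - 1 - (a j).val then 2 else
         if 2 * n - 1 - (a j).val < (a m).val ∧ (a m).val < (a j).val then -2 else 0) else 0) := by
  have hx := (a i).isLt
  have hy := (a j).isLt
  have hz := (a m).isLt
  simp only [pairTerm]
  rcases lt_or_gt_of_ne hi with h | h
  · have h' := h.trans hij
    simp only [invTerm_of_lt _ h, invTerm_of_lt _ h', invTerm_of_le _ h.le, invTerm_of_le _ h'.le,
      bi, bj, bm, h.not_gt, h'.not_gt, false_and, if_false, val_bar, invVal_bar_right hx,
      invVal_bar_right hy]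
    ring
  rcases lt_or_gt_of_ne hj with h' | h'
  · have hy' : 2 * n - 1 - (a j).val < 2 * n := by omega
    have h2' : 2 * n - 1 - (a j).val ≠ (a m).val := by omega
    simp only [invTerm_of_lt _ h, invTerm_of_lt _ h', invTerm_of_le _ h.le, invTerm_of_le _ h'.le,
      bi, bj, bm, h, h', h'.not_gt, and_self, if_true, if_false, val_bar, invVal_bar_right hx,
      invVal_comm hx hz h1.1, invVal_comm hy' hz h2', invVal_bar_right hy]
    split_ifs <;> omega
  · simp only [invTerm_of_lt _ h, invTerm_of_lt _ h', invTerm_of_le _ h.le, invTerm_of_le _ h'.le,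
      bi, bj, bm, h', h'.not_gt, and_false, if_true, if_false, val_bar,
      invVal_bar_left hx hz h1.1 h1.2, invVal_bar_left hy hz h2.1 h2.2]
    ring

lemma long_term {n : ℕ} {i m : Fin n} (hi : m ≠ i)
    (a b : Fin n → Letter n)
    (h1 : (a i).val ≠ (a m).val ∧ (a i).val + (a m).val ≠ 2 * n - 1)
    (bi : b i = bar (a i)) (bm : b m = a m) :
    pairTerm b i m - pairTerm a i m =
      if i < m then
        (if (a i).val < (a m).val ∧ (a m).val < 2 * n - 1 - (a i).val then 2 else
         if 2 * n - 1 - (a i).val < (a m).val ∧ (a m).val < (a i).val then -2 else 0) else 0 := by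
  simp only [pairTerm, invTerm, bi, bm, val_bar]
  have hx := (a i).isLt
  have hz := (a m).isLt
  generalize (a i).val = x at *
  generalize (a m).val = z at *
  rcases lt_or_gt_of_ne hi with h | h
  · simp only [h.le, h.not_ge, h.not_gt, if_true, if_false]
    split_ifs <;> omega
  · simp only [h.le, h.not_ge, h, if_true, if_false]
    split_ifs <;> omega

lemma sum_ite_between {n : ℕ} {i j : Fin n} (hij : i < j) (c : ℤ) :
    ∑ m ∈ (Finset.univ.erase i).erase j, (if i < m ∧ m < j then c else 0) =
      ((j.val : ℤ) - i.val - 1) * c := by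
  rw [← Finset.sum_filter, Finset.sum_const]
  have : ((Finset.univ.erase i).erase j).filter (fun m => i < m ∧ m < j) = Finset.Ioo i j := by
    ext m
    simp only [Finset.mem_filter, Finset.mem_erase, Finset.mem_univ, Finset.mem_Ioo]
    constructor
    · exact fun h => h.2
    · exact fun h => ⟨⟨h.2.ne, h.1.ne', trivial⟩, h⟩
  have hij' : i.val < j.val := hij
  rw [this, Fin.card_Ioo, nsmul_eq_mul]
  congr 1
  omega

lemma sum_ite_above {n : ℕ} {i j : Fin n} (hij : i ≤ j) (c : ℤ) :
    ∑ m ∈ (Finset.univ.erase i).erase j, (if j < m then c else 0) =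
      ((n : ℤ) - j.val - 1) * c := by
  rw [← Finset.sum_filter, Finset.sum_const]
  have : ((Finset.univ.erase i).erase j).filter (fun m => j < m) = Finset.Ioi j := by
    ext m
    simp only [Finset.mem_filter, Finset.mem_erase, Finset.mem_univ, Finset.mem_Ioi]
    constructor
    · exact fun h => h.2
    · exact fun h => ⟨⟨h.ne', (lt_of_le_of_lt hij h).ne', trivial⟩, h⟩
  rw [this, Fin.card_Ioi, nsmul_eq_mul]
  congr 1
  omega

/-! ### Criteria for steps along the three kinds of reflections -/

/-- The possible length differences `δ = ℓ(u s_β) - ℓ(u)`, and when `u s_β → u` is a step. -/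
def StepBounds {n : ℕ} (u : SignedPerm n) (β : PosRoot n) : Prop :=
  (length (u * β.refl) : ℤ) ≠ length u ∧
    (length u : ℚ) - length (u * β.refl) ≤ 2 * rhoCoroot β - 1 ∧ 1 ≤ rhoCoroot β

lemma backStep_iff_of {n : ℕ} (u : SignedPerm n) (β : PosRoot n) (d r : ℤ)
    (hd : (length (u * β.refl) : ℤ) - length u = d) (hr : rhoCoroot β = r) :
    BackStep u β ↔ d = 1 ∨ d = 1 - 2 * r := by
  have hd' : (length (u * β.refl) : ℚ) - length u = d := by exact_mod_cast hd
  rw [BackStep, Step, mul_refl_mul_refl, hr]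
  constructor
  · rintro (h | h)
    · left
      have : (d : ℚ) = 1 := by linarith
      exact_mod_cast this
    · right
      have : (d : ℚ) = 1 - 2 * r := by linarith
      exact_mod_cast this
  · rintro (h | h)
    · left; rw [h] at hd'; push_cast at hd'; linarith
    · right; rw [h] at hd'; push_cast at hd'; linarith

lemma stepBounds_of {n : ℕ} (u : SignedPerm n) (β : PosRoot n) (d r : ℤ)
    (hd : (length (u * β.refl) : ℤ) - length u = d) (hr : rhoCoroot β = r)
    (h0 : d ≠ 0) (h1 : 1 - 2 * r ≤ d) (h2 : 1 ≤ r) : StepBounds u β := by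
  refine ⟨by omega, ?_, ?_⟩
  · have hd' : (length (u * β.refl) : ℚ) - length u = d := by exact_mod_cast hd
    have h1' : (1 : ℚ) - 2 * r ≤ d := by exact_mod_cast h1
    rw [hr]; linarith
  · rw [hr]; exact_mod_cast h2

/-- Let `N` be the number of rows strictly between `i` and `j` whose value lies between `u(i)` and
`u(j)`. The length changes by `1 + 2N` if `u(i) < u(j)` and by `-1 - 2N` otherwise. A step needs `N
= 0` in the first case and the maximal `N = j - i - 1` in the second; the circular order unifies the
two. -/
lemma sub_step {n : ℕ} (u : SignedPerm n) {i j : Fin n} (hij : i < j) :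
    StepBounds u (.sub i j hij) ∧ (BackStep u (.sub i j hij) ↔
      ∀ m, i < m → m < j → ¬ CircLT (ev u i) (ev u m) (ev u j)) := by
  have hij' : i.val < j.val := hij
  have bi := ev_mul_sub u hij i
  have bj := ev_mul_sub u hij j
  rw [if_pos rfl] at bi
  rw [if_neg hij.ne', if_pos rfl] at bj
  have hd := sum_sum_sub_pair (ev (u * (PosRoot.sub i j hij).refl)) (ev u) i j hij.ne
    (fun p h1 h2 => by rw [ev_mul_sub, if_neg h1, if_neg h2])
  rw [← length_eq_sum, ← length_eq_sum] at hd
  have hs : ∀ m ∈ (Finset.univ.erase i).erase j, _ := fun m hm => by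
    simp only [Finset.mem_erase] at hm
    exact sub_term hij hm.2.1 hm.1 (ev u) (ev (u * (PosRoot.sub i j hij).refl))
      (val_ne_of_ne u (Ne.symm hm.2.1)) (val_ne_of_ne u (Ne.symm hm.1)) bi bj
      (by rw [ev_mul_sub, if_neg hm.2.1, if_neg hm.1])
  rw [Finset.sum_congr rfl hs] at hd
  have hr : rhoCoroot (PosRoot.sub i j hij) = (((j.val : ℤ) - i.val : ℤ) : ℚ) := by
    rw [rhoCoroot_sub]; push_cast; rfl
  have hx := (ev u i).isLt
  have hy := (ev u j).isLt
  have hne := val_ne_of_ne u hij.ne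
  have h0 : (invTerm (ev (u * (PosRoot.sub i j hij).refl)) i i - invTerm (ev u) i i) +
    (invTerm (ev (u * (PosRoot.sub i j hij).refl)) j j - invTerm (ev u) j j) +
        (pairTerm (ev (u * (PosRoot.sub i j hij).refl)) i j - pairTerm (ev u) i j) =
        if (ev u i).val < (ev u j).val then 1 else -1 := by
    rw [pairTerm, pairTerm, invTerm_of_lt _ hij, invTerm_of_lt _ hij, invTerm_of_le _ hij.le,
      invTerm_of_le _ hij.le, invTerm_of_le _ le_rfl, invTerm_of_le _ le_rfl,
      invTerm_of_le _ le_rfl, invTerm_of_le _ le_rfl, bi, bj, invVal_comm hy hx hne.1.symm]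
    ring
  rw [h0] at hd
  -- If `u(i) > u(j)`, the circular arc from `u(i)` to `u(j)` is the complement of the linear
  -- interval between them.
  have hc : ∀ m, i < m → m < j → (CircLT (ev u i) (ev u m) (ev u j) ↔
      if (ev u i).val < (ev u j).val then (ev u i).val < (ev u m).val ∧ (ev u m).val < (ev u j).val
      else ¬ ((ev u j).val < (ev u m).val ∧ (ev u m).val < (ev u i).val)) := by
    intro m h1 h2
    have := val_ne_of_ne u h1.ne
    have := val_ne_of_ne u h2.ne
    simp only [CircLT, Fin.lt_def]
    split_ifs <;> omega
  by_cases hxy : (ev u i).val < (ev u j).val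
  · simp only [hxy, if_true] at hd hc
    rw [Finset.sum_congr rfl (g := fun m => if i < m ∧ m < j ∧ (ev u i).val < (ev u m).val ∧
      (ev u m).val < (ev u j).val then 2 else 0)
      (fun m _ => by split_ifs <;> first | rfl | omega)] at hd
    have hnn : ∀ m ∈ (Finset.univ.erase i).erase j, (0 : ℤ) ≤ if i < m ∧ m < j ∧
      (ev u i).val < (ev u m).val ∧ (ev u m).val < (ev u j).val then 2 else 0 := by
      intro m _; split_ifs <;> norm_num
    have hS := Finset.sum_nonneg hnn
    have hS0 := Finset.sum_eq_zero_iff_of_nonneg hnn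
    refine ⟨stepBounds_of u _ _ _ hd hr (by omega) (by omega) (by omega), ?_⟩
    rw [backStep_iff_of u _ _ _ hd hr]
    have : ((1 : ℤ) + (∑ m ∈ (Finset.univ.erase i).erase j, if i < m ∧ m < j ∧
      (ev u i).val < (ev u m).val ∧ (ev u m).val < (ev u j).val then (2 : ℤ) else 0) = 1 ∨
      (1 : ℤ) + (∑ m ∈ (Finset.univ.erase i).erase j, if i < m ∧ m < j ∧
      (ev u i).val < (ev u m).val ∧ (ev u m).val < (ev u j).val then (2 : ℤ) else 0) =
        1 - 2 * ((j.val : ℤ) - i.val)) ↔ (∑ m ∈ (Finset.univ.erase i).erase j, if i < m ∧ m < j ∧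
      (ev u i).val < (ev u m).val ∧ (ev u m).val < (ev u j).val then (2 : ℤ) else 0) = 0 := by
      omega
    rw [this, hS0]
    constructor
    · intro h m h1 h2 hcirc
      have := h m (by simp [h1.ne', h2.ne])
      rw [hc m h1 h2] at hcirc
      rw [if_pos ⟨h1, h2, hcirc⟩] at this
      omega
    · intro h m _
      rw [if_neg]
      rintro ⟨h1, h2, h3⟩
      exact h m h1 h2 ((hc m h1 h2).2 h3)
  · simp only [hxy, if_false] at hd hc
    rw [Finset.sum_congr rfl (g := fun m => if i < m ∧ m < j ∧ (ev u j).val < (ev u m).val ∧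
      (ev u m).val < (ev u i).val then -2 else 0)
      (fun m _ => by split_ifs <;> first | rfl | omega)] at hd
    -- The lower bound sums to `-2 (j - i - 1)`, which with the `-1` from the rows `i, j` is the
    -- quantum value `1 - 2 (j - i)`. Equality of the sums forces equality of all terms.
    have hnn : ∀ m ∈ (Finset.univ.erase i).erase j, (if i < m ∧ m < j then (-2 : ℤ) else 0) ≤
      if i < m ∧ m < j ∧
      (ev u j).val < (ev u m).val ∧ (ev u m).val < (ev u i).val then -2 else 0 := by
      intro m _; split_ifs <;> first | (norm_num; done) | tauto
    have hS := Finset.sum_le_sum hnn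
    have hS0 := Finset.sum_eq_sum_iff_of_le hnn
    have hSn : (∑ m ∈ (Finset.univ.erase i).erase j, if i < m ∧ m < j ∧
      (ev u j).val < (ev u m).val ∧ (ev u m).val < (ev u i).val then (-2 : ℤ) else 0) ≤ 0 := by
      apply Finset.sum_nonpos
      intro m _; split_ifs <;> norm_num
    rw [sum_ite_between hij] at hS hS0
    refine ⟨stepBounds_of u _ _ _ hd hr (by omega) (by omega) (by omega), ?_⟩
    rw [backStep_iff_of u _ _ _ hd hr]
    have : ((-1 : ℤ) + (∑ m ∈ (Finset.univ.erase i).erase j, if i < m ∧ m < j ∧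
      (ev u j).val < (ev u m).val ∧ (ev u m).val < (ev u i).val then (-2 : ℤ) else 0) = 1 ∨
      (-1 : ℤ) + (∑ m ∈ (Finset.univ.erase i).erase j, if i < m ∧ m < j ∧
      (ev u j).val < (ev u m).val ∧ (ev u m).val < (ev u i).val then (-2 : ℤ) else 0) =
        1 - 2 * ((j.val : ℤ) - i.val)) ↔ ((j.val : ℤ) - i.val - 1) * -2 =
        (∑ m ∈ (Finset.univ.erase i).erase j, if i < m ∧ m < j ∧
      (ev u j).val < (ev u m).val ∧ (ev u m).val < (ev u i).val then (-2 : ℤ) else 0) := by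
      omega
    rw [this, hS0]
    constructor
    · intro h m h1 h2 hcirc
      have := h m (by simp [h1.ne', h2.ne])
      rw [hc m h1 h2] at hcirc
      rw [if_pos ⟨h1, h2⟩, if_neg (fun hh => hcirc hh.2.2)] at this
      omega
    · intro h m _
      by_cases h1 : i < m ∧ m < j
      · have h2 := h m h1.1 h1.2
        rw [hc m h1.1 h1.2, not_not] at h2
        rw [if_pos h1, if_pos ⟨h1.1, h1.2, h2⟩]
      · rw [if_neg h1, if_neg (fun hh => h1 ⟨hh.1, hh.2.1⟩)]

/-- As for `sub_step`, with the bar of `u(i)` in place of `u(j)`: the rows concerned are all rows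
after `i`, and the case distinction is whether `u(i)` is unbarred. -/
lemma long_step {n : ℕ} (u : SignedPerm n) (i : Fin n) :
    StepBounds u (.long i) ∧ (BackStep u (.long i) ↔
      ∀ m, i < m → ¬ CircLT (ev u i) (ev u m) (bar (ev u i))) := by
  have hi := i.isLt
  have bi := ev_mul_long u i i
  rw [if_pos rfl] at bi
  have hd := sum_sum_sub_single (ev (u * (PosRoot.long i).refl)) (ev u) i
    (fun p h1 => by rw [ev_mul_long, if_neg h1])
  rw [← length_eq_sum, ← length_eq_sum] at hd
  have hs : ∀ m ∈ Finset.univ.erase i, _ := fun m hm => by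
    simp only [Finset.mem_erase] at hm
    exact long_term hm.1 (ev u) (ev (u * (PosRoot.long i).refl))
      (val_ne_of_ne u (Ne.symm hm.1)) bi (by rw [ev_mul_long, if_neg hm.1])
  rw [Finset.sum_congr rfl hs] at hd
  have hr : rhoCoroot (PosRoot.long i) = (((n : ℤ) - i.val : ℤ) : ℚ) := by
    rw [rhoCoroot_long]; push_cast; rfl
  have hx := (ev u i).isLt
  have h0 : invTerm (ev (u * (PosRoot.long i).refl)) i i - invTerm (ev u) i i =
        if (ev u i).val < n then 1 else -1 := by
    rw [invTerm_of_le _ le_rfl, invTerm_of_le _ le_rfl, bi, invVal, invVal, val_bar]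
    split_ifs <;> omega
  rw [h0] at hd
  have hc : ∀ m, i < m → (CircLT (ev u i) (ev u m) (bar (ev u i)) ↔
      if (ev u i).val < n then
        (ev u i).val < (ev u m).val ∧ (ev u m).val < 2 * n - 1 - (ev u i).val
      else ¬ (2 * n - 1 - (ev u i).val < (ev u m).val ∧ (ev u m).val < (ev u i).val)) := by
    intro m h1
    have := val_ne_of_ne u h1.ne
    simp only [CircLT, Fin.lt_def, val_bar]
    split_ifs <;> omega
  -- Case of an unbarred `u(i)`: `P` is the interval condition, and a step means that no later row
  -- satisfies it.
  have key : ∀ (P : Fin n → Prop) [DecidablePred P], (∀ m, i < m → (CircLT (ev u i) (ev u m) (bar (ev u i)) ↔ P m)) →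
      ((length (u * (PosRoot.long i).refl) : ℤ) - length u = 1 +
        ∑ m ∈ Finset.univ.erase i, if i < m ∧ P m then (2 : ℤ) else 0) →
      StepBounds u (.long i) ∧ (BackStep u (.long i) ↔
      ∀ m, i < m → ¬ CircLT (ev u i) (ev u m) (bar (ev u i))) := by
    intro P _ hP hd
    have hnn : ∀ m ∈ Finset.univ.erase i, (0 : ℤ) ≤ if i < m ∧ P m then (2 : ℤ) else 0 := by
      intro m _; split_ifs <;> norm_num
    have hS := Finset.sum_nonneg hnn
    have hS0 := Finset.sum_eq_zero_iff_of_nonneg hnn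
    refine ⟨stepBounds_of u _ _ _ hd hr (by omega) (by omega) (by omega), ?_⟩
    rw [backStep_iff_of u _ _ _ hd hr]
    generalize ∑ m ∈ Finset.univ.erase i, (if i < m ∧ P m then (2 : ℤ) else 0) = S at *
    have : (1 + S = 1 ∨ 1 + S = 1 - 2 * ((n : ℤ) - i.val)) ↔ S = 0 := by omega
    rw [this, hS0]
    constructor
    · intro h m h1 hcirc
      have := h m (by simp [h1.ne'])
      rw [hP m h1] at hcirc
      rw [if_pos ⟨h1, hcirc⟩] at this
      omega
    · intro h m _
      rw [if_neg]
      rintro ⟨h1, h3⟩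
      exact h m h1 ((hP m h1).2 h3)
  -- Case of a barred `u(i)`: a step means that every later row satisfies `P`, the only way to reach
  -- the quantum value `1 - 2 (n - i)`.
  have key' : ∀ (P : Fin n → Prop) [DecidablePred P], (∀ m, i < m → (CircLT (ev u i) (ev u m) (bar (ev u i)) ↔ ¬ P m)) →
      ((length (u * (PosRoot.long i).refl) : ℤ) - length u = -1 +
        ∑ m ∈ Finset.univ.erase i, if i < m ∧ P m then (-2 : ℤ) else 0) →
      StepBounds u (.long i) ∧ (BackStep u (.long i) ↔
      ∀ m, i < m → ¬ CircLT (ev u i) (ev u m) (bar (ev u i))) := by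
    intro P _ hP hd
    have hnn : ∀ m ∈ Finset.univ.erase i, (if i < m then (-2 : ℤ) else 0) ≤
        if i < m ∧ P m then (-2 : ℤ) else 0 := by
      intro m _; split_ifs <;> first | (norm_num; done) | tauto
    have hS := Finset.sum_le_sum hnn
    have hS0 := Finset.sum_eq_sum_iff_of_le hnn
    have hSn : (∑ m ∈ Finset.univ.erase i, if i < m ∧ P m then (-2 : ℤ) else 0) ≤ 0 := by
      apply Finset.sum_nonpos
      intro m _; split_ifs <;> norm_num
    have hcount := sum_ite_above (le_refl i) (-2)
    rw [Finset.erase_eq_of_notMem (a := i) (s := Finset.univ.erase i) (by simp)] at hcount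
    rw [hcount] at hS hS0
    refine ⟨stepBounds_of u _ _ _ hd hr (by omega) (by omega) (by omega), ?_⟩
    rw [backStep_iff_of u _ _ _ hd hr]
    generalize ∑ m ∈ Finset.univ.erase i, (if i < m ∧ P m then (-2 : ℤ) else 0) = S at *
    have : (-1 + S = 1 ∨ -1 + S = 1 - 2 * ((n : ℤ) - i.val)) ↔ ((n : ℤ) - i.val - 1) * -2 = S := by
      omega
    rw [this, hS0]
    constructor
    · intro h m h1 hcirc
      have := h m (by simp [h1.ne'])
      rw [hP m h1] at hcirc
      rw [if_pos h1, if_neg (fun hh => hcirc hh.2)] at this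
      omega
    · intro h m _
      by_cases h1 : i < m
      · have h2 := h m h1
        rw [hP m h1, not_not] at h2
        rw [if_pos h1, if_pos ⟨h1, h2⟩]
      · rw [if_neg h1, if_neg (fun hh => h1 hh.1)]
  by_cases hxy : (ev u i).val < n
  · simp only [hxy, if_true] at hd hc
    refine key _ hc (hd.trans (congrArg _ (Finset.sum_congr rfl fun m _ => ?_)))
    split_ifs <;> first | (norm_num; done) | omega
  · simp only [hxy, if_false] at hd hc
    refine key' _ hc (hd.trans (congrArg _ (Finset.sum_congr rfl fun m _ => ?_)))
    split_ifs <;> first | (norm_num; done) | omega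

-- There are no quantum steps here. If `u(i)` exceeds the bar of `u(j)`, the length drops, but never
-- far enough. Otherwise all contributions of other rows are nonnegative, and the rows `i, j`
-- contribute `1` if exactly one of their values is unbarred and `3` if both are; so a step needs
-- the first alternative and no contribution from any other row.
set_option maxHeartbeats 1000000 in
lemma add_step {n : ℕ} (u : SignedPerm n) {i j : Fin n} (hij : i < j) :
    StepBounds u (.add i j hij) ∧ (BackStep u (.add i j hij) ↔
      (ev u i).val + (ev u j).val < 2 * n - 1 ∧ ((ev u i).val < n ↔ n ≤ (ev u j).val) ∧
      (∀ m, i < m → m < j → ¬ ((ev u i).val < (ev u m).val ∧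
        (ev u m).val + (ev u j).val < 2 * n - 1)) ∧
      ∀ m, j < m → ¬ ((ev u i).val < (ev u m).val ∧ (ev u m).val + (ev u j).val < 2 * n - 1) ∧
        ¬ ((ev u j).val < (ev u m).val ∧ (ev u m).val + (ev u i).val < 2 * n - 1)) := by
  have hij' : i.val < j.val := hij
  have hjn := j.isLt
  have bi := ev_mul_add u hij i
  have bj := ev_mul_add u hij j
  rw [if_pos rfl] at bi
  rw [if_neg hij.ne', if_pos rfl] at bj
  have hd := sum_sum_sub_pair (ev (u * (PosRoot.add i j hij).refl)) (ev u) i j hij.ne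
    (fun p h1 h2 => by rw [ev_mul_add, if_neg h1, if_neg h2])
  rw [← length_eq_sum, ← length_eq_sum] at hd
  have hs : ∀ m ∈ (Finset.univ.erase i).erase j, _ := fun m hm => by
    simp only [Finset.mem_erase] at hm
    exact add_term hij hm.2.1 hm.1 (ev u) (ev (u * (PosRoot.add i j hij).refl))
      (val_ne_of_ne u (Ne.symm hm.2.1)) (val_ne_of_ne u (Ne.symm hm.1)) bi bj
      (by rw [ev_mul_add, if_neg hm.2.1, if_neg hm.1])
  rw [Finset.sum_congr rfl hs] at hd
  have hr : rhoCoroot (PosRoot.add i j hij) = ((2 * (n : ℤ) - i.val - j.val : ℤ) : ℚ) := by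
    rw [rhoCoroot_add]; push_cast; rfl
  have hx := (ev u i).isLt
  have hy := (ev u j).isLt
  have hne := val_ne_of_ne u hij.ne
  have h0 : (invTerm (ev (u * (PosRoot.add i j hij).refl)) i i - invTerm (ev u) i i) +
    (invTerm (ev (u * (PosRoot.add i j hij).refl)) j j - invTerm (ev u) j j) +
        (pairTerm (ev (u * (PosRoot.add i j hij).refl)) i j - pairTerm (ev u) i j) =
        (if (ev u i).val + (ev u j).val < 2 * n - 1 then 1 else -1) +
        ((if (ev u i).val < n then 1 else -1) + (if (ev u j).val < n then 1 else -1)) := by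
    have hx' : 2 * n - 1 - (ev u i).val < 2 * n := by omega
    have hy' : 2 * n - 1 - (ev u j).val < 2 * n := by omega
    rw [pairTerm, pairTerm, invTerm_of_lt _ hij, invTerm_of_lt _ hij, invTerm_of_le _ hij.le,
      invTerm_of_le _ hij.le, invTerm_of_le _ le_rfl, invTerm_of_le _ le_rfl,
      invTerm_of_le _ le_rfl, invTerm_of_le _ le_rfl, bi, bj, val_bar, val_bar]
    simp only [invVal_bar_right hx, invVal_bar_right hy]
    rw [invVal_comm hy' hx (by omega), invVal_bar_right hy]
    have e1 : ∀ x, x < 2 * n → invVal n (2 * n - 1 - x) x - invVal n x x =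
        if x < n then 1 else -1 := by
      intro x hx
      simp only [invVal]
      split_ifs <;> omega
    have e2 := e1 _ hx
    have e3 := e1 _ hy
    rw [← e2, ← e3]
    have e4 : (if (ev u i).val < 2 * n - 1 - (ev u j).val then (1 : ℤ) else -1) =
        if (ev u i).val + (ev u j).val < 2 * n - 1 then 1 else -1 := by
      split_ifs <;> omega
    rw [e4]
    ring
  rw [h0] at hd
  have hnm : ∀ m ∈ (Finset.univ.erase i).erase j,
      ((ev u i).val ≠ (ev u m).val ∧ (ev u i).val + (ev u m).val ≠ 2 * n - 1) ∧
      ((ev u j).val ≠ (ev u m).val ∧ (ev u j).val + (ev u m).val ≠ 2 * n - 1) := by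
    intro m hm
    simp only [Finset.mem_erase] at hm
    exact ⟨val_ne_of_ne u (Ne.symm hm.2.1), val_ne_of_ne u (Ne.symm hm.1)⟩
  generalize hT : (fun m => ((if i < m ∧ m < j then
        (if (ev u i).val < (ev u m).val ∧ (ev u m).val < 2 * n - 1 - (ev u j).val then (2 : ℤ) else
         if 2 * n - 1 - (ev u j).val < (ev u m).val ∧ (ev u m).val < (ev u i).val then -2 else 0)
         else 0) +
      (if j < m then
        (if (ev u i).val < (ev u m).val ∧ (ev u m).val < 2 * n - 1 - (ev u i).val then 2 else
         if 2 * n - 1 - (ev u i).val < (ev u m).val ∧ (ev u m).val < (ev u i).val then -2 else 0) +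
        (if (ev u j).val < (ev u m).val ∧ (ev u m).val < 2 * n - 1 - (ev u j).val then 2 else
         if 2 * n - 1 - (ev u j).val < (ev u m).val ∧ (ev u m).val < (ev u j).val then -2 else 0)
         else 0) : ℤ)) = T
  have hT' : ∀ m, T m = _ := fun m => (congrFun hT m).symm
  have hd : (length (u * (PosRoot.add i j hij).refl) : ℤ) - length u =
      (if (ev u i).val + (ev u j).val < 2 * n - 1 then 1 else -1) +
        ((if (ev u i).val < n then 1 else -1) + (if (ev u j).val < n then 1 else -1)) +
        ∑ m ∈ (Finset.univ.erase i).erase j, T m :=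
    hd.trans (congrArg _ (Finset.sum_congr rfl fun m _ => (hT' m).symm))
  by_cases hxy : (ev u i).val + (ev u j).val < 2 * n - 1
  · simp only [hxy, if_true] at hd
    have hnn : ∀ m ∈ (Finset.univ.erase i).erase j, 0 ≤ T m := by
      intro m hm
      have := hnm m hm
      rw [hT']
      split_ifs <;> omega
    have hS := Finset.sum_nonneg hnn
    have hS0 := Finset.sum_eq_zero_iff_of_nonneg hnn
    have hb : (-2 : ℤ) ≤ (if (ev u i).val < n then 1 else -1) +
        (if (ev u j).val < n then 1 else -1) := by split_ifs <;> norm_num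
    have hb0 : (1 : ℤ) + ((if (ev u i).val < n then 1 else -1) +
        (if (ev u j).val < n then 1 else -1)) = if ((ev u i).val < n ↔ n ≤ (ev u j).val) then 1
        else 3 := by
      split_ifs <;> omega
    rw [hb0] at hd
    by_cases hh : (ev u i).val < n ↔ n ≤ (ev u j).val
    · rw [if_pos hh] at hd
      refine ⟨stepBounds_of u _ _ _ hd hr (by omega) (by omega) (by omega), ?_⟩
      rw [backStep_iff_of u _ _ _ hd hr]
      have : ((1 : ℤ) + (∑ m ∈ (Finset.univ.erase i).erase j, T m) = 1 ∨
        (1 : ℤ) + (∑ m ∈ (Finset.univ.erase i).erase j, T m) =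
        1 - 2 * (2 * (n : ℤ) - i.val - j.val)) ↔ (∑ m ∈ (Finset.univ.erase i).erase j, T m) = 0 := by
        omega
      rw [this, hS0]
      have hmid : ∀ m, i < m → m < j → (T m = 0 ↔ ¬ ((ev u i).val < (ev u m).val ∧
        (ev u m).val + (ev u j).val < 2 * n - 1)) := by
        intro m h1 h2
        have := hnm m (by simp [h1.ne', h2.ne])
        rw [hT', if_pos ⟨h1, h2⟩, if_neg h2.not_gt]
        split_ifs <;> omega
      have hup : ∀ m, j < m → (T m = 0 ↔
          (¬ ((ev u i).val < (ev u m).val ∧ (ev u m).val + (ev u j).val < 2 * n - 1) ∧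
        ¬ ((ev u j).val < (ev u m).val ∧ (ev u m).val + (ev u i).val < 2 * n - 1))) := by
        intro m h1
        have := hnm m (by simp [h1.ne', (hij.trans h1).ne'])
        rw [hT', if_neg (fun h => h1.not_gt h.2), if_pos h1]
        split_ifs <;> omega
      constructor
      · intro h
        exact ⟨hxy, hh, fun m h1 h2 => (hmid m h1 h2).1 (h m (by simp [h1.ne', h2.ne])),
          fun m h1 => (hup m h1).1 (h m (by simp [h1.ne', (hij.trans h1).ne']))⟩
      · rintro ⟨-, -, h1, h2⟩ m hm
        simp only [Finset.mem_erase] at hm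
        rcases lt_or_gt_of_ne hm.1 with h | h
        · rcases lt_or_gt_of_ne hm.2.1 with h' | h'
          · rw [hT', if_neg (fun e => h'.not_gt e.1), if_neg h.not_gt, add_zero]
          · exact (hmid m h' h).2 (h1 m h' h)
        · exact (hup m h).2 (h2 m h)
    · rw [if_neg hh] at hd
      refine ⟨stepBounds_of u _ _ _ hd hr (by omega) (by omega) (by omega), ?_⟩
      rw [backStep_iff_of u _ _ _ hd hr]
      constructor
      · intro h; exfalso; omega
      · exact fun h => absurd h.2.1 hh
  · simp only [hxy, if_false] at hd
    -- Now `u(i)` exceeds the bar of `u(j)`. With `r = ⟨ρ, β^∨⟩`, the bounds `-3` for the rows `i,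
    -- j`, `-2` for each row between them and `-4` for each row after `j` add up to `3 - 2r`, which
    -- is above the quantum value `1 - 2r`; and the change is at most `-1`.
    have hA : ∀ z, (-2 : ℤ) ≤ (if (ev u i).val < z ∧ z < 2 * n - 1 - (ev u j).val then (2 : ℤ) else
         if 2 * n - 1 - (ev u j).val < z ∧ z < (ev u i).val then -2 else 0) ∧
         (if (ev u i).val < z ∧ z < 2 * n - 1 - (ev u j).val then (2 : ℤ) else
         if 2 * n - 1 - (ev u j).val < z ∧ z < (ev u i).val then -2 else 0) ≤ 0 := by
      intro z
      rw [if_neg (by omega)]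
      split_ifs <;> norm_num
    have hB : ∀ x z, (-2 : ℤ) ≤ (if x < z ∧ z < 2 * n - 1 - x then (2 : ℤ) else
         if 2 * n - 1 - x < z ∧ z < x then -2 else 0) := by
      intro x z
      split_ifs <;> norm_num
    -- If barring one of the two rows contributes positively, barring the other contributes `-2`;
    -- hence no row after `j` contributes positively in total.
    have hC : ∀ x y z, x < 2 * n → y < 2 * n → ¬ x + y < 2 * n - 1 → y ≠ z → y + z ≠ 2 * n - 1 →
        (if x < z ∧ z < 2 * n - 1 - x then (2 : ℤ) else
         if 2 * n - 1 - x < z ∧ z < x then -2 else 0) ≤ 0 ∨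
         (if y < z ∧ z < 2 * n - 1 - y then (2 : ℤ) else
         if 2 * n - 1 - y < z ∧ z < y then -2 else 0) = -2 := by
      intro x y z hx hy hxy h1 h2
      by_cases hz : x < z ∧ z < 2 * n - 1 - x
      · right
        rw [if_neg (by omega), if_pos (by omega)]
      · left
        rw [if_neg hz]
        split_ifs <;> norm_num
    have hC' : ∀ x z, (if x < z ∧ z < 2 * n - 1 - x then (2 : ℤ) else
         if 2 * n - 1 - x < z ∧ z < x then -2 else 0) ≤ 2 := by
      intro x z
      split_ifs <;> norm_num
    have hbound : ∀ m ∈ (Finset.univ.erase i).erase j,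
        (if i < m ∧ m < j then (-2 : ℤ) else 0) + (if j < m then (-4 : ℤ) else 0) ≤ T m ∧
        T m ≤ 0 := by
      intro m hm
      have h1 := hnm m hm
      have h2 := hA (ev u m).val
      have h3 := hB (ev u i).val (ev u m).val
      have h4 := hB (ev u j).val (ev u m).val
      have h5 := hC _ _ _ hx hy hxy h1.2.1 h1.2.2
      have h6 := hC _ _ _ hy hx (by omega) h1.1.1 h1.1.2
      have h7 := hC' (ev u i).val (ev u m).val
      have h8 := hC' (ev u j).val (ev u m).val
      rw [hT']
      revert h2 h3 h4 h5 h6 h7 h8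
      generalize (if (ev u i).val < (ev u m).val ∧ (ev u m).val < 2 * n - 1 - (ev u j).val then (2 : ℤ) else
         if 2 * n - 1 - (ev u j).val < (ev u m).val ∧ (ev u m).val < (ev u i).val then -2 else 0) = A
      generalize (if (ev u i).val < (ev u m).val ∧ (ev u m).val < 2 * n - 1 - (ev u i).val then (2 : ℤ) else
         if 2 * n - 1 - (ev u i).val < (ev u m).val ∧ (ev u m).val < (ev u i).val then -2 else 0) = B
      generalize (if (ev u j).val < (ev u m).val ∧ (ev u m).val < 2 * n - 1 - (ev u j).val then (2 : ℤ) else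
         if 2 * n - 1 - (ev u j).val < (ev u m).val ∧ (ev u m).val < (ev u j).val then -2 else 0) = C
      intro h2 h3 h4 h5 h6 h7 h8
      by_cases c1 : i < m ∧ m < j
      · rw [if_pos c1, if_neg c1.2.not_gt, if_pos c1, if_neg c1.2.not_gt]
        omega
      · rw [if_neg c1, if_neg c1]
        split_ifs <;> omega
    have hS := Finset.sum_le_sum fun m hm => (hbound m hm).1
    rw [Finset.sum_add_distrib, sum_ite_between hij, sum_ite_above hij.le] at hS
    have hSn : (∑ m ∈ (Finset.univ.erase i).erase j, T m) ≤ 0 :=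
      Finset.sum_nonpos fun m hm => (hbound m hm).2
    have hb : (-2 : ℤ) ≤ (if (ev u i).val < n then 1 else -1) +
        (if (ev u j).val < n then 1 else -1) := by split_ifs <;> norm_num
    have hb' : (if (ev u i).val < n then (1 : ℤ) else -1) +
        (if (ev u j).val < n then 1 else -1) ≤ 0 := by split_ifs <;> omega
    refine ⟨stepBounds_of u _ _ _ hd hr (by omega) (by omega) (by omega), ?_⟩
    rw [backStep_iff_of u _ _ _ hd hr]
    constructor
    · intro h; exfalso; omega
    · exact fun h => absurd h.1 hxy

lemma stepBounds {n : ℕ} (u : SignedPerm n) (β : PosRoot n) : StepBounds u β := by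
  cases β with
  | sub i j h => exact (sub_step u h).1
  | add i j h => exact (add_step u h).1
  | long i => exact (long_step u i).1

/-! ### Walks of folding pairs -/

lemma filter_lt_succ {N : ℕ} (l : List (Fin N)) (hl : l.Pairwise (· < ·)) (P : Fin N → Prop)
    [DecidablePred P] (p : ℕ) :
    l.filter (fun q => P q ∧ q.val < p + 1) =
      l.filter (fun q => P q ∧ q.val < p) ++ l.filter (fun q => P q ∧ q.val = p) := by
  induction l with
  | nil => rfl
  | cons a l ih =>
    rw [List.pairwise_cons] at hl
    have ih := ih hl.2
    rw [List.filter_cons, List.filter_cons, List.filter_cons, ih]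
    rcases lt_trichotomy a.val p with h | h | h
    · have h2 : a.val < p + 1 := by omega
      by_cases hP : P a
      · simp only [h, h2, h.ne, hP, and_self, and_false, decide_true, decide_false, if_true,
          List.cons_append, Bool.false_eq_true, if_false]
      · simp only [hP, false_and, decide_false, Bool.false_eq_true, if_false]
    · have hnil : l.filter (fun q => P q ∧ q.val < p) = [] := by
        rw [List.filter_eq_nil_iff]
        intro b hb
        have : a.val < b.val := hl.1 b hb
        simp only [decide_eq_true_eq]
        omega
      rw [hnil]
      by_cases hP : P a
      · simp [h, hP]
      · simp only [hP, false_and, decide_false, Bool.false_eq_true, if_false]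
    · have h1 : ¬ a.val < p := by omega
      have h2 : ¬ a.val < p + 1 := by omega
      have h3 : ¬ a.val = p := by omega
      simp only [h1, h2, h3, and_false, decide_false, Bool.false_eq_true, if_false]

lemma walk_zero {n : ℕ} {Γ : List (PosRoot n)} (F : FoldingPair Γ) : walk F 0 = F.1 := by
  simp [walk]

lemma walk_succ {n : ℕ} {Γ : List (PosRoot n)} (F : FoldingPair Γ) (p : Fin Γ.length) :
    walk F (p.val + 1) = if p ∈ F.2 then walk F p.val * (Γ.get p).refl else walk F p.val := by
  rw [walk, filter_lt_succ _ (List.sortedLT_finRange _).pairwise (· ∈ F.2), List.map_append,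
    List.prod_append, ← mul_assoc]
  change walk F p.val * _ = _
  have h1 : (List.finRange Γ.length).filter (fun q => q ∈ F.2 ∧ q.val = p.val) =
      if p ∈ F.2 then [p] else [] := by
    have : (List.finRange Γ.length).filter (fun q => q ∈ F.2 ∧ q.val = p.val) =
        ((List.finRange Γ.length).filter (fun q => q = p)).filter (fun q => q ∈ F.2) := by
      rw [List.filter_filter]
      congr 1
      funext q
      simp [Fin.ext_iff]
    rw [this]
    have h2 : (List.finRange Γ.length).filter (fun q => q = p) = [p] := by
      rw [List.filter_eq, List.count_eq_one_of_mem (List.nodup_finRange _) (List.mem_finRange p)]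
      rfl
    rw [h2]
    by_cases h : p ∈ F.2 <;> simp [h]
  rw [h1]
  split_ifs <;> simp

/-- A reflection never fixes a group element, so the walk moves at a position exactly when that
position is folded. -/
lemma foldingPair_ext {n : ℕ} {Γ : List (PosRoot n)} {F F' : FoldingPair Γ}
    (h : ∀ p ≤ Γ.length, walk F p = walk F' p) : F = F' := by
  have h0 : F.1 = F'.1 := by simpa only [walk_zero] using h 0 (Nat.zero_le _)
  refine Prod.ext h0 (Finset.ext fun q => ?_)
  have h1 := h (q.val + 1) q.isLt
  have h2 := h q.val q.isLt.le
  rw [walk_succ, walk_succ, h2] at h1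
  have h3 := mul_refl_ne (walk F' q.val) (Γ.get q)
  by_cases a : q ∈ F.2 <;> by_cases b : q ∈ F'.2 <;> simp only [a, b, if_true, if_false] at h1 ⊢
  · exact absurd h1 h3
  · exact absurd h1.symm h3

lemma invTerm_nonneg {n : ℕ} (a : Fin n → Letter n) (p q : Fin n) : 0 ≤ invTerm a p q := by
  rw [invTerm]
  split_ifs <;> norm_num

lemma length_one {n : ℕ} : length (1 : SignedPerm n) = 0 := by
  have h := length_eq_sum (1 : SignedPerm n)
  rw [Finset.sum_eq_zero] at h
  · exact_mod_cast h
  intro p _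
  refine Finset.sum_eq_zero fun q _ => ?_
  by_cases hpq : p ≤ q
  · rw [invTerm_of_le _ hpq, invVal, ev_one, ev_one, val_unbarred, val_unbarred]
    have : p.val ≤ q.val := hpq
    rw [if_neg (by omega), if_neg (by omega), add_zero]
  · exact invTerm_of_lt _ (not_le.1 hpq)

/-- Vanishing diagonal terms make all values unbarred and vanishing off-diagonal terms make them
increasing; the only increasing permutation of `1, …, n` is the identity. -/
lemma eq_one_of_length {n : ℕ} {w : SignedPerm n} (h : length w = 0) : w = 1 := by
  have h' := length_eq_sum w
  rw [h, Nat.cast_zero, eq_comm,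
    Finset.sum_eq_zero_iff_of_nonneg (fun p _ => Finset.sum_nonneg fun q _ => invTerm_nonneg _ p q)]
    at h'
  have hz : ∀ p q, p ≤ q → invVal n (ev w p).val (ev w q).val = 0 := by
    intro p q hpq
    have := (Finset.sum_eq_zero_iff_of_nonneg (fun q _ => invTerm_nonneg _ p q)).1
      (h' p (Finset.mem_univ p)) q (Finset.mem_univ q)
    rwa [invTerm_of_le _ hpq] at this
  have hlt : ∀ p, (ev w p).val < n := by
    intro p
    have h1 := hz p p le_rfl
    have h2 := (ev w p).isLt
    rw [invVal] at h1
    split_ifs at h1 <;> omega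
  have hmono : StrictMono (fun p => (⟨(ev w p).val, hlt p⟩ : Fin n)) := by
    intro p q hpq
    have h1 := hz p q hpq.le
    have h2 := val_ne_of_ne w hpq.ne
    rw [invVal] at h1
    rw [Fin.lt_def]
    change (ev w p).val < (ev w q).val
    split_ifs at h1 <;> omega
  have hid : (fun p => (⟨(ev w p).val, hlt p⟩ : Fin n)) = id :=
    (hmono.range_inj strictMono_id).1 (by
      rw [Set.range_id]
      exact (Finite.surjective_of_injective hmono.injective).range_eq)
  apply ev_ext
  intro p
  have := congrArg Fin.val (congrFun hid p)
  exact Fin.ext this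

/-- Every generating relation of the Bruhat order raises the length, and a length-raising reflection
is itself a generating relation. -/
lemma bruhatLT_iff {n : ℕ} (w : SignedPerm n) (β : PosRoot n) :
    BruhatLT w (w * β.refl) ↔ length w < length (w * β.refl) := by
  constructor
  · have : ∀ u v : SignedPerm n, BruhatLT u v → length u < length v := by
      intro u v h
      induction h with
      | single h => exact h.1
      | tail _ h ih => exact ih.trans h.1
    exact this _ _
  · exact fun h => Relation.TransGen.single ⟨h, β, rfl⟩

/-- The contribution of a folding at `β`, taken from `w`, to the statistic defining `FBar`. -/
noncomputable def stepDefect {n : ℕ} (w : SignedPerm n) (β : PosRoot n) : ℚ :=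
  (1 / 2 : ℚ) * ((length w : ℚ) - length (w * β.refl) - 1) +
    if length w < length (w * β.refl) then rhoCoroot β else 0

/-- The length must change: a decrease is at least `1` and an increase at most `2⟨ρ, β^∨⟩ - 1`. The
defect measures the distance from these two extremes. -/
lemma stepDefect_nonneg {n : ℕ} (w : SignedPerm n) (β : PosRoot n) :
    0 ≤ stepDefect w β ∧ (stepDefect w β = 0 ↔ Step w β) := by
  obtain ⟨h1, h2, h3⟩ := stepBounds (w * β.refl) β
  rw [mul_refl_mul_refl] at h1 h2
  rw [stepDefect, Step]
  by_cases h : length w < length (w * β.refl)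
  · have h' : (length w : ℚ) + 1 ≤ length (w * β.refl) := by exact_mod_cast h
    rw [if_pos h]
    refine ⟨by linarith, fun e => Or.inr (by linarith), ?_⟩
    rintro (e | e) <;> linarith
  · have h' : (length (w * β.refl) : ℚ) + 1 ≤ length w := by
      have : length (w * β.refl) + 1 ≤ length w := by omega
      exact_mod_cast this
    rw [if_neg h]
    refine ⟨by linarith, fun e => Or.inl (by linarith), ?_⟩
    rintro (e | e) <;> linarith

/-- The differences of lengths telescope along the walk, so the statistic equals `ℓ(end)` plus the
sum of the defects, all of which are nonnegative. -/
lemma mem_FBar_iff {n : ℕ} {Γ : List (PosRoot n)} (F : FoldingPair Γ) :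
    F ∈ FBar Γ ↔ endPoint F = 1 ∧ ∀ j ∈ F.2, Step (walk F j.val) (Γ.get j) := by
  have hsum : (1 / 2 : ℚ) * ((length F.1 : ℚ) + (length (endPoint F) : ℚ) - (F.2.card : ℚ)) +
      ∑ j ∈ negFoldings F, rhoCoroot (Γ.get j) =
      length (endPoint F) + ∑ j ∈ F.2, stepDefect (walk F j.val) (Γ.get j) := by
    have h1 : ∀ j ∈ F.2, walk F (j.val + 1) = walk F j.val * (Γ.get j).refl := fun j hj => by
      rw [walk_succ, if_pos hj]
    have htel : ∑ j ∈ F.2, ((length (walk F j.val) : ℚ) - length (walk F j.val * (Γ.get j).refl)) =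
        length F.1 - length (endPoint F) := by
      have ht := Finset.sum_range_sub' (fun p => (length (walk F p) : ℚ)) Γ.length
      rw [walk_zero] at ht
      rw [endPoint, ← ht, Finset.sum_range (n := Γ.length)]
      rw [← Finset.sum_subset (Finset.subset_univ F.2)]
      · exact Finset.sum_congr rfl fun j hj => by rw [h1 j hj]
      · intro j _ hj
        rw [walk_succ, if_neg hj, sub_self]
    have hneg : ∑ j ∈ negFoldings F, rhoCoroot (Γ.get j) = ∑ j ∈ F.2,
        if length (walk F j.val) < length (walk F j.val * (Γ.get j).refl) then
          rhoCoroot (Γ.get j) else 0 := by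
      classical
      rw [negFoldings, Finset.sum_filter]
      refine Finset.sum_congr rfl fun j hj => ?_
      rw [h1 j hj]
      simp only [bruhatLT_iff]
    rw [hneg]
    simp only [stepDefect, Finset.sum_add_distrib, ← Finset.mul_sum, Finset.sum_sub_distrib] at htel ⊢
    rw [htel]
    simp
    ring
  rw [FBar, Set.mem_ofPred_eq, hsum]
  have hnn : ∀ j ∈ F.2, 0 ≤ stepDefect (walk F j.val) (Γ.get j) := fun j _ =>
    (stepDefect_nonneg _ _).1
  have hS := Finset.sum_nonneg hnn
  have hS0 := Finset.sum_eq_zero_iff_of_nonneg hnn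
  have hl : (0 : ℚ) ≤ length (endPoint F) := Nat.cast_nonneg _
  constructor
  · intro h
    have e1 : (length (endPoint F) : ℚ) = 0 := by linarith
    have e2 : ∑ j ∈ F.2, stepDefect (walk F j.val) (Γ.get j) = 0 := by linarith
    refine ⟨eq_one_of_length (by exact_mod_cast e1), fun j hj => ?_⟩
    exact (stepDefect_nonneg _ _).2.1 (hS0.1 e2 j hj)
  · rintro ⟨h1, h2⟩
    rw [h1, length_one, hS0.2 fun j hj => (stepDefect_nonneg _ _).2.2 (h2 j hj)]
    norm_num

/-! ### Traces of walks -/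

/-- From position `a` on, the sequence `g` of group elements changes only by steps along `Γ`. -/
def IsTrace {n : ℕ} (Γ : List (PosRoot n)) (a : ℕ) (g : ℕ → SignedPerm n) : Prop :=
  ∀ p, a ≤ p → ∀ β, Γ[p]? = some β →
    g (p + 1) = g p ∨ (g (p + 1) = g p * β.refl ∧ Step (g p) β)

lemma isTrace_walk {n : ℕ} {Γ : List (PosRoot n)} {F : FoldingPair Γ} (hF : F ∈ FBar Γ) :
    IsTrace Γ 0 (walk F) := by
  intro p _ β hβ
  obtain ⟨hp, rfl⟩ := List.getElem?_eq_some_iff.1 hβ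
  have h := walk_succ F ⟨p, hp⟩
  by_cases hm : (⟨p, hp⟩ : Fin Γ.length) ∈ F.2
  · rw [if_pos hm] at h
    exact Or.inr ⟨h, ((mem_FBar_iff F).1 hF).2 _ hm⟩
  · rw [if_neg hm] at h
    exact Or.inl h

/-- The folded positions are those at which the trace moves. Members of `FBar` are thus the same as
traces ending at `1`, and traces can be built backwards segment by segment. -/
lemma exists_foldingPair {n : ℕ} {Γ : List (PosRoot n)} {g : ℕ → SignedPerm n}
    (hg : IsTrace Γ 0 g) (h1 : g Γ.length = 1) :
    ∃ F ∈ FBar Γ, ∀ p ≤ Γ.length, walk F p = g p := by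
  classical
  let F : FoldingPair Γ := (g 0, Finset.univ.filter fun q => g (q.val + 1) ≠ g q.val)
  have hw : ∀ p ≤ Γ.length, walk F p = g p := by
    intro p
    induction p with
    | zero => exact fun _ => walk_zero F
    | succ p ih =>
      intro hp
      have h := walk_succ F ⟨p, hp⟩
      simp only [ih (Nat.le_of_succ_le hp)] at h
      rw [h]
      have hm : ((⟨p, hp⟩ : Fin Γ.length) ∈ F.2) ↔ g (p + 1) ≠ g p := by simp [F]
      simp only [hm]
      rcases hg p (Nat.zero_le p) (Γ.get ⟨p, hp⟩) (List.getElem?_eq_getElem hp) with e | ⟨e, -⟩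
      · rw [if_neg (not_not.2 e), e]
      · rw [if_pos (by rw [e]; exact mul_refl_ne _ _), e]
  refine ⟨F, (mem_FBar_iff F).2 ⟨(hw _ le_rfl).trans h1, fun j hj => ?_⟩, hw⟩
  have hm : g (j.val + 1) ≠ g j.val := by simpa [F] using hj
  rw [hw _ j.isLt.le]
  rcases hg j.val (Nat.zero_le _) (Γ.get j) (List.getElem?_eq_getElem j.isLt) with e | ⟨-, e⟩
  · exact absurd e hm
  · exact e

/-- `Back L v u`: one can get to `u` from `v` walking backwards along the roots in `L`. -/
inductive Back {n : ℕ} : List (PosRoot n) → SignedPerm n → SignedPerm n → Prop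
  | nil (v) : Back [] v v
  | skip {β L v u} : Back L v u → Back (β :: L) v u
  | step {β L v u} : BackStep v β → Back L (v * β.refl) u → Back (β :: L) v u

lemma backStep_of_step {n : ℕ} {w v : SignedPerm n} {β : PosRoot n} (h : v = w * β.refl)
    (hs : Step w β) : BackStep v β ∧ v * β.refl = w := by
  have : v * β.refl = w := by rw [h, mul_refl_mul_refl]
  exact ⟨by rwa [BackStep, this], this⟩

lemma getElem?_segment {α : Type*} (A S B : List α) (β : α) :
    (A ++ (S ++ [β]) ++ B)[(A.length + S.length)]? = some β := by
  rw [List.append_assoc, List.getElem?_append_right (Nat.le_add_right _ _)]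
  simp

lemma IsTrace.back {n : ℕ} {A S B : List (PosRoot n)} {g : ℕ → SignedPerm n}
    (hg : IsTrace (A ++ S ++ B) A.length g) :
    Back S.reverse (g (A.length + S.length)) (g A.length) := by
  induction S using List.reverseRecOn generalizing B with
  | nil => exact Back.nil _
  | append_singleton S β ih =>
    have hb := hg (A.length + S.length) (Nat.le_add_right _ _) β (getElem?_segment A S B β)
    rw [List.reverse_append, List.reverse_singleton, List.singleton_append, List.length_append,
      List.length_singleton, ← add_assoc]
    have ih := ih (B := β :: B) (by simpa using hg)
    rcases hb with e | ⟨e, hs⟩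
    · rw [e]; exact Back.skip ih
    · obtain ⟨h1, h2⟩ := backStep_of_step e hs
      exact Back.step h1 (by rwa [h2])

/-- A trace constrains nothing before its starting position, so its earlier values can be
overwritten by a given backward walk. -/
lemma IsTrace.extend {n : ℕ} {A S B : List (PosRoot n)} {g : ℕ → SignedPerm n}
    (hg : IsTrace (A ++ S ++ B) (A.length + S.length) g) {u : SignedPerm n}
    (hu : Back S.reverse (g (A.length + S.length)) u) :
    ∃ g', IsTrace (A ++ S ++ B) A.length g' ∧ g' A.length = u ∧
      ∀ p, A.length + S.length ≤ p → g' p = g p := by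
  induction S using List.reverseRecOn generalizing B g with
  | nil =>
    cases hu
    exact ⟨g, hg, rfl, fun _ _ => rfl⟩
  | append_singleton S β ih =>
    rw [List.reverse_append, List.reverse_singleton, List.singleton_append, List.length_append,
      List.length_singleton, ← add_assoc] at hu
    have key : ∀ v, (g (A.length + S.length + 1) = v ∨
        (g (A.length + S.length + 1) = v * β.refl ∧ Step v β)) → Back S.reverse v u →
        ∃ g', IsTrace (A ++ (S ++ [β]) ++ B) A.length g' ∧ g' A.length = u ∧
        ∀ p, A.length + (S ++ [β]).length ≤ p → g' p = g p := by
      intro v hv hb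
      -- Only the value just before the last root of the segment is overwritten; the induction
      -- hypothesis takes care of the preceding roots.
      obtain ⟨g', h1, h2, h3⟩ := ih (B := β :: B) (g := Function.update g (A.length + S.length) v)
        (by
          intro p hp γ hγ
          rcases hp.eq_or_lt with rfl | hp
          · have e : (A ++ (S ++ [β]) ++ B)[(A.length + S.length)]? = some γ := by
              simpa using hγ
            rw [getElem?_segment, Option.some.injEq] at e
            subst e
            rwa [Function.update_self, Function.update_of_ne (by omega)]
          · rw [Function.update_of_ne (by omega), Function.update_of_ne (by omega)]
            exact hg p (by simp; omega) γ (by simpa using hγ))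
        (by rwa [Function.update_self])
      refine ⟨g', by simpa using h1, h2, fun p hp => ?_⟩
      rw [List.length_append, List.length_singleton] at hp
      rw [h3 p (by omega), Function.update_of_ne (by omega)]
    cases hu with
    | skip h => exact key _ (Or.inl rfl) h
    | step hs h => exact key _ (Or.inr ⟨(mul_refl_mul_refl _ _).symm, hs⟩) h

/-- Along `L`, a backward walk is determined by its start and the `R`-class of its end. -/
def Separates {n : ℕ} (L : List (PosRoot n)) (R : SignedPerm n → SignedPerm n → Prop) : Prop :=
  ∀ β L', (β :: L') <:+ L → ∀ v u u', BackStep v β → Back L' (v * β.refl) u → Back L' v u' →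
    R u u' → False

/-- Both traces are followed backwards from their common end. At the first root folded by only one
of them, `Separates` would make their final elements unrelated by `R`. -/
lemma IsTrace.unique {n : ℕ} {A S B : List (PosRoot n)} {g g' : ℕ → SignedPerm n}
    {R : SignedPerm n → SignedPerm n → Prop} (hR : ∀ u u', R u u' → R u' u)
    (hs : Separates S.reverse R)
    (hg : IsTrace (A ++ S ++ B) A.length g) (hg' : IsTrace (A ++ S ++ B) A.length g')
    (hend : g (A.length + S.length) = g' (A.length + S.length))
    (h : R (g A.length) (g' A.length)) :
    ∀ p, A.length ≤ p → p ≤ A.length + S.length → g p = g' p := by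
  induction S using List.reverseRecOn generalizing B with
  | nil =>
    intro p h1 h2
    have : p = A.length := le_antisymm h2 h1
    rw [this]; exact hend
  | append_singleton S β ih =>
    have hb := hg (A.length + S.length) (Nat.le_add_right _ _) β (getElem?_segment A S B β)
    have hb' := hg' (A.length + S.length) (Nat.le_add_right _ _) β (getElem?_segment A S B β)
    have hk := IsTrace.back (A := A) (S := S) (B := β :: B) (by simpa using hg)
    have hk' := IsTrace.back (A := A) (S := S) (B := β :: B) (by simpa using hg')
    rw [List.reverse_append, List.reverse_singleton, List.singleton_append] at hs
    rw [List.length_append, List.length_singleton, ← add_assoc] at hend ⊢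
    have heq : g (A.length + S.length) = g' (A.length + S.length) := by
      have hsep := hs β S.reverse (List.suffix_refl _)
      rcases hb with e | ⟨e, hst⟩ <;> rcases hb' with e' | ⟨e', hst'⟩
      · rw [← e, ← e', hend]
      · obtain ⟨h1, h2⟩ := backStep_of_step e' hst'
        rw [← h2] at hk'
        rw [← e, hend] at hk
        exact (hsep _ _ _ h1 hk' hk (hR _ _ h)).elim
      · obtain ⟨h1, h2⟩ := backStep_of_step e hst
        rw [← h2] at hk
        rw [← e', ← hend] at hk'
        exact (hsep _ _ _ h1 hk hk' h).elim
      · rw [← (backStep_of_step e hst).2, ← (backStep_of_step e' hst').2, hend]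
    intro p h1 h2
    rcases h2.eq_or_lt with rfl | h2
    · exact hend
    · refine ih (B := β :: B) ?_ (by simpa using hg) (by simpa using hg') heq p h1 (by omega)
      intro γ L' hsuf
      exact hs γ L' (hsuf.trans (List.suffix_cons _ _))

/-! ### Values of signed permutations as natural numbers -/

/-- The position in the alphabet of the value `w(i)`. -/
def vl {n : ℕ} (w : SignedPerm n) (i : Fin n) : ℕ := (ev w i).val

lemma vl_lt {n : ℕ} (w : SignedPerm n) (i : Fin n) : vl w i < 2 * n := (ev w i).isLt

lemma vl_ne {n : ℕ} (w : SignedPerm n) {p q : Fin n} (h : p ≠ q) :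
    vl w p ≠ vl w q ∧ vl w p + vl w q ≠ 2 * n - 1 := val_ne_of_ne w h

lemma exists_vl {n : ℕ} (w : SignedPerm n) {x : ℕ} (hx : x < 2 * n) :
    ∃ i, vl w i = x ∨ vl w i = 2 * n - 1 - x := by
  obtain ⟨i, h | h⟩ := ev_surjective w ⟨x, hx⟩
  · exact ⟨i, Or.inl (congrArg Fin.val h).symm⟩
  · refine ⟨i, Or.inr ?_⟩
    have := congrArg Fin.val h
    rw [val_bar] at this
    have h2 := vl_lt w i
    simp only [vl] at *
    omega

/-- The root `ε_i - ε_m`, for `i < m`. -/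
def subRoot {n : ℕ} (i m : Fin n) : PosRoot n := if h : i < m then .sub i m h else .long i

/-- The root `ε_i + ε_m`, for `i < m`. -/
def addRoot {n : ℕ} (i m : Fin n) : PosRoot n := if h : i < m then .add i m h else .long i

lemma vl_subRoot {n : ℕ} (w : SignedPerm n) {i m : Fin n} (h : i < m) (p : Fin n) :
    vl (w * (subRoot i m).refl) p = if p = i then vl w m else if p = m then vl w i else vl w p := by
  rw [subRoot, dif_pos h, vl, ev_mul_sub]
  split_ifs <;> rfl

lemma vl_addRoot {n : ℕ} (w : SignedPerm n) {i m : Fin n} (h : i < m) (p : Fin n) :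
    vl (w * (addRoot i m).refl) p =
      if p = i then 2 * n - 1 - vl w m else if p = m then 2 * n - 1 - vl w i else vl w p := by
  rw [addRoot, dif_pos h, vl, ev_mul_add]
  split_ifs
  · exact val_bar _
  · exact val_bar _
  · rfl

lemma vl_long {n : ℕ} (w : SignedPerm n) (i p : Fin n) :
    vl (w * (PosRoot.long i).refl) p = if p = i then 2 * n - 1 - vl w i else vl w p := by
  rw [vl, ev_mul_long]
  split_ifs
  · exact val_bar _
  · rfl

/-- `z` does not lie on the closed arc from `c` to `a` of the circularly ordered alphabet. -/
def Av (z c a : ℕ) : Prop :=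
  z ≠ c ∧ z ≠ a ∧ ¬ ((c < z ∧ z < a) ∨ (z < a ∧ a < c) ∨ (a < c ∧ c < z))

/-- Two consecutive arcs that both miss `z` do not go all the way round, so together they form the
arc from `c` to `a`. -/
lemma Av.trans {z c b a : ℕ} (h1 : Av z c b) (h2 : Av z b a) : Av z c a := by
  simp only [Av] at *; omega

lemma Av.refl {z c : ℕ} (h : z ≠ c) : Av z c c := by
  simp only [Av]; omega

/-- Two arcs with the same end are nested, so one of them contains the start of the other. All
uniqueness statements except the one for the long roots come down to this. -/
lemma Av.contra {c b a : ℕ} (h1 : Av c b a) (h2 : Av b c a) : False := by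
  simp only [Av] at *; omega

/-- `x` lies on the arc from `c` (excluded) to `a` (included). -/
def Oc (c x a : ℕ) : Prop := (c < x ∧ x ≤ a) ∨ (a < c ∧ (c < x ∨ x ≤ a))

/-- `c ≤ a`, and both are unbarred or both are barred. -/
def SameUp (n c a : ℕ) : Prop := c ≤ a ∧ (c < n ↔ a < n)

lemma SameUp.trans {n c b a : ℕ} (h1 : SameUp n c b) (h2 : SameUp n b a) : SameUp n c a :=
  ⟨h1.1.trans h2.1, h1.2.trans h2.2⟩

lemma SameUp.refl (n c : ℕ) : SameUp n c c := ⟨le_rfl, Iff.rfl⟩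

lemma av_of_circLT {n : ℕ} (u : SignedPerm n) {i l : Fin n} (hl : l ≠ i) (x : Letter n)
    (hx : (ev u l).val ≠ x.val) :
    ¬ CircLT (ev u i) (ev u l) x ↔ Av (vl u l) (vl u i) x.val := by
  have := vl_ne u hl
  simp only [CircLT, Fin.lt_def, Av, vl] at *
  omega

lemma backStep_sub {n : ℕ} (u : SignedPerm n) {i m : Fin n} (h : i < m) :
    BackStep u (subRoot i m) ↔ ∀ l, i < l → l < m → Av (vl u l) (vl u i) (vl u m) := by
  rw [subRoot, dif_pos h, (sub_step u h).2]
  refine forall_congr' fun l => forall_congr' fun h1 => forall_congr' fun h2 => ?_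
  exact av_of_circLT u h1.ne' _ (vl_ne u h2.ne).1

lemma backStep_long {n : ℕ} (u : SignedPerm n) (i : Fin n) :
    BackStep u (.long i) ↔ ∀ l, i < l → Av (vl u l) (vl u i) (2 * n - 1 - vl u i) := by
  rw [(long_step u i).2]
  refine forall_congr' fun l => forall_congr' fun h1 => ?_
  have h2 := vl_ne u h1.ne'
  rw [av_of_circLT u h1.ne', val_bar]
  · rfl
  · rw [val_bar]; simp only [vl] at h2; omega

lemma backStep_add {n : ℕ} (u : SignedPerm n) {i j : Fin n} (h : i < j) :
    BackStep u (addRoot i j) ↔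
      vl u i + vl u j < 2 * n - 1 ∧ (vl u i < n ↔ n ≤ vl u j) ∧
      (∀ m, i < m → m < j → ¬ (vl u i < vl u m ∧ vl u m + vl u j < 2 * n - 1)) ∧
      ∀ m, j < m → ¬ (vl u i < vl u m ∧ vl u m + vl u j < 2 * n - 1) ∧
        ¬ (vl u j < vl u m ∧ vl u m + vl u i < 2 * n - 1) := by
  rw [addRoot, dif_pos h]
  exact (add_step u h).2

lemma back_append {n : ℕ} {A B : List (PosRoot n)} {u v : SignedPerm n} :
    Back (A ++ B) u v ↔ ∃ w, Back A u w ∧ Back B w v := by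
  induction A generalizing u with
  | nil =>
    constructor
    · exact fun h => ⟨u, Back.nil u, h⟩
    · rintro ⟨w, h1, h2⟩
      cases h1
      exact h2
  | cons β A ih =>
    constructor
    · intro h
      cases h with
      | skip h =>
        obtain ⟨w, h1, h2⟩ := ih.1 h
        exact ⟨w, Back.skip h1, h2⟩
      | step hs h =>
        obtain ⟨w, h1, h2⟩ := ih.1 h
        exact ⟨w, Back.step hs h1, h2⟩
    · rintro ⟨w, h1, h2⟩
      cases h1 with
      | skip h1 => exact Back.skip (ih.2 ⟨w, h1, h2⟩)
      | step hs h1 => exact Back.step hs (ih.2 ⟨w, h1, h2⟩)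

/-! ### Target columns and the counting argument -/

/-- The first `k` values of `d` are the entries of a column with distinct absolute values. -/
structure IsTarget (n k : ℕ) (d : Fin n → ℕ) : Prop where
  lt : ∀ r : Fin n, r.val < k → d r < 2 * n
  ne : ∀ r s : Fin n, r.val < k → s.val < k → r ≠ s → d r ≠ d s ∧ d r + d s ≠ 2 * n - 1

/-- Rows with value in `M` are among the rows with target in `M`. Conversely, a target in `M` is, up
to a bar, the value of some row; this value lies in `M` because `M` is closed under bars, so the row
is not free. Distinct absolute values make this assignment injective, so the two sets of rows have
equal size and coincide. -/
lemma mem_of_target_mem {n k : ℕ} {d : Fin n → ℕ} (hd : IsTarget n k d) (u : SignedPerm n)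
    (M : ℕ → Prop) (hM : ∀ x, x < 2 * n → M x → M (2 * n - 1 - x))
    (hfree : ∀ f : Fin n, k ≤ f.val → ¬ M (vl u f))
    (hrow : ∀ r : Fin n, r.val < k → M (vl u r) → M (d r)) (r : Fin n) (hr : r.val < k)
    (h : M (d r)) : M (vl u r) := by
  classical
  let A : Finset (Fin n) := Finset.univ.filter fun r => r.val < k ∧ M (vl u r)
  let B : Finset (Fin n) := Finset.univ.filter fun r => r.val < k ∧ M (d r)
  have hAB : A ⊆ B := by
    intro s hs
    simp only [A, B, Finset.mem_filter] at hs ⊢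
    exact ⟨hs.1, hs.2.1, hrow s hs.2.1 hs.2.2⟩
  have hex : ∀ s : Fin n, ∃ t : Fin n, s.val < k → vl u t = d s ∨ vl u t = 2 * n - 1 - d s := by
    intro s
    by_cases hs : s.val < k
    · obtain ⟨t, ht⟩ := exists_vl u (hd.lt s hs)
      exact ⟨t, fun _ => ht⟩
    · exact ⟨s, fun h => absurd h hs⟩
  choose t ht using hex
  have hcard : B.card ≤ A.card := by
    apply Finset.card_le_card_of_injOn t
    · intro s hs
      simp only [A, B, Finset.coe_filter, Set.mem_ofPred_eq,
        Finset.mem_univ, true_and] at hs ⊢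
      have hMt : M (vl u (t s)) := by
        rcases ht s hs.1 with e | e
        · rw [e]; exact hs.2
        · rw [e]; exact hM _ (hd.lt s hs.1) hs.2
      exact ⟨not_le.1 fun hk => hfree _ hk hMt, hMt⟩
    · intro s hs s' hs' e
      simp only [B, Finset.coe_filter, Set.mem_ofPred_eq, Finset.mem_univ, true_and] at hs hs'
      by_contra hne
      have h1 := hd.ne s s' hs.1 hs'.1 hne
      have h2 := ht s hs.1
      have h3 := ht s' hs'.1
      have h4 := hd.lt s hs.1
      have h5 := hd.lt s' hs'.1
      rw [e] at h2
      omega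
  have heq := Finset.eq_of_subset_of_card_le hAB hcard
  have hrB : r ∈ B := by simp [B, hr, h]
  rw [← heq] at hrB
  simp only [A, Finset.mem_filter] at hrB
  exact hrB.2.2

/-- The condition on row `p` of the current window `u` and of the target column `d`. -/
def RowCond {n : ℕ} (k : ℕ) (d : Fin n → ℕ) (u : SignedPerm n) (p : Fin n) : Prop :=
  ∀ l : Fin n, p < l → l.val < k → Av (d l) (vl u p) (d p)

/-! ### Greedy walks within a row -/

/-- Greedy rule: exchange rows `i` and `m` exactly when the value of `m` lies on the arc from the
value of `i` (excluded) to the target `a` (included). Free rows already passed have no value on that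
arc, and settled rows avoid it, so the exchange is a step; it shortens the arc. -/
lemma exists_back_sub {n k : ℕ} {i : Fin n} (hi : i.val < k) (a : ℕ) (L : List (Fin n))
    (hL : L.Pairwise (· < ·)) (hk : ∀ m ∈ L, k ≤ m.val) (u : SignedPerm n)
    (hfree : ∀ m : Fin n, k ≤ m.val → m ∉ L → ¬ Oc (vl u i) (vl u m) a)
    (hdone : ∀ l : Fin n, i < l → l.val < k → Av (vl u l) (vl u i) a) :
    ∃ u', Back (L.map (subRoot i)) u u' ∧ (∀ r : Fin n, r.val < k → r ≠ i → vl u' r = vl u r) ∧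
      (∀ m : Fin n, k ≤ m.val → ¬ Oc (vl u' i) (vl u' m) a) ∧
      ∀ z, Av z (vl u i) a → Av z (vl u' i) a := by
  induction L generalizing u with
  | nil => exact ⟨u, Back.nil u, fun _ _ _ => rfl, fun m hm => hfree m hm (by simp), fun _ h => h⟩
  | cons m L ih =>
    rw [List.pairwise_cons] at hL
    have hmk : k ≤ m.val := hk m (by simp)
    have him : i < m := by rw [Fin.lt_def]; omega
    have hmL : m ∉ L := fun h => lt_irrefl _ (hL.1 m h)
    by_cases hm : Oc (vl u i) (vl u m) a
    · have hstep : BackStep u (subRoot i m) := by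
        rw [backStep_sub u him]
        intro l h1 h2
        have e1 := vl_ne u h1.ne'
        have e2 := vl_ne u h2.ne
        by_cases hl : l.val < k
        · have := hdone l h1 hl
          simp only [Oc, Av] at *
          omega
        · have hlL : l ∉ m :: L := by
            rw [List.mem_cons]
            rintro (h | h)
            · exact h2.ne h
            · exact h2.not_gt (hL.1 l h)
          have := hfree l (not_lt.1 hl) hlL
          simp only [Oc, Av] at *
          omega
      have hv := vl_subRoot u him
      have e1 := vl_ne u him.ne
      have hvi : vl (u * (subRoot i m).refl) i = vl u m := by rw [hv, if_pos rfl]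
      have hvr : ∀ r : Fin n, r.val < k → r ≠ i → vl (u * (subRoot i m).refl) r = vl u r := by
        intro r hr hri
        rw [hv, if_neg hri, if_neg]
        rintro rfl
        omega
      have hmon : ∀ z, Av z (vl u i) a → Av z (vl u m) a := by
        intro z hz
        simp only [Oc, Av] at *
        omega
      obtain ⟨u', h1, h2, h3, h4⟩ := ih hL.2 (fun q hq => hk q (by simp [hq]))
        (u * (subRoot i m).refl)
        (by
          intro q hq hqL
          rw [hvi, hv, if_neg (by rintro rfl; omega)]
          by_cases hqm : q = m
          · rw [if_pos hqm]
            simp only [Oc] at *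
            omega
          · rw [if_neg hqm]
            have := hfree q hq (by simp [hqm, hqL])
            simp only [Oc] at *
            omega)
        (by
          intro l h1 h2
          rw [hvi, hvr l h2 h1.ne']
          exact hmon _ (hdone l h1 h2))
      refine ⟨u', Back.step hstep h1, fun r hr hri => ?_, h3, fun z hz => h4 z ?_⟩
      · rw [h2 r hr hri, hvr r hr hri]
      · rw [hvi]; exact hmon z hz
    · obtain ⟨u', h1, h2⟩ := ih hL.2 (fun q hq => hk q (by simp [hq])) u
        (by
          intro q hq hqL
          by_cases hqm : q = m
          · rw [hqm]; exact hm
          · exact hfree q hq (by simp [hqm, hqL])) hdone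
      exact ⟨u', Back.skip h1, h2⟩

/-- The same greedy rule for the bars of the free values. Row `i` and its target now have the same
sign, so the arc is an interval, as the criterion for `ε_i + ε_m` requires. -/
lemma exists_back_add {n k : ℕ} {i : Fin n} (hi : i.val < k) (a : ℕ) (L : List (Fin n))
    (hL : L.Pairwise (· > ·)) (hk : ∀ m ∈ L, k ≤ m.val) (u : SignedPerm n)
    (hup : SameUp n (vl u i) a)
    (hfree : ∀ m : Fin n, k ≤ m.val → ¬ (vl u i < vl u m ∧ vl u m ≤ a))
    (hfree' : ∀ m : Fin n, k ≤ m.val → m ∉ L →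
      ¬ (vl u i < 2 * n - 1 - vl u m ∧ 2 * n - 1 - vl u m ≤ a))
    (hdone : ∀ l : Fin n, i < l → l.val < k → ¬ (vl u i < vl u l ∧ vl u l ≤ a)) :
    ∃ u', Back (L.map (addRoot i)) u u' ∧ (∀ r : Fin n, r.val < k → r ≠ i → vl u' r = vl u r) ∧
      SameUp n (vl u' i) a ∧ vl u i ≤ vl u' i ∧
      ∀ m : Fin n, k ≤ m.val → ¬ (vl u' i < vl u' m ∧ vl u' m ≤ a) ∧
        ¬ (vl u' i < 2 * n - 1 - vl u' m ∧ 2 * n - 1 - vl u' m ≤ a) := by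
  induction L generalizing u with
  | nil =>
    exact ⟨u, Back.nil u, fun _ _ _ => rfl, hup, le_rfl,
      fun m hm => ⟨hfree m hm, hfree' m hm (by simp)⟩⟩
  | cons m L ih =>
    rw [List.pairwise_cons] at hL
    have hmk : k ≤ m.val := hk m (by simp)
    have him : i < m := by rw [Fin.lt_def]; omega
    have hmL : m ∉ L := fun h => lt_irrefl _ (hL.1 m h)
    have hm1 := vl_lt u m
    have hi1 := vl_lt u i
    by_cases hm : vl u i < 2 * n - 1 - vl u m ∧ 2 * n - 1 - vl u m ≤ a
    · have hstep : BackStep u (addRoot i m) := by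
        rw [backStep_add u him]
        simp only [SameUp] at hup
        refine ⟨by omega, by omega, ?_, ?_⟩
        · intro l h1 h2
          by_cases hl : l.val < k
          · have := hdone l h1 hl
            omega
          · have := hfree l (not_lt.1 hl)
            omega
        · intro l h1
          have hlk : k ≤ l.val := hmk.trans (Fin.le_def.1 h1.le)
          have hlL : l ∉ m :: L := by
            rw [List.mem_cons]
            rintro (h | h)
            · exact h1.ne' h
            · exact h1.not_gt (hL.1 l h)
          have e1 := hfree l hlk
          have e2 := hfree' l hlk hlL
          have e3 := vl_lt u l
          omega
      have hv := vl_addRoot u him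
      have hvi : vl (u * (addRoot i m).refl) i = 2 * n - 1 - vl u m := by rw [hv, if_pos rfl]
      have hvr : ∀ r : Fin n, r.val < k → r ≠ i → vl (u * (addRoot i m).refl) r = vl u r := by
        intro r hr hri
        rw [hv, if_neg hri, if_neg]
        rintro rfl
        omega
      simp only [SameUp] at hup
      obtain ⟨u', h1, h2, h3, h4, h5⟩ := ih hL.2 (fun q hq => hk q (by simp [hq]))
        (u * (addRoot i m).refl)
        (by rw [hvi]; simp only [SameUp]; omega)
        (by
          intro q hq
          rw [hvi, hv, if_neg (by rintro rfl; omega)]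
          by_cases hqm : q = m
          · rw [if_pos hqm]
            omega
          · rw [if_neg hqm]
            have := hfree q hq
            omega)
        (by
          intro q hq hqL
          rw [hvi, hv, if_neg (by rintro rfl; omega)]
          by_cases hqm : q = m
          · rw [if_pos hqm]
            omega
          · rw [if_neg hqm]
            have := hfree' q hq (by simp [hqm, hqL])
            omega)
        (by
          intro l h1 h2
          rw [hvi, hvr l h2 h1.ne']
          have := hdone l h1 h2
          omega)
      refine ⟨u', Back.step hstep h1, fun r hr hri => ?_, h3, ?_, h5⟩
      · rw [h2 r hr hri, hvr r hr hri]
      · rw [hvi] at h4; omega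
    · obtain ⟨u', h1, h2⟩ := ih hL.2 (fun q hq => hk q (by simp [hq])) u hup hfree
        (by
          intro q hq hqL
          by_cases hqm : q = m
          · rw [hqm]; exact hm
          · exact hfree' q hq (by simp [hqm, hqL])) hdone
      exact ⟨u', Back.skip h1, h2⟩

/-- No target value `d q` of the rows considered lies on the arc from `ā` to `c̄`, where `c` and `a`
are the current value and the target of row `i`. -/
lemma no_target_between {n k : ℕ} {d : Fin n → ℕ} (hd : IsTarget n k d) {i : Fin n}
    (hi : i.val < k) (u : SignedPerm n)
    (hrow : ∀ p, p < i → RowCond k d u p)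
    (hdone : ∀ l : Fin n, i < l → l.val < k → vl u l = d l)
    (hup : SameUp n (vl u i) (d i))
    (hfree : ∀ m : Fin n, k ≤ m.val → ¬ (vl u i < vl u m ∧ vl u m ≤ d i) ∧
        ¬ (vl u i < 2 * n - 1 - vl u m ∧ 2 * n - 1 - vl u m ≤ d i))
    {q : Fin n} (hq : q.val < k) (hqi : q ≠ i)
    (h1 : 2 * n - 1 - d i ≤ d q) (h2 : d q < 2 * n - 1 - vl u i)
    (hle : ∀ r, r < i → 2 * n - 1 - d i ≤ vl u r → vl u r ≤ d q → r ≤ q) : False := by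
  have hdi := hd.lt i hi
  have hdq := hd.lt q hq
  have hui := vl_lt u i
  simp only [SameUp] at hup
  -- The set is the interval from the bar of `d i` to `d q` together with its image under the bar.
  -- It contains `d i` but not the current value of row `i`, contrary to the counting lemma.
  have key := mem_of_target_mem hd u
    (fun x => (2 * n - 1 - d i ≤ x ∧ x ≤ d q) ∨ (2 * n - 1 - d q ≤ x ∧ x ≤ d i))
    (by intro x hx h; omega)
    (by
      intro f hf
      have e1 := hfree f hf
      have e2 := vl_lt u f
      omega)
    (by
      intro r hr h
      rcases lt_trichotomy r i with hri | rfl | hri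
      · have e1 := hrow r hri i hri hi
        rcases h with h | h
        · rcases (hle r hri h.1 h.2).lt_or_eq with hrq | rfl
          · have e2 := hrow r hri q hrq hq
            simp only [Av] at e1 e2
            omega
          · omega
        · simp only [Av] at e1
          omega
      · omega
      · rw [← hdone r hri hr]; exact h)
    i hi (by omega)
  omega

/-- Greedy rule: fold at `(p, ī)` exactly when the bar of the value of `p` lies above the value of
`i` and not beyond its target. `hloc` guarantees arrival: the target is already there, or its bar is
held by a row still to be treated. Rows `p` also move, but only along their own arcs towards their
targets, so their conditions persist. -/
lemma exists_back_below {n k : ℕ} {d : Fin n → ℕ} (hd : IsTarget n k d) {i : Fin n}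
    (hi : i.val < k) (L : List (Fin n)) (hL : L.Pairwise (· > ·)) (hLi : ∀ p ∈ L, p < i)
    (u : SignedPerm n)
    (hrow : ∀ p, p < i → RowCond k d u p)
    (hdone : ∀ l : Fin n, i < l → l.val < k → vl u l = d l)
    (hup : SameUp n (vl u i) (d i))
    (hfree : ∀ m : Fin n, k ≤ m.val → ¬ (vl u i < vl u m ∧ vl u m ≤ d i) ∧
        ¬ (vl u i < 2 * n - 1 - vl u m ∧ 2 * n - 1 - vl u m ≤ d i))
    (hav : ∀ l : Fin n, i < l → l.val < k → ¬ (vl u i < d l ∧ d l ≤ d i))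
    (hproc : ∀ r, r < i → r ∉ L → ¬ (vl u i < 2 * n - 1 - vl u r ∧ 2 * n - 1 - vl u r ≤ d i))
    (hloc : vl u i = d i ∨ ∃ r ∈ L, 2 * n - 1 - vl u r = d i) :
    ∃ u', Back (L.map (fun p => addRoot p i)) u u' ∧ vl u' i = d i ∧
      (∀ r, i < r → vl u' r = vl u r) ∧
      ∀ p, p < i → (∀ z, Av z (vl u p) (d p) → Av z (vl u' p) (d p)) ∧
        (SameUp n (vl u p) (d p) → SameUp n (vl u' p) (d p)) := by
  induction L generalizing u with
  | nil =>
    refine ⟨u, Back.nil u, ?_, fun _ _ => rfl, fun p _ => ⟨fun _ h => h, fun h => h⟩⟩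
    rcases hloc with h | ⟨r, hr, -⟩
    · exact h
    · simp at hr
  | cons p L ih =>
    rw [List.pairwise_cons] at hL
    have hpi : p < i := hLi p (by simp)
    have hp1 := vl_lt u p
    have hi1 := vl_lt u i
    have hdi := hd.lt i hi
    have hpk : p.val < k := lt_trans hpi hi
    have hdp := hd.lt p hpk
    by_cases hp : vl u i < 2 * n - 1 - vl u p ∧ 2 * n - 1 - vl u p ≤ d i
    · have hproc' : ∀ r, p < r → r < i →
          ¬ (vl u i < 2 * n - 1 - vl u r ∧ 2 * n - 1 - vl u r ≤ d i) := by
        intro r h1 h2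
        refine hproc r h2 ?_
        rw [List.mem_cons]
        rintro (h | h)
        · exact h1.ne' h
        · exact h1.not_gt (hL.1 r h)
      have hbar : ∀ l : Fin n, i < l → l.val < k →
          ¬ (2 * n - 1 - d i ≤ d l ∧ d l < 2 * n - 1 - vl u i) := by
        intro l h1 h2 h3
        exact no_target_between hd hi u hrow hdone hup hfree h2 h1.ne' h3.1 h3.2
          (fun r hr _ _ => (hr.trans h1).le)
      -- Row `p` does not jump over its own target. A row with value between `u(p)` and `d p` lying
      -- after `p` has been refused before, which supplies the last hypothesis of
      -- `no_target_between`.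
      have hdpb : ¬ (vl u p ≤ d p ∧ d p < 2 * n - 1 - vl u i) := by
        intro h3
        refine no_target_between hd hi u hrow hdone hup hfree hpk hpi.ne (by omega) h3.2
          (fun r hr e1 e2 => ?_)
        by_contra hrp
        have e3 := hproc' r (not_le.1 hrp) hr
        have e4 := vl_lt u r
        omega
      have hstep : BackStep u (addRoot p i) := by
        rw [backStep_add u hpi]
        simp only [SameUp] at hup
        clear hloc
        refine ⟨by omega, by omega, ?_, ?_⟩
        · intro r h1 h2
          have e3 := hproc' r h1 h2
          have e4 := vl_lt u r
          omega
        · intro l h1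
          have e4 := vl_lt u l
          by_cases hl : l.val < k
          · have e1 := hbar l h1 hl
            have e2 := hav l h1 hl
            rw [hdone l h1 hl]
            omega
          · have e1 := hfree l (not_lt.1 hl)
            omega
      have hv := vl_addRoot u hpi
      have hvi : vl (u * (addRoot p i).refl) i = 2 * n - 1 - vl u p := by
        rw [hv, if_neg hpi.ne', if_pos rfl]
      have hvp : vl (u * (addRoot p i).refl) p = 2 * n - 1 - vl u i := by
        rw [hv, if_pos rfl]
      have hvr : ∀ r, r ≠ p → r ≠ i → vl (u * (addRoot p i).refl) r = vl u r := by
        intro r h1 h2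
        rw [hv, if_neg h1, if_neg h2]
      simp only [SameUp] at hup
      have hmono : ∀ q, q < i →
          (∀ z, Av z (vl u q) (d q) → Av z (vl (u * (addRoot p i).refl) q) (d q)) ∧
          (SameUp n (vl u q) (d q) → SameUp n (vl (u * (addRoot p i).refl) q) (d q)) := by
        intro q hq
        by_cases hqp : q = p
        · subst hqp
          rw [hvp]
          constructor
          · intro z hz
            simp only [Av] at *
            omega
          · intro h
            simp only [SameUp] at *
            omega
        · rw [hvr q hqp hq.ne]
          exact ⟨fun _ h => h, fun h => h⟩
      obtain ⟨u', h1, h2, h3, h4⟩ := ih hL.2 (fun q hq => hLi q (by simp [hq]))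
        (u * (addRoot p i).refl)
        (fun q hq l hl hlk => (hmono q hq).1 _ (hrow q hq l hl hlk))
        (fun l hl hlk => by rw [hvr l (hpi.trans hl).ne' hl.ne', hdone l hl hlk])
        (by clear hloc; rw [hvi]; simp only [SameUp]; omega)
        (by
          intro m hm
          have hmi : i < m := Fin.lt_def.2 (lt_of_lt_of_le hi hm)
          rw [hvi, hvr m (hpi.trans hmi).ne' hmi.ne']
          have := hfree m hm
          omega)
        (by
          intro l hl hlk
          rw [hvi]
          have := hav l hl hlk
          omega)
        (by
          intro r hr hrL
          rw [hvi]
          by_cases hrp : r = p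
          · subst hrp
            rw [hvp]
            omega
          · rw [hvr r hrp hr.ne]
            have := hproc r hr (by simp [hrp, hrL])
            omega)
        (by
          rw [hvi]
          rcases hloc with h | ⟨r, hr, h⟩
          · omega
          · rcases List.mem_cons.1 hr with rfl | hr'
            · exact Or.inl h
            · refine Or.inr ⟨r, hr', ?_⟩
              rw [hvr r (hL.1 r hr').ne (hLi r hr).ne, h])
      refine ⟨u', Back.step hstep h1, h2, fun r hr => ?_, fun q hq => ⟨fun z hz => ?_, fun h => ?_⟩⟩
      · rw [h3 r hr, hvr r (hpi.trans hr).ne' hr.ne']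
      · exact (h4 q hq).1 z ((hmono q hq).1 z hz)
      · exact (h4 q hq).2 ((hmono q hq).2 h)
    · obtain ⟨u', h1, h2⟩ := ih hL.2 (fun q hq => hLi q (by simp [hq])) u hrow hdone hup hfree hav
        (by
          intro r hr hrL
          by_cases hrp : r = p
          · rw [hrp]; exact hp
          · exact hproc r hr (by simp [hrp, hrL]))
        (by
          rcases hloc with h | ⟨r, hr, h⟩
          · exact Or.inl h
          · rcases List.mem_cons.1 hr with rfl | hr'
            · simp only [SameUp] at hup
              exact Or.inl (by omega)
            · exact Or.inr ⟨r, hr', h⟩)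
      exact ⟨u', Back.skip h1, h2⟩

/-! ### Values avoided by the walks within a row -/

/-- Each step advances row `i` along an arc missing the rows between `i` and `m`; the arcs of
successive steps are joined by `Av.trans`. -/
lemma back_sub_av {n k : ℕ} {i : Fin n} (hi : i.val < k) (L : List (Fin n))
    (hL : L.Pairwise (· < ·)) (hk : ∀ m ∈ L, k ≤ m.val) {u u' : SignedPerm n}
    (h : Back (L.map (subRoot i)) u u') :
    (∀ r : Fin n, r.val < k → r ≠ i → vl u' r = vl u r) ∧
    ∀ l, i < l → (∀ m ∈ L, l < m) → vl u' l = vl u l ∧ Av (vl u l) (vl u i) (vl u' i) := by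
  induction L generalizing u with
  | nil =>
    cases h
    exact ⟨fun _ _ _ => rfl, fun l hl _ => ⟨rfl, Av.refl (vl_ne u' hl.ne').1⟩⟩
  | cons m L ih =>
    rw [List.pairwise_cons] at hL
    have hmk : k ≤ m.val := hk m (by simp)
    have him : i < m := by rw [Fin.lt_def]; omega
    have ih := @ih hL.2 (fun q hq => hk q (by simp [hq]))
    rw [List.map_cons] at h
    cases h with
    | skip h =>
      obtain ⟨h1, h2⟩ := ih h
      exact ⟨h1, fun l hl hlm => h2 l hl fun q hq => hlm q (by simp [hq])⟩
    | step hs h =>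
      obtain ⟨h1, h2⟩ := ih h
      have hv := vl_subRoot u him
      rw [backStep_sub u him] at hs
      refine ⟨fun r hr hri => ?_, fun l hl hlm => ?_⟩
      · rw [h1 r hr hri, hv, if_neg hri, if_neg]
        rintro rfl
        omega
      · have hlm' : l < m := hlm m (by simp)
        obtain ⟨h3, h4⟩ := h2 l hl fun q hq => hlm q (by simp [hq])
        have e : vl (u * (subRoot i m).refl) l = vl u l := by
          rw [hv, if_neg hl.ne', if_neg hlm'.ne]
        rw [e] at h3 h4
        rw [hv i, if_pos rfl] at h4
        exact ⟨h3, (hs l hl hlm').trans h4⟩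

lemma back_long_av {n : ℕ} {i : Fin n} {u u' : SignedPerm n} (h : Back [PosRoot.long i] u u') :
    (∀ r, r ≠ i → vl u' r = vl u r) ∧ ∀ l, i < l → Av (vl u l) (vl u i) (vl u' i) := by
  cases h with
  | skip h =>
    cases h
    exact ⟨fun _ _ => rfl, fun l hl => Av.refl (vl_ne u hl.ne').1⟩
  | step hs h =>
    cases h
    rw [backStep_long] at hs
    refine ⟨fun r hr => by rw [vl_long, if_neg hr], fun l hl => ?_⟩
    rw [vl_long, if_pos rfl]
    exact hs l hl

/-- Row `i` moves up within its sign. A later row either keeps its value or had a value of the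
opposite sign, which no further upward motion of row `i` can meet. The bars of rows already passed
are avoided as well, which is what uniqueness needs. -/
lemma back_add_av {n k : ℕ} {i : Fin n} (hi : i.val < k) (L : List (Fin n))
    (hL : L.Pairwise (· > ·)) (hk : ∀ m ∈ L, k ≤ m.val) {u u' : SignedPerm n}
    (h : Back (L.map (addRoot i)) u u') :
    (∀ r : Fin n, r.val < k → r ≠ i → vl u' r = vl u r) ∧ SameUp n (vl u i) (vl u' i) ∧
    (∀ l, i < l → Av (vl u l) (vl u i) (vl u' i) ∧
      (vl u' l = vl u l ∨ (vl u l < n ↔ n ≤ vl u' i))) ∧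
    ∀ l, i < l → (∀ m ∈ L, m < l) →
      vl u' l = vl u l ∧ Av (2 * n - 1 - vl u l) (vl u i) (vl u' i) := by
  induction L generalizing u with
  | nil =>
    cases h
    refine ⟨fun _ _ _ => rfl, SameUp.refl _ _,
      fun l hl => ⟨Av.refl (vl_ne u' hl.ne').1, Or.inl rfl⟩, fun l hl _ => ⟨rfl, Av.refl ?_⟩⟩
    have := vl_ne u' hl.ne'
    have := vl_lt u' l
    omega
  | cons m L ih =>
    rw [List.pairwise_cons] at hL
    have hmk : k ≤ m.val := hk m (by simp)
    have him : i < m := by rw [Fin.lt_def]; omega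
    have ih := @ih hL.2 (fun q hq => hk q (by simp [hq]))
    rw [List.map_cons] at h
    cases h with
    | skip h =>
      obtain ⟨h1, h2, h3, h4⟩ := ih h
      exact ⟨h1, h2, h3, fun l hl hlm => h4 l hl fun q hq => hlm q (by simp [hq])⟩
    | step hs h =>
      obtain ⟨h1, h2, h3, h4⟩ := ih h
      have hv := vl_addRoot u him
      rw [backStep_add u him] at hs
      obtain ⟨s1, s2, s3, s4⟩ := hs
      have hm1 := vl_lt u m
      have hi1 := vl_lt u i
      have hvi : vl (u * (addRoot i m).refl) i = 2 * n - 1 - vl u m := by rw [hv i, if_pos rfl]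
      have hvm : vl (u * (addRoot i m).refl) m = 2 * n - 1 - vl u i := by
        rw [hv m, if_neg him.ne', if_pos rfl]
      rw [hvi] at h2 h3 h4
      have hup : SameUp n (vl u i) (2 * n - 1 - vl u m) := by
        simp only [SameUp]; omega
      refine ⟨fun r hr hri => ?_, hup.trans h2, fun l hl => ?_, fun l hl hlm => ?_⟩
      · rw [h1 r hr hri, hv, if_neg hri, if_neg]
        rintro rfl
        omega
      -- Row `m` itself changes; by the sign condition its old value is off every interval that row
      -- `i` traverses.
      · by_cases hlm : l = m
        · subst hlm
          simp only [SameUp, Av] at *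
          omega
        · have e : vl (u * (addRoot i m).refl) l = vl u l := by
            rw [hv, if_neg hl.ne', if_neg hlm]
          have h5 := h3 l hl
          rw [e] at h5
          refine ⟨Av.trans ?_ h5.1, h5.2⟩
          have e1 := vl_ne u hlm
          have e2 := vl_ne u hl.ne'
          rcases lt_or_gt_of_ne hlm with h6 | h6
          · have := s3 l hl h6
            simp only [Av]
            omega
          · have := s4 l h6
            simp only [Av]
            omega
      · have hlm' : m < l := hlm m (by simp)
        have e : vl (u * (addRoot i m).refl) l = vl u l := by
          rw [hv, if_neg hl.ne', if_neg hlm'.ne']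
        have h5 := h4 l hl fun q hq => hlm q (by simp [hq])
        rw [e] at h5
        refine ⟨h5.1, Av.trans ?_ h5.2⟩
        have e1 := vl_ne u hlm'.ne'
        have e2 := vl_ne u hl.ne'
        have e3 := s4 l hlm'
        have e4 := vl_lt u l
        simp only [Av]
        omega

/-- Both rows taking part in a step at `(p, ī)` move up within their signs, over intervals that
contain neither a value of a row after `i` nor the bar of one. -/
lemma back_below_av {n : ℕ} {i : Fin n} (L : List (Fin n))
    (hL : L.Pairwise (· > ·)) (hLi : ∀ p ∈ L, p < i) {u u' : SignedPerm n}
    (h : Back (L.map (fun p => addRoot p i)) u u') :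
    (∀ r, r ≠ i → r ∉ L → vl u' r = vl u r) ∧ SameUp n (vl u i) (vl u' i) ∧
    (∀ l, i < l → Av (vl u l) (vl u i) (vl u' i) ∧ Av (2 * n - 1 - vl u l) (vl u i) (vl u' i)) ∧
    (∀ r, r < i → (∀ q ∈ L, q < r) → Av (2 * n - 1 - vl u r) (vl u i) (vl u' i)) ∧
    ∀ p, p < i → SameUp n (vl u p) (vl u' p) ∧ ∀ l, i < l →
      Av (vl u l) (vl u p) (vl u' p) ∧ Av (2 * n - 1 - vl u l) (vl u p) (vl u' p) := by
  induction L generalizing u with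
  | nil =>
    cases h
    have hb : ∀ l p, l ≠ p → Av (2 * n - 1 - vl u' l) (vl u' p) (vl u' p) := by
      intro l p hlp
      apply Av.refl
      have := vl_ne u' hlp
      have := vl_lt u' l
      omega
    exact ⟨fun _ _ _ => rfl, SameUp.refl _ _, fun l hl => ⟨Av.refl (vl_ne u' hl.ne').1, hb _ _ hl.ne'⟩,
      fun r hr _ => hb _ _ hr.ne, fun p hp => ⟨SameUp.refl _ _, fun l hl =>
        ⟨Av.refl (vl_ne u' (hp.trans hl).ne').1, hb _ _ (hp.trans hl).ne'⟩⟩⟩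
  | cons p L ih =>
    rw [List.pairwise_cons] at hL
    have hpi : p < i := hLi p (by simp)
    have hpL : p ∉ L := fun h => lt_irrefl _ (hL.1 p h)
    have ih := @ih hL.2 (fun q hq => hLi q (by simp [hq]))
    rw [List.map_cons] at h
    cases h with
    | skip h =>
      obtain ⟨h1, h2, h3, h4, h5⟩ := ih h
      exact ⟨fun r hr hrL => h1 r hr fun hh => hrL (by simp [hh]), h2, h3,
        fun r hr hrL => h4 r hr fun q hq => hrL q (by simp [hq]), h5⟩
    | step hs h =>
      obtain ⟨h1, h2, h3, h4, h5⟩ := ih h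
      have hv := vl_addRoot u hpi
      rw [backStep_add u hpi] at hs
      obtain ⟨s1, s2, s3, s4⟩ := hs
      have hp1 := vl_lt u p
      have hi1 := vl_lt u i
      have hvi : vl (u * (addRoot p i).refl) i = 2 * n - 1 - vl u p := by
        rw [hv i, if_neg hpi.ne', if_pos rfl]
      have hvp : vl (u * (addRoot p i).refl) p = 2 * n - 1 - vl u i := by
        rw [hv p, if_pos rfl]
      have hvr : ∀ r, r ≠ p → r ≠ i → vl (u * (addRoot p i).refl) r = vl u r := by
        intro r h1 h2
        rw [hv, if_neg h1, if_neg h2]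
      rw [hvi] at h2 h3 h4
      have hup : SameUp n (vl u i) (2 * n - 1 - vl u p) := by
        simp only [SameUp]; omega
      have hup' : SameUp n (vl u p) (2 * n - 1 - vl u i) := by
        simp only [SameUp]; omega
      refine ⟨fun r hr hrL => ?_, hup.trans h2, fun l hl => ?_, fun r hr hrL => ?_,
        fun q hq => ?_⟩
      · rw [List.mem_cons, not_or] at hrL
        rw [h1 r hr hrL.2, hvr r hrL.1 hr]
      · have h6 := h3 l hl
        rw [hvr l (hpi.trans hl).ne' hl.ne'] at h6
        have e1 := vl_ne u hl.ne'
        have e2 := vl_ne u (hpi.trans hl).ne'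
        have e3 := s4 l hl
        have e4 := vl_lt u l
        refine ⟨Av.trans ?_ h6.1, Av.trans ?_ h6.2⟩ <;> simp only [Av] <;> omega
      · have hpr : p < r := hrL p (by simp)
        have h6 := h4 r hr fun q hq => hrL q (by simp [hq])
        rw [hvr r hpr.ne' hr.ne] at h6
        have e1 := vl_ne u hpr.ne'
        have e2 := vl_ne u hr.ne
        have e3 := s3 r hpr hr
        have e4 := vl_lt u r
        refine Av.trans ?_ h6
        simp only [Av]
        omega
      · by_cases hqp : q = p
        · subst hqp
          rw [h1 q hq.ne hpL, hvp]
          refine ⟨hup', fun l hl => ?_⟩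
          have e1 := vl_ne u hl.ne'
          have e2 := vl_ne u (hpi.trans hl).ne'
          have e3 := s4 l hl
          have e4 := vl_lt u l
          constructor <;> simp only [Av] <;> omega
        · have h6 := h5 q hq
          rw [hvr q hqp hq.ne] at h6
          refine ⟨h6.1, fun l hl => ?_⟩
          have h7 := h6.2 l hl
          rwa [hvr l (hpi.trans hl).ne' hl.ne'] at h7

/-- Undoing a step at `(p, ī)` lengthens the arc of row `p` by the interval from `u(p)` to the bar
of `u(i)`. What has to be shown is that this interval contains no target of a row after `p`. -/
lemma rowCond_of_back_below {n k : ℕ} {d : Fin n → ℕ} (hd : IsTarget n k d) {i : Fin n}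
    (hi : i.val < k) (L : List (Fin n)) (hL : L.Pairwise (· > ·)) (hLi : ∀ p ∈ L, p < i)
    {u u' : SignedPerm n} (h : Back (L.map (fun p => addRoot p i)) u u')
    (hui : vl u' i = d i) (hdone : ∀ l : Fin n, i < l → l.val < k → vl u' l = d l)
    (hrow : ∀ p, p < i → RowCond k d u' p) :
    ∀ p, p < i → RowCond k d u p := by
  induction L generalizing u with
  | nil =>
    cases h
    exact hrow
  | cons p L ih =>
    rw [List.pairwise_cons] at hL
    have hpi : p < i := hLi p (by simp)
    have hpk : p.val < k := lt_trans hpi hi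
    have hLi' : ∀ q ∈ L, q < i := fun q hq => hLi q (by simp [hq])
    rw [List.map_cons] at h
    cases h with
    | skip h => exact ih hL.2 hLi' h
    | step hs h =>
      have hr1 := ih hL.2 hLi' h
      obtain ⟨h1, h2, h3, h4, -⟩ := back_below_av L hL.2 hLi' h
      have hv := vl_addRoot u hpi
      rw [backStep_add u hpi] at hs
      obtain ⟨s1, s2, s3, s4⟩ := hs
      have hp1 := vl_lt u p
      have hi1 := vl_lt u i
      have hdi := hd.lt i hi
      have hvi : vl (u * (addRoot p i).refl) i = 2 * n - 1 - vl u p := by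
        rw [hv i, if_neg hpi.ne', if_pos rfl]
      have hvp : vl (u * (addRoot p i).refl) p = 2 * n - 1 - vl u i := by
        rw [hv p, if_pos rfl]
      have hvr : ∀ r, r ≠ p → r ≠ i → vl (u * (addRoot p i).refl) r = vl u r := by
        intro r h1 h2
        rw [hv, if_neg h1, if_neg h2]
      rw [hvi, hui] at h2 h3 h4
      intro q hq
      by_cases hqp : q = p
      swap
      · intro l hql hl
        have := hr1 q hq l hql hl
        rwa [hvr q hqp hq.ne] at this
      subst hqp
      intro l hql hlk
      have hA := hr1 q hq l hql hlk
      rw [hvp] at hA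
      by_contra hcon
      have hdq := hd.lt q hpk
      have hdl := hd.lt l hlk
      have hne := hd.ne l q hlk hpk hql.ne'
      -- Since the arc after the step avoids `d l`, a violation must come from the added interval.
      have hbetween : vl u q ≤ d l ∧ d l < 2 * n - 1 - vl u i := by
        simp only [Av] at *
        omega
      simp only [SameUp] at h2
      rcases lt_trichotomy l i with hli | rfl | hli
      · have hfree : ∀ m : Fin n, i < m → ¬ ((2 * n - 1 - d i ≤ vl u m ∧ vl u m ≤ d l) ∨
            (2 * n - 1 - d l ≤ vl u m ∧ vl u m ≤ d i)) := by
          intro m hm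
          have e1 := h3 m hm
          rw [hvr m (hpi.trans hm).ne' hm.ne'] at e1
          have e2 := s4 m hm
          have e3 := vl_ne u hm.ne'
          have e4 := vl_ne u (hpi.trans hm).ne'
          have e5 := vl_lt u m
          simp only [Av] at e1
          clear hcon hA
          omega
        have hmid : ∀ r, q < r → r < i → ¬ (2 * n - 1 - d i ≤ vl u r ∧ vl u r ≤ d l) := by
          intro r hqr hri
          have e1 := h4 r hri (fun p hp => (hL.1 p hp).trans hqr)
          rw [hvr r hqr.ne' hri.ne] at e1
          have e2 := s3 r hqr hri
          have e3 := vl_ne u hri.ne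
          have e4 := vl_ne u hqr.ne'
          have e5 := vl_lt u r
          simp only [Av] at e1
          clear hcon hA
          omega
        -- For `l` between `q` and `i`, the set is the interval from the bar of `d i` to `d l` and
        -- its image under the bar. It contains the target `d l`, while `hmid` and the condition on
        -- row `l` keep the value of row `l` out of it.
        have key := mem_of_target_mem hd (u * (addRoot q i).refl)
          (fun x => (2 * n - 1 - d i ≤ x ∧ x ≤ d l) ∨ (2 * n - 1 - d l ≤ x ∧ x ≤ d i))
          (by clear hcon hA; intro x hx h; omega)
          (by
            intro f hf
            have hfi : i < f := Fin.lt_def.2 (lt_of_lt_of_le hi hf)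
            rw [hvr f (hpi.trans hfi).ne' hfi.ne']
            exact hfree f hfi)
          (by
            intro r hr h
            rcases lt_trichotomy r i with hri | rfl | hri
            · have e1 := hr1 r hri i hri hi
              rcases h with h | h
              · rcases lt_trichotomy r q with hrq | rfl | hrq
                · have e2 := hr1 r hri l (hrq.trans hql) hlk
                  clear hcon hA
                  simp only [Av] at e1 e2
                  omega
                · rw [hvp] at h
                  clear hcon hA
                  omega
                · rw [hvr r hrq.ne' hri.ne] at h
                  exact absurd h (hmid r hrq hri)
              · clear hcon hA
                simp only [Av] at e1
                omega
            · clear hcon hA; omega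
            · have e1 := h1 r hri.ne' (fun hh => (hLi' r hh).not_gt hri)
              rw [← hdone r hri hr, e1]; exact h)
          l hlk (by clear hcon hA; omega)
        have e1 := hr1 l hli i hli hi
        rw [hvr l hql.ne' hli.ne] at key e1
        have e2 := hmid l hql hli
        clear hcon hA
        simp only [Av] at e1
        omega
      · clear hcon hA
        omega
      · have e1 := h1 l hli.ne' (fun hh => (hLi' l hh).not_gt hli)
        rw [hdone l hli hlk, hvr l (hpi.trans hli).ne' hli.ne'] at e1
        have e2 := s4 l hli
        have e3 := vl_ne u (hpi.trans hli).ne'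
        clear hcon hA
        omega

/-! ### The walk within a row -/

/-- The rows above row `i`, in decreasing order. -/
def belowList {n : ℕ} (i : Fin n) : List (Fin n) :=
  ((List.finRange n).filter (fun p => p < i)).reverse

/-- The rows `k + 1, …, n`. -/
def freeList (n k : ℕ) : List (Fin n) := (List.finRange n).filter (fun m => k ≤ m.val)

/-- The reverse of `Γ_i`. -/
def stageR {n : ℕ} (i : Fin n) : List (PosRoot n) := (belowList i).map (fun p => addRoot p i)

/-- The reverse of `Γ_{ki}`. -/
def stageL {n : ℕ} (k : ℕ) (i : Fin n) : List (PosRoot n) :=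
  (freeList n k).map (subRoot i) ++
    ([PosRoot.long i] ++ ((freeList n k).reverse.map (addRoot i) ++ stageR i))

lemma pairwise_freeList (n k : ℕ) : (freeList n k).Pairwise (· < ·) :=
  (List.sortedLT_finRange n).pairwise.filter _

lemma pairwise_freeList_reverse (n k : ℕ) : (freeList n k).reverse.Pairwise (· > ·) :=
  List.pairwise_reverse.2 (pairwise_freeList n k)

lemma pairwise_belowList {n : ℕ} (i : Fin n) : (belowList i).Pairwise (· > ·) :=
  List.pairwise_reverse.2 ((List.sortedLT_finRange n).pairwise.filter _)

lemma mem_freeList {n k : ℕ} {m : Fin n} : m ∈ freeList n k ↔ k ≤ m.val := by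
  simp [freeList]

lemma mem_belowList {n : ℕ} {i p : Fin n} : p ∈ belowList i ↔ p < i := by
  simp [belowList]

/-- After a possible sign change, the current value and the target of row `i` have the same sign. -/
lemma sameUp_of_not_oc {n k : ℕ} {d : Fin n → ℕ} (hd : IsTarget n k d) {i : Fin n}
    (hi : i.val < k) (u : SignedPerm n) (hrow : ∀ p, p < i → RowCond k d u p)
    (hdone : ∀ l : Fin n, i < l → l.val < k → vl u l = d l)
    (hfree : ∀ m : Fin n, k ≤ m.val → ¬ Oc (vl u i) (vl u m) (d i))
    (hbar : ¬ Oc (vl u i) (2 * n - 1 - vl u i) (d i)) : SameUp n (vl u i) (d i) := by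
  have hui := vl_lt u i
  have hdi := hd.lt i hi
  by_contra hcon
  -- With `c` the value and `a` the target, any failure other than these two would put the bar of
  -- `c` on the arc from `c` to `a`. In each remaining case a set closed under bars, centred either
  -- at the middle or at the ends of the alphabet, contains `a` but not `c`.
  have hcases : (vl u i < n ∧ n ≤ d i ∧ d i < 2 * n - 1 - vl u i) ∨
      (n ≤ vl u i ∧ d i < n ∧ d i < 2 * n - 1 - vl u i) := by
    simp only [SameUp, Oc] at *
    omega
  rcases hcases with hc | hc
  · have key := mem_of_target_mem hd u (fun x => 2 * n - 1 - d i ≤ x ∧ x ≤ d i)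
      (by intro x hx h; omega)
      (by
        intro f hf
        have e1 := hfree f hf
        simp only [Oc] at e1
        omega)
      (by
        intro r hr h
        rcases lt_trichotomy r i with hri | rfl | hri
        · have e1 := hrow r hri i hri hi
          simp only [Av] at e1
          omega
        · omega
        · rw [← hdone r hri hr]; exact h)
      i hi (by omega)
    omega
  · have key := mem_of_target_mem hd u (fun x => x < 2 * n ∧ (2 * n - 1 - d i ≤ x ∨ x ≤ d i))
      (by intro x hx h; omega)
      (by
        intro f hf
        have e1 := hfree f hf
        simp only [Oc] at e1
        omega)
      (by
        intro r hr h
        have e2 := hd.lt r hr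
        rcases lt_trichotomy r i with hri | rfl | hri
        · have e1 := hrow r hri i hri hi
          simp only [Av] at e1
          omega
        · omega
        · rw [← hdone r hri hr]; exact h)
      i hi (by omega)
    omega

/-- The target `d i` is, up to a bar, the value of some row. Settled and free rows are excluded, so
if row `i` has not arrived, this row lies above it; its own condition forbids the value `d i`, so it
holds the bar. -/
lemma exists_stageR {n k : ℕ} {d : Fin n → ℕ} (hd : IsTarget n k d) {i : Fin n}
    (hi : i.val < k) (u : SignedPerm n)
    (hrow : ∀ p, p ≤ i → RowCond k d u p)
    (hdone : ∀ l : Fin n, i < l → l.val < k → vl u l = d l)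
    (hup : SameUp n (vl u i) (d i))
    (hfree : ∀ m : Fin n, k ≤ m.val → ¬ (vl u i < vl u m ∧ vl u m ≤ d i) ∧
        ¬ (vl u i < 2 * n - 1 - vl u m ∧ 2 * n - 1 - vl u m ≤ d i)) :
    ∃ u', Back (stageR i) u u' ∧ vl u' i = d i ∧
      (∀ r, i < r → vl u' r = vl u r) ∧
      ∀ p, p < i → (∀ z, Av z (vl u p) (d p) → Av z (vl u' p) (d p)) ∧
        (SameUp n (vl u p) (d p) → SameUp n (vl u' p) (d p)) := by
  refine exists_back_below hd hi (belowList i) (pairwise_belowList i)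
    (fun p hp => mem_belowList.1 hp) u (fun p hp => hrow p hp.le) hdone hup hfree ?_ ?_ ?_
  · intro l h1 h2
    have := hrow i le_rfl l h1 h2
    simp only [Av] at this
    omega
  · exact fun r hr hrL => absurd (mem_belowList.2 hr) hrL
  · by_cases hc : vl u i = d i
    · exact Or.inl hc
    · right
      have hdi := hd.lt i hi
      have hui := vl_lt u i
      obtain ⟨r, hr⟩ := exists_vl u hdi
      have hvr := vl_lt u r
      simp only [SameUp] at hup
      have hri : r < i := by
        by_contra hnot
        rcases (not_lt.1 hnot).eq_or_lt with rfl | hlt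
        · omega
        · by_cases hrk : r.val < k
          · have e1 := hd.ne i r hi hrk hlt.ne
            have e2 := hd.lt r hrk
            rw [hdone r hlt hrk] at hr
            omega
          · have e1 := hfree r (not_lt.1 hrk)
            omega
      refine ⟨r, mem_belowList.2 hri, ?_⟩
      have e1 := hrow r hri.le i hri hi
      simp only [Av] at e1
      omega

lemma rowCond_congr {n k : ℕ} {d : Fin n → ℕ} {u u' : SignedPerm n} {p : Fin n}
    (h : vl u' p = vl u p) (hp : RowCond k d u p) : RowCond k d u' p := by
  intro l hl hlk
  rw [h]
  exact hp l hl hlk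

/-- The four families of roots clear, in turn, the arc from the value of row `i` to its target: of
free values, of the bar of the value itself (which gives equal signs), of the bars of free values,
and finally of the bars of the rows above, when the target is reached. -/
lemma exists_stageL {n k : ℕ} {d : Fin n → ℕ} (hd : IsTarget n k d) {i : Fin n}
    (hi : i.val < k) (u : SignedPerm n)
    (hrow : ∀ p, p ≤ i → RowCond k d u p)
    (hdone : ∀ l : Fin n, i < l → l.val < k → vl u l = d l) :
    ∃ u', Back (stageL k i) u u' ∧ (∀ l : Fin n, i ≤ l → l.val < k → vl u' l = d l) ∧
      ∀ p, p < i → RowCond k d u' p := by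
  have hdi := hd.lt i hi
  obtain ⟨u1, b1, r1, f1, a1⟩ := exists_back_sub hi (d i) (freeList n k) (pairwise_freeList n k)
    (fun m hm => mem_freeList.1 hm) u (fun m hm hn => absurd (mem_freeList.2 hm) hn)
    (fun l h1 h2 => by rw [hdone l h1 h2]; exact hrow i le_rfl l h1 h2)
  have hi1 := vl_lt u1 i
  obtain ⟨u2, b2, r2, f2, a2, o2⟩ : ∃ u2, Back [PosRoot.long i] u1 u2 ∧
      (∀ r, r ≠ i → vl u2 r = vl u1 r) ∧
      (∀ m : Fin n, k ≤ m.val → ¬ Oc (vl u2 i) (vl u2 m) (d i)) ∧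
      (∀ z, Av z (vl u1 i) (d i) → Av z (vl u2 i) (d i)) ∧
      ¬ Oc (vl u2 i) (2 * n - 1 - vl u2 i) (d i) := by
    -- The sign change follows the same greedy rule: it is made exactly when the barred value lies
    -- on the arc.
    by_cases hO : Oc (vl u1 i) (2 * n - 1 - vl u1 i) (d i)
    · have hvi : vl (u1 * (PosRoot.long i).refl) i = 2 * n - 1 - vl u1 i := by
        rw [vl_long, if_pos rfl]
      have hvr : ∀ r, r ≠ i → vl (u1 * (PosRoot.long i).refl) r = vl u1 r := by
        intro r hr
        rw [vl_long, if_neg hr]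
      refine ⟨u1 * (PosRoot.long i).refl, Back.step ?_ (Back.nil _), hvr, ?_, ?_, ?_⟩
      · rw [backStep_long]
        intro l hl
        have e1 := vl_ne u1 hl.ne'
        by_cases hlk : l.val < k
        · have e2 := a1 _ (hrow i le_rfl l hl hlk)
          rw [r1 l hlk hl.ne', hdone l hl hlk] at e1 ⊢
          simp only [Oc, Av] at *
          omega
        · have e2 := f1 l (not_lt.1 hlk)
          simp only [Oc, Av] at *
          omega
      · intro m hm
        have hmi : m ≠ i := by rintro rfl; omega
        rw [hvi, hvr m hmi]
        have e2 := f1 m hm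
        simp only [Oc] at *
        omega
      · intro z hz
        rw [hvi]
        simp only [Oc, Av] at *
        omega
      · rw [hvi]
        simp only [Oc] at *
        omega
    · exact ⟨u1, Back.skip (Back.nil _), fun _ _ => rfl, f1, fun _ h => h, hO⟩
  have hdone2 : ∀ l : Fin n, i < l → l.val < k → vl u2 l = d l := fun l h1 h2 => by
    rw [r2 l h1.ne', r1 l h2 h1.ne', hdone l h1 h2]
  have hrow2 : ∀ p, p < i → RowCond k d u2 p := fun p hp =>
    rowCond_congr (by rw [r2 p hp.ne, r1 p (lt_trans hp hi) hp.ne]) (hrow p hp.le)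
  have hup := sameUp_of_not_oc hd hi u2 hrow2 hdone2 f2 o2
  obtain ⟨u3, b3, r3, s3, l3, f3⟩ := exists_back_add hi (d i) (freeList n k).reverse
    (pairwise_freeList_reverse n k) (fun m hm => mem_freeList.1 (List.mem_reverse.1 hm)) u2 hup
    (by
      intro m hm
      have := f2 m hm
      simp only [Oc] at this
      omega)
    (fun m hm hn => absurd (List.mem_reverse.2 (mem_freeList.2 hm)) hn)
    (by
      intro l h1 h2
      have := a2 _ (a1 _ (hrow i le_rfl l h1 h2))
      rw [hdone2 l h1 h2]
      simp only [Av, SameUp] at this hup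
      omega)
  have hdone3 : ∀ l : Fin n, i < l → l.val < k → vl u3 l = d l := fun l h1 h2 => by
    rw [r3 l h2 h1.ne', hdone2 l h1 h2]
  obtain ⟨u4, b4, i4, r4, p4⟩ := exists_stageR hd hi u3
    (by
      intro p hp
      rcases hp.lt_or_eq with hp | rfl
      · exact rowCond_congr (r3 p (lt_trans hp hi) hp.ne) (hrow2 p hp)
      · intro l h1 h2
        have := a2 _ (a1 _ (hrow p le_rfl l h1 h2))
        simp only [Av, SameUp] at *
        omega)
    hdone3 s3 f3
  refine ⟨u4, back_append.2 ⟨u1, b1, back_append.2 ⟨u2, b2, back_append.2 ⟨u3, b3, b4⟩⟩⟩, ?_, ?_⟩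
  · intro l h1 h2
    rcases h1.eq_or_lt with rfl | h1
    · exact i4
    · rw [r4 l h1, hdone3 l h1 h2]
  · intro p hp l h1 h2
    have e := rowCond_congr (r3 p (lt_trans hp hi) hp.ne) (hrow2 p hp)
    exact (p4 p hp).1 _ (e l h1 h2)

lemma stageR_preserves {n : ℕ} {i : Fin n} {L : List (PosRoot n)} (hL : L <:+ stageR i)
    {u u' : SignedPerm n} (h : Back L u u') (r : Fin n) (hr : i < r) : vl u' r = vl u r := by
  obtain ⟨L', hL', rfl⟩ : ∃ L', L' <:+ belowList i ∧ L = L'.map (fun p => addRoot p i) := by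
    obtain ⟨t, ht⟩ := hL
    obtain ⟨t', L', h1, -, h3⟩ := List.map_eq_append_iff.1 ht.symm
    exact ⟨L', ⟨t', h1.symm⟩, h3.symm⟩
  refine (back_below_av L' ((pairwise_belowList i).sublist hL'.sublist)
    (fun p hp => mem_belowList.1 (hL'.subset hp)) h).1 r hr.ne' ?_
  exact fun hm => (mem_belowList.1 (hL'.subset hm)).not_gt hr

lemma suffix_append_cases {α : Type*} {β : α} {L A B : List α} (h : (β :: L) <:+ A ++ B) :
    (β :: L) <:+ B ∨ ∃ A', (β :: A') <:+ A ∧ L = A' ++ B := by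
  obtain ⟨t, ht⟩ := h
  rcases List.append_eq_append_iff.1 ht with ⟨a, h1, h2⟩ | ⟨c, h1, h2⟩
  · cases a with
    | nil => exact Or.inl (by rw [h2]; exact List.suffix_refl _)
    | cons b a =>
      rw [List.cons_append, List.cons.injEq] at h2
      obtain ⟨rfl, h2⟩ := h2
      exact Or.inr ⟨a, ⟨t, h1.symm⟩, h2⟩
  · exact Or.inl ⟨c, h2.symm⟩

lemma suffix_map_cases {α γ : Type*} {f : α → γ} {β : γ} {L : List γ} {A : List α}
    (h : (β :: L) <:+ A.map f) : ∃ m A', (m :: A') <:+ A ∧ β = f m ∧ L = A'.map f := by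
  obtain ⟨t, ht⟩ := h
  obtain ⟨t', L', h1, -, h3⟩ := List.map_eq_append_iff.1 ht.symm
  cases L' with
  | nil => simp at h3
  | cons m A' =>
    rw [List.map_cons, List.cons.injEq] at h3
    exact ⟨m, A', ⟨t', h1.symm⟩, h3.1.symm, h3.2.symm⟩

/-- If the root `(p, ī)` is folded, row `p` receives the bar of `v(i)`, and the later motion of row
`i`, from the bar of `v(p)`, avoids `v(i)`. If it is refused, the motion from `v(i)` avoids the bar
of `v(p)`. `Av.contra` excludes a common end. -/
lemma stageR_separates {n : ℕ} (i : Fin n) :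
    Separates (stageR i) (fun u u' => vl u i = vl u' i) := by
  intro β A' hs v u u' hv hu hu' he
  obtain ⟨p, L, hL, rfl, rfl⟩ := suffix_map_cases hs
  have hsub := hL.sublist
  have hpw := (pairwise_belowList i).sublist hsub
  rw [List.pairwise_cons] at hpw
  have hpi : p < i := mem_belowList.1 (hL.subset (by simp))
  have hLi : ∀ q ∈ L, q < i := fun q hq => mem_belowList.1 (hL.subset (by simp [hq]))
  have e1 := (back_below_av L hpw.2 hLi hu).2.2.2.1 p hpi hpw.1
  have e2 := (back_below_av L hpw.2 hLi hu').2.2.2.1 p hpi hpw.1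
  rw [vl_addRoot v hpi p, if_pos rfl, vl_addRoot v hpi i, if_neg hpi.ne', if_pos rfl, he] at e1
  have := vl_lt v i
  rw [show 2 * n - 1 - (2 * n - 1 - vl v i) = vl v i by omega] at e1
  exact e1.contra e2

/-- After the long root, row `i` no longer changes sign; this separates the two choices at the long
root, and the avoided bars separate those at `ε_i + ε_m`. -/
lemma back_tail_sameUp {n k : ℕ} {i : Fin n} (hi : i.val < k) {L : List (Fin n)}
    (hL : L <:+ (freeList n k).reverse) {u u' : SignedPerm n}
    (h : Back (L.map (addRoot i) ++ stageR i) u u') :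
    SameUp n (vl u i) (vl u' i) ∧ (∀ l, i < l → Av (vl u l) (vl u i) (vl u' i)) ∧
    ∀ l, i < l → (∀ m ∈ L, m < l) → Av (2 * n - 1 - vl u l) (vl u i) (vl u' i) := by
  obtain ⟨w, h1, h2⟩ := back_append.1 h
  obtain ⟨-, a2, a3, a4⟩ := back_add_av hi L ((pairwise_freeList_reverse n k).sublist hL.sublist)
    (fun m hm => mem_freeList.1 (List.mem_reverse.1 (hL.subset hm))) h1
  obtain ⟨-, b2, b3, -, -⟩ := back_below_av _ (pairwise_belowList i)
    (fun p hp => mem_belowList.1 hp) h2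
  refine ⟨a2.trans b2, fun l hl => ?_, fun l hl hlm => ?_⟩
  · obtain ⟨c1, c2⟩ := a3 l hl
    refine c1.trans ?_
    rcases c2 with c2 | c2
    · rw [← c2]; exact (b3 l hl).1
    · simp only [SameUp, Av] at *
      omega
  · obtain ⟨c1, c2⟩ := a4 l hl hlm
    refine c2.trans ?_
    rw [← c1]
    exact (b3 l hl).2

lemma back_long_tail_av {n k : ℕ} {i : Fin n} (hi : i.val < k) {u u' : SignedPerm n}
    (h : Back ([PosRoot.long i] ++ ((freeList n k).reverse.map (addRoot i) ++ stageR i)) u u')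
    (l : Fin n) (hl : i < l) : Av (vl u l) (vl u i) (vl u' i) := by
  obtain ⟨w, h1, h2⟩ := back_append.1 h
  obtain ⟨a1, a2⟩ := back_long_av h1
  refine (a2 l hl).trans ?_
  rw [← a1 l hl.ne']
  exact (back_tail_sameUp hi (List.suffix_refl _) h2).2.1 l hl

/-- At every root except the long one, folding and refusing produce arcs with the same end, each
missing the start of the other. -/
lemma stageL_separates {n k : ℕ} {i : Fin n} (hi : i.val < k) :
    Separates (stageL k i) (fun u u' => vl u i = vl u' i) := by
  intro β A' hs v u u' hv hu hu' he
  rcases suffix_append_cases hs with hs | ⟨A1, hsA, rfl⟩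
  · rcases suffix_append_cases hs with hs | ⟨A1, hsA, rfl⟩
    · rcases suffix_append_cases hs with hs | ⟨A1, hsA, rfl⟩
      · exact stageR_separates i β A' hs v u u' hv hu hu' he
      · obtain ⟨m, L, hL, rfl, rfl⟩ := suffix_map_cases hsA
        have hpw := (pairwise_freeList_reverse n k).sublist hL.sublist
        rw [List.pairwise_cons] at hpw
        have hmk : k ≤ m.val := mem_freeList.1 (List.mem_reverse.1 (hL.subset (by simp)))
        have him : i < m := by rw [Fin.lt_def]; omega
        have hL' : L <:+ (freeList n k).reverse := (List.suffix_cons m L).trans hL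
        have e1 := (back_tail_sameUp hi hL' hu).2.2 m him hpw.1
        have e2 := (back_tail_sameUp hi hL' hu').2.2 m him hpw.1
        rw [vl_addRoot v him i, if_pos rfl, vl_addRoot v him m, if_neg him.ne', if_pos rfl,
          he] at e1
        have := vl_lt v i
        rw [show 2 * n - 1 - (2 * n - 1 - vl v i) = vl v i by omega] at e1
        exact e1.contra e2
    · obtain ⟨t, ht⟩ := hsA
      have hlen := congrArg List.length ht
      rw [List.length_append, List.length_cons, List.length_singleton] at hlen
      have ht0 : t = [] := List.eq_nil_of_length_eq_zero (by omega)
      have hA0 : A1 = [] := List.eq_nil_of_length_eq_zero (by omega)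
      subst ht0
      subst hA0
      rw [List.nil_append, List.cons.injEq] at ht
      obtain ⟨rfl, -⟩ := ht
      -- At the long root the two choices have opposite signs, and the rest of the stage preserves
      -- signs.
      have e1 := (back_tail_sameUp hi (List.suffix_refl _) hu).1
      have e2 := (back_tail_sameUp hi (List.suffix_refl _) hu').1
      rw [vl_long, if_pos rfl, he] at e1
      have := vl_lt v i
      simp only [SameUp] at *
      omega
  · obtain ⟨m, L, hL, rfl, rfl⟩ := suffix_map_cases hsA
    have hpw := (pairwise_freeList n k).sublist hL.sublist
    rw [List.pairwise_cons] at hpw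
    have hmk : k ≤ m.val := mem_freeList.1 (hL.subset (by simp))
    have him : i < m := by rw [Fin.lt_def]; omega
    have hav : ∀ {w w' : SignedPerm n}, Back (L.map (subRoot i) ++
        ([PosRoot.long i] ++ ((freeList n k).reverse.map (addRoot i) ++ stageR i))) w w' →
        Av (vl w m) (vl w i) (vl w' i) := by
      intro w w' h
      obtain ⟨w1, h1, h2⟩ := back_append.1 h
      obtain ⟨a1, a2⟩ := (back_sub_av hi L hpw.2
        (fun q hq => mem_freeList.1 (hL.subset (by simp [hq]))) h1).2 m him hpw.1
      refine a2.trans ?_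
      rw [← a1]
      exact back_long_tail_av hi h2 m him
    have e1 := hav hu
    have e2 := hav hu'
    rw [vl_subRoot v him m, if_neg him.ne', if_pos rfl, vl_subRoot v him i, if_pos rfl, he] at e1
    exact e1.contra e2

/-- Suffixes of `stageL k i` do not change the rows `i + 1, …, k`. -/
lemma stageL_preserves {n k : ℕ} {i : Fin n} (hi : i.val < k) {L : List (PosRoot n)}
    (hL : L <:+ stageL k i) {u u' : SignedPerm n} (h : Back L u u') (r : Fin n) (hr : i < r)
    (hrk : r.val < k) : vl u' r = vl u r := by
  induction L generalizing u with
  | nil => cases h; rfl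
  | cons β L ih =>
    have ih := @ih ((List.suffix_cons β L).trans hL)
    cases h with
    | skip h => exact ih h
    | step hs h =>
      rw [ih h]
      have hmem : β ∈ stageL k i := hL.subset (by simp)
      simp only [stageL, stageR, List.mem_append, List.mem_map, List.mem_singleton, mem_freeList,
        List.mem_reverse, mem_belowList] at hmem
      rcases hmem with ⟨m, hm, rfl⟩ | rfl | ⟨m, hm, rfl⟩ | ⟨m, hm, rfl⟩
      · have him : i < m := by rw [Fin.lt_def]; omega
        rw [vl_subRoot u him, if_neg hr.ne', if_neg (by rintro rfl; omega)]
      · rw [vl_long, if_neg hr.ne']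
      · have him : i < m := by rw [Fin.lt_def]; omega
        rw [vl_addRoot u him, if_neg hr.ne', if_neg (by rintro rfl; omega)]
      · rw [vl_addRoot u hm, if_neg (hm.trans hr).ne', if_neg hr.ne']

lemma rowCond_of_stageR {n k : ℕ} {d : Fin n → ℕ} (hd : IsTarget n k d) {i : Fin n}
    (hi : i.val < k) {u u' : SignedPerm n} (h : Back (stageR i) u u')
    (hdone : ∀ l : Fin n, i ≤ l → l.val < k → vl u' l = d l)
    (hrow : ∀ p, p < i → RowCond k d u' p) : ∀ p, p ≤ i → RowCond k d u p := by
  intro p hp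
  rcases hp.lt_or_eq with hp | rfl
  · exact rowCond_of_back_below hd hi _ (pairwise_belowList i) (fun p hp => mem_belowList.1 hp) h
      (hdone i le_rfl hi) (fun l hl => hdone l hl.le) hrow p hp
  · intro l hl hlk
    have e := (back_below_av _ (pairwise_belowList p) (fun p hp => mem_belowList.1 hp) h).2.2.1 l hl
    rw [← stageR_preserves (List.suffix_refl _) h l hl, hdone l hl.le hlk, hdone p le_rfl hi] at e
    exact e.1

lemma rowCond_of_stageL {n k : ℕ} {d : Fin n → ℕ} (hd : IsTarget n k d) {i : Fin n}
    (hi : i.val < k) {u u' : SignedPerm n} (h : Back (stageL k i) u u')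
    (hdone : ∀ l : Fin n, i ≤ l → l.val < k → vl u' l = d l)
    (hrow : ∀ p, p < i → RowCond k d u' p) : ∀ p, p ≤ i → RowCond k d u p := by
  obtain ⟨u1, b1, h1⟩ := back_append.1 h
  have hh1 := h1
  obtain ⟨u2, b2, h2⟩ := back_append.1 h1
  obtain ⟨u3, b3, b4⟩ := back_append.1 h2
  have s1 := back_sub_av hi _ (pairwise_freeList n k) (fun m hm => mem_freeList.1 hm) b1
  have s2 := back_long_av b2
  have s3 := back_add_av hi _ (pairwise_freeList_reverse n k)
    (fun m hm => mem_freeList.1 (List.mem_reverse.1 hm)) b3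
  intro p hp
  rcases hp.lt_or_eq with hp | rfl
  · have hpk : p.val < k := lt_trans hp hi
    refine rowCond_congr ?_ (rowCond_of_stageR hd hi b4 hdone hrow p hp.le)
    rw [s3.1 p hpk hp.ne, s2.1 p hp.ne, s1.1 p hpk hp.ne]
  · intro l hl hlk
    obtain ⟨c1, c2⟩ := s1.2 l hl (fun m hm => by
      have := mem_freeList.1 hm
      rw [Fin.lt_def]; omega)
    have c3 := back_long_tail_av hi hh1 l hl
    rw [c1] at c3
    have c4 := c2.trans c3
    rwa [← stageL_preserves hi (List.suffix_refl _) h l hl hlk, hdone l hl.le hlk,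
      hdone p le_rfl hi] at c4

/-! ### The walk along all rows -/

/-- The concatenation of the lists `st i` for the rows `i = j, …, 1`. -/
def rowsRev {n : ℕ} (st : Fin n → List (PosRoot n)) (j : ℕ) : List (PosRoot n) :=
  (firstRows n j).reverse.flatMap st

lemma rowsRev_zero {n : ℕ} (st : Fin n → List (PosRoot n)) : rowsRev st 0 = [] := by
  simp [rowsRev, firstRows]

lemma firstRows_succ {n j : ℕ} (hj : j < n) : firstRows n (j + 1) = firstRows n j ++ [⟨j, hj⟩] := by
  have h := filter_lt_succ (List.finRange n) (List.sortedLT_finRange n).pairwise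
    (fun _ => True) j
  simp only [true_and] at h
  rw [firstRows, h, firstRows]
  congr 1
  have h2 : (List.finRange n).filter (fun q => q.val = j) =
      (List.finRange n).filter (fun q => q = ⟨j, hj⟩) := by
    congr 1
    funext q
    simp [Fin.ext_iff]
  rw [h2, List.filter_eq, List.count_eq_one_of_mem (List.nodup_finRange _) (List.mem_finRange _)]
  rfl

lemma rowsRev_succ {n : ℕ} (st : Fin n → List (PosRoot n)) {j : ℕ} (hj : j < n) :
    rowsRev st (j + 1) = st ⟨j, hj⟩ ++ rowsRev st j := by
  rw [rowsRev, firstRows_succ hj, List.reverse_append, List.reverse_singleton,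
    List.singleton_append, List.flatMap_cons, rowsRev]

lemma filterMap_eq_map_filter {α γ : Type*} (l : List α) (f : α → Option γ) (P : α → Prop)
    [DecidablePred P] (g : α → γ) (h : ∀ a, f a = if P a then some (g a) else none) :
    l.filterMap f = (l.filter P).map g := by
  induction l with
  | nil => rfl
  | cons a l ih =>
    by_cases ha : P a <;> simp [h a, ha, ih]

lemma rootsBelow_reverse {n : ℕ} (i : Fin n) : (rootsBelow i).reverse = stageR i := by
  rw [rootsBelow, filterMap_eq_map_filter _ _ (fun p => p < i) (fun p => addRoot p i),
    ← List.map_reverse]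
  · rfl
  · intro p
    by_cases h : p < i <;> simp [h, addRoot]

lemma rootsAdd_eq {n k : ℕ} {i : Fin n} (hi : i.val < k) :
    rootsAdd k i = (freeList n k).map (addRoot i) := by
  refine filterMap_eq_map_filter _ _ (fun m : Fin n => k ≤ m.val) _ ?_
  intro m
  by_cases h : k ≤ m.val
  · have him : i < m := by rw [Fin.lt_def]; omega
    simp [h, him, addRoot]
  · simp [h]

lemma rootsSub_eq {n k : ℕ} {i : Fin n} (hi : i.val < k) :
    rootsSub k i = (freeList n k).reverse.map (subRoot i) := by
  rw [freeList, ← List.filter_reverse]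
  refine filterMap_eq_map_filter _ _ (fun m : Fin n => k ≤ m.val) _ ?_
  intro m
  by_cases h : k ≤ m.val
  · have him : i < m := by rw [Fin.lt_def]; omega
    simp [h, him, subRoot]
  · simp [h]

lemma gammaR_reverse {n k : ℕ} : (gammaR n k).reverse = rowsRev stageR k := by
  rw [gammaR, List.reverse_flatMap, rowsRev]
  congr 1
  funext i
  exact rootsBelow_reverse i

lemma gammaL_reverse {n k : ℕ} : (gammaL n k).reverse = rowsRev (stageL k) k := by
  rw [gammaL, List.reverse_flatMap, rowsRev, List.flatMap_def, List.flatMap_def]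
  congr 1
  refine List.map_congr_left fun i hi => ?_
  have hik : i.val < k := by simpa [firstRows] using hi
  simp only [Function.comp, List.reverse_append, List.reverse_singleton, rootsBelow_reverse,
    rootsAdd_eq hik, rootsSub_eq hik, stageL, ← List.map_reverse, List.reverse_reverse]

lemma exists_rowsL {n k : ℕ} {d : Fin n → ℕ} (hd : IsTarget n k d) (hkn : k ≤ n) (j : ℕ)
    (hj : j ≤ k) (u : SignedPerm n)
    (hdone : ∀ l : Fin n, j ≤ l.val → l.val < k → vl u l = d l)
    (hrow : ∀ p : Fin n, p.val < j → RowCond k d u p) :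
    ∃ u', Back (rowsRev (stageL k) j) u u' ∧ ∀ l : Fin n, l.val < k → vl u' l = d l := by
  induction j generalizing u with
  | zero => exact ⟨u, by rw [rowsRev_zero]; exact Back.nil u, fun l hl => hdone l (Nat.zero_le _) hl⟩
  | succ j ih =>
    have hjn : j < n := by omega
    obtain ⟨u1, b1, d1, r1⟩ := exists_stageL hd (i := ⟨j, hjn⟩) hj u
      (fun p hp => hrow p (Nat.lt_succ_of_le hp)) (fun l hl hlk => hdone l hl hlk)
    obtain ⟨u2, b2, d2⟩ := ih (by omega) u1 (fun l hl hlk => d1 l hl hlk) (fun p hp => r1 p hp)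
    exact ⟨u2, by rw [rowsRev_succ _ hjn]; exact back_append.2 ⟨u1, b1, b2⟩, d2⟩

/-- Row `r` moves up from `u` to `d`, without passing any of the values of the free rows. -/
def FreeUp {n : ℕ} (k : ℕ) (d : Fin n → ℕ) (u : SignedPerm n) (r : Fin n) : Prop :=
  SameUp n (vl u r) (d r) ∧ ∀ f : Fin n, k ≤ f.val →
    Av (vl u f) (vl u r) (d r) ∧ Av (2 * n - 1 - vl u f) (vl u r) (d r)

/-- `Γ_r(k)` has no roots to clear an arc of free values and their bars or to change a sign, so
`FreeUp` is assumed. It persists for the rows above, because they only move along their own arcs and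
free rows do not move. -/
lemma exists_rowsR {n k : ℕ} {d : Fin n → ℕ} (hd : IsTarget n k d) (hkn : k ≤ n) (j : ℕ)
    (hj : j ≤ k) (u : SignedPerm n)
    (hdone : ∀ l : Fin n, j ≤ l.val → l.val < k → vl u l = d l)
    (hrow : ∀ p : Fin n, p.val < j → RowCond k d u p)
    (hfree : ∀ p : Fin n, p.val < j → FreeUp k d u p) :
    ∃ u', Back (rowsRev stageR j) u u' ∧ ∀ l : Fin n, l.val < k → vl u' l = d l := by
  induction j generalizing u with
  | zero => exact ⟨u, by rw [rowsRev_zero]; exact Back.nil u, fun l hl => hdone l (Nat.zero_le _) hl⟩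
  | succ j ih =>
    have hjn : j < n := by omega
    obtain ⟨f1, f2⟩ := hfree ⟨j, hjn⟩ (Nat.lt_succ_self j)
    obtain ⟨u1, b1, i1, d1, r1⟩ := exists_stageR hd (i := ⟨j, hjn⟩) hj u
      (fun p hp => hrow p (Nat.lt_succ_of_le hp)) (fun l hl hlk => hdone l hl hlk) f1
      (by
        intro m hm
        have := f2 m hm
        simp only [Av] at this
        omega)
    obtain ⟨u2, b2, d2⟩ := ih (by omega) u1
      (fun l hl hlk => by
        rcases hl.eq_or_lt with h | h
        · have : l = ⟨j, hjn⟩ := Fin.ext h.symm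
          rw [this]; exact i1
        · rw [d1 l h, hdone l h hlk])
      (fun p hp l hl hlk => (r1 p hp).1 _ (hrow p (Nat.lt_succ_of_lt hp) l hl hlk))
      (fun p hp => by
        obtain ⟨g1, g2⟩ := hfree p (Nat.lt_succ_of_lt hp)
        refine ⟨(r1 p hp).2 g1, fun f hf => ?_⟩
        rw [d1 f (Fin.lt_def.2 (by simp only; omega))]
        exact ⟨(r1 p hp).1 _ (g2 f hf).1, (r1 p hp).1 _ (g2 f hf).2⟩)
    exact ⟨u2, by rw [rowsRev_succ _ hjn]; exact back_append.2 ⟨u1, b1, b2⟩, d2⟩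

/-- Walking back from the final window, each stage passes the row conditions to its start, while
rows not yet treated by the stages that follow already hold their final values. -/
lemma rowCond_of_rows {n k : ℕ} {d : Fin n → ℕ} (hkn : k ≤ n) (st : Fin n → List (PosRoot n))
    (hst : ∀ (i : Fin n) (u u' : SignedPerm n), i.val < k → Back (st i) u u' →
      (∀ l : Fin n, i ≤ l → l.val < k → vl u' l = d l) → (∀ p, p < i → RowCond k d u' p) →
      ∀ p, p ≤ i → RowCond k d u p)
    (hpres : ∀ (i : Fin n) (u u' : SignedPerm n), i.val < k → Back (st i) u u' →
      ∀ r, i < r → r.val < k → vl u' r = vl u r)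
    (j : ℕ) (hj : j ≤ k) {u u' : SignedPerm n} (h : Back (rowsRev st j) u u')
    (hd : ∀ l : Fin n, l.val < k → vl u' l = d l) :
    (∀ l : Fin n, j ≤ l.val → l.val < k → vl u l = d l) ∧
      ∀ p : Fin n, p.val < j → RowCond k d u p := by
  induction j generalizing u with
  | zero =>
    rw [rowsRev_zero] at h
    cases h
    exact ⟨fun l _ hl => hd l hl, fun p hp => absurd hp (Nat.not_lt_zero _)⟩
  | succ j ih =>
    have hjn : j < n := by omega
    rw [rowsRev_succ _ hjn] at h
    obtain ⟨w, h1, h2⟩ := back_append.1 h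
    obtain ⟨i1, i2⟩ := ih (by omega) h2
    refine ⟨fun l hl hlk => ?_, fun p hp => ?_⟩
    · rw [← i1 l (by omega) hlk, hpres ⟨j, hjn⟩ u w hj h1 l hl hlk]
    · exact hst ⟨j, hjn⟩ u w hj h1 (fun l hl hlk => i1 l hl hlk) (fun p hp => i2 p hp) p
        (Nat.le_of_lt_succ hp)

/-- Once its stage is over, a row keeps its value, so the final window determines that value and the
separation property of the single stage applies. -/
lemma rows_separates {n k : ℕ} (hkn : k ≤ n) (st : Fin n → List (PosRoot n))
    (hsep : ∀ i : Fin n, i.val < k → Separates (st i) (fun u u' => vl u i = vl u' i))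
    (hpres : ∀ (i : Fin n) (L : List (PosRoot n)) (u u' : SignedPerm n), i.val < k → L <:+ st i →
      Back L u u' → ∀ r, i < r → r.val < k → vl u' r = vl u r) (j : ℕ) (hj : j ≤ k) :
    (∀ u u' : SignedPerm n, Back (rowsRev st j) u u' →
      ∀ r : Fin n, j ≤ r.val → r.val < k → vl u' r = vl u r) ∧
    Separates (rowsRev st j) (fun u u' => ∀ r : Fin n, r.val < k → vl u r = vl u' r) := by
  induction j with
  | zero =>
    rw [rowsRev_zero]
    refine ⟨fun u u' h r _ _ => by cases h; rfl, fun β L' hs => ?_⟩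
    exact absurd (List.suffix_nil.1 hs) (by simp)
  | succ j ih =>
    have hjn : j < n := by omega
    obtain ⟨i1, i2⟩ := ih (by omega)
    rw [rowsRev_succ _ hjn]
    constructor
    · intro u u' h r hr hrk
      obtain ⟨w, h1, h2⟩ := back_append.1 h
      rw [i1 w u' h2 r (by omega) hrk]
      exact hpres ⟨j, hjn⟩ _ u w hj (List.suffix_refl _) h1 r hr hrk
    · intro β L' hs v u u' hv hu hu' he
      rcases suffix_append_cases hs with hs' | ⟨A, hA, rfl⟩
      · exact i2 β L' hs' v u u' hv hu hu' he
      · obtain ⟨w, h1, h2⟩ := back_append.1 hu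
        obtain ⟨w', h1', h2'⟩ := back_append.1 hu'
        refine hsep ⟨j, hjn⟩ hj β A hA v w w' hv h1 h1' ?_
        change vl w _ = vl w' _
        rw [← i1 w u h2 ⟨j, hjn⟩ le_rfl hj, ← i1 w' u' h2' ⟨j, hjn⟩ le_rfl hj]
        exact he _ hj

/-- Free rows are never touched, so the intervals avoided in the successive stages refer to the same
free values and can be joined. -/
lemma freeUp_of_rowsR {n k : ℕ} (hkn : k ≤ n) (j : ℕ) (hj : j ≤ k) {u u' : SignedPerm n}
    (h : Back (rowsRev stageR j) u u') :
    (∀ f : Fin n, k ≤ f.val → vl u' f = vl u f) ∧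
      ∀ r : Fin n, r.val < k → FreeUp k (vl u') u r := by
  induction j generalizing u with
  | zero =>
    rw [rowsRev_zero] at h
    cases h
    refine ⟨fun _ _ => rfl, fun r hr => ⟨SameUp.refl _ _, fun f hf => ?_⟩⟩
    have hfr : f ≠ r := by rintro rfl; omega
    have e1 := vl_ne u' hfr
    have e2 := vl_lt u' f
    exact ⟨Av.refl e1.1, Av.refl (by omega)⟩
  | succ j ih =>
    have hjn : j < n := by omega
    rw [rowsRev_succ _ hjn] at h
    obtain ⟨w, h1, h2⟩ := back_append.1 h
    obtain ⟨i1, i2⟩ := ih (by omega) h2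
    obtain ⟨a1, a2, a3, -, a5⟩ := back_below_av _ (pairwise_belowList ⟨j, hjn⟩)
      (fun p hp => mem_belowList.1 hp) h1
    have hfix : ∀ r : Fin n, j < r.val → vl w r = vl u r := fun r hr =>
      stageR_preserves (List.suffix_refl _) h1 r hr
    refine ⟨fun f hf => by rw [i1 f hf, hfix f (by omega)], fun r hr => ?_⟩
    have hstage : FreeUp k (vl w) u r := by
      rcases lt_trichotomy r.val j with hrj | hrj | hrj
      · exact ⟨(a5 r hrj).1, fun f hf => (a5 r hrj).2 f (Fin.lt_def.2 (by simp only; omega))⟩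
      · have : r = ⟨j, hjn⟩ := Fin.ext hrj
        subst this
        exact ⟨a2, fun f hf => a3 f (Fin.lt_def.2 (by simp only; omega))⟩
      · have e := hfix r hrj
        refine ⟨by rw [e]; exact SameUp.refl _ _, fun f hf => ?_⟩
        rw [e]
        have hfr : f ≠ r := by rintro rfl; omega
        have e1 := vl_ne u hfr
        have e2 := vl_lt u f
        exact ⟨Av.refl e1.1, Av.refl (by omega)⟩
    refine ⟨hstage.1.trans (i2 r hr).1, fun f hf => ?_⟩
    have e1 := (i2 r hr).2 f hf
    rw [hfix f (by omega)] at e1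
    exact ⟨(hstage.2 f hf).1.trans e1.1, (hstage.2 f hf).2.trans e1.2⟩

/-! ### From columns to targets: walks along `Γ_l(k)` and `Γ_r(k)` -/

/-- The target given by a column. -/
def target {n k : ℕ} (C : Fin k → Letter n) (r : Fin n) : ℕ :=
  if h : r.val < k then (C ⟨r.val, h⟩).val else 0

lemma target_of_lt {n k : ℕ} (C : Fin k → Letter n) {r : Fin n} (h : r.val < k) :
    target C r = (C ⟨r.val, h⟩).val := dif_pos h

lemma absLetter_eq_iff {n : ℕ} (x y : Letter n) : absLetter x = absLetter y ↔
    x.val = y.val ∨ x.val + y.val = 2 * n - 1 := by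
  have hx := x.isLt
  have hy := y.isLt
  rw [Fin.ext_iff, absLetter, absLetter, Fin.coe_min, Fin.coe_min, val_bar, val_bar]
  omega

lemma isTarget_target {n k : ℕ} {C : Fin k → Letter n} (hC : DistinctAbs C) :
    IsTarget n k (target C) := by
  refine ⟨fun r hr => ?_, fun r s hr hs hrs => ?_⟩
  · rw [target_of_lt C hr]
    exact (C _).isLt
  · rw [target_of_lt C hr, target_of_lt C hs]
    have h : ¬ absLetter (C ⟨r.val, hr⟩) = absLetter (C ⟨s.val, hs⟩) := fun e =>
      hrs (Fin.ext (by simpa using hC e))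
    rw [absLetter_eq_iff] at h
    omega

lemma val_window {n k : ℕ} (u : SignedPerm n) (hk : k ≤ n) (r : Fin k) :
    (window u hk r).val = vl u (Fin.castLE hk r) := rfl

lemma distinctAbs_window {n k : ℕ} (u : SignedPerm n) (hk : k ≤ n) :
    DistinctAbs (window u hk) := by
  intro r s h
  by_contra hne
  have := vl_ne u (p := Fin.castLE hk r) (q := Fin.castLE hk s)
    (fun e => hne (Fin.castLE_injective hk e))
  have h' := (absLetter_eq_iff _ _).1 h
  rw [val_window, val_window] at h'
  omega

lemma window_eq_iff {n k : ℕ} (u : SignedPerm n) (hk : k ≤ n) (C : Fin k → Letter n) :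
    window u hk = C ↔ ∀ r : Fin n, r.val < k → vl u r = target C r := by
  constructor
  · rintro rfl r hr
    rw [target_of_lt _ hr]
    rfl
  · intro h
    funext r
    apply Fin.ext
    have := h (Fin.castLE hk r) r.isLt
    rw [target_of_lt C (r := Fin.castLE hk r) r.isLt] at this
    exact this

lemma adjacentCond_iff {n k : ℕ} (hk : k ≤ n) (C : Fin k → Letter n) (hC : DistinctAbs C)
    (v : SignedPerm n) : AdjacentCond le_rfl C (window v hk) ↔
      ∀ p : Fin n, p.val < k → RowCond k (target C) v p := by
  have key : ∀ i l : Fin k, i < l → ((window v hk (Fin.castLE le_rfl i) ≠ C l ∧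
      ¬ CircLT (window v hk (Fin.castLE le_rfl i)) (C l) (C i)) ↔
      Av (target C (Fin.castLE hk l)) (vl v (Fin.castLE hk i)) (target C (Fin.castLE hk i))) := by
    intro i l hil
    rw [target_of_lt C (r := Fin.castLE hk l) l.isLt, target_of_lt C (r := Fin.castLE hk i) i.isLt]
    have h : ¬ absLetter (C i) = absLetter (C l) := fun e => hil.ne (hC e)
    rw [absLetter_eq_iff] at h
    simp only [CircLT, Fin.lt_def, Av, ne_eq, Fin.ext_iff, val_window]
    simp only [Fin.val_castLE, Fin.eta]
    have : Fin.castLE hk (Fin.castLE le_rfl i) = Fin.castLE hk i := rfl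
    rw [this]
    omega
  constructor
  · intro h p hp l hl hlk
    exact (key ⟨p.val, hp⟩ ⟨l.val, hlk⟩ hl).1 (h ⟨p.val, hp⟩ ⟨l.val, hlk⟩ hl)
  · intro h i l hil
    exact (key i l hil).2 (h (Fin.castLE hk i) i.isLt (Fin.castLE hk l) hil l.isLt)

/-- Existence for `Γ_l(k)`. -/
lemma exists_back_gammaL {n k : ℕ} (hk : k ≤ n) {C : Fin k → Letter n} (hC : DistinctAbs C)
    {v : SignedPerm n} (h : AdjacentCond le_rfl C (window v hk)) :
    ∃ u, Back (gammaL n k).reverse v u ∧ window u hk = C := by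
  rw [adjacentCond_iff hk C hC] at h
  obtain ⟨u, h1, h2⟩ := exists_rowsL (isTarget_target hC) hk k le_rfl v
    (fun l h1 h2 => absurd h2 (not_lt.2 h1)) h
  exact ⟨u, by rw [gammaL_reverse]; exact h1, (window_eq_iff u hk C).2 h2⟩

lemma adjacentCond_of_gammaL {n k : ℕ} (hk : k ≤ n) {u v : SignedPerm n}
    (h : Back (gammaL n k).reverse v u) :
    AdjacentCond le_rfl (window u hk) (window v hk) := by
  have hC := distinctAbs_window u hk
  rw [adjacentCond_iff hk _ hC]
  rw [gammaL_reverse] at h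
  exact (rowCond_of_rows hk (stageL k)
    (fun i u u' hi hb hd hr => rowCond_of_stageL (isTarget_target hC) hi hb hd hr)
    (fun i u u' hi hb r hr hrk => stageL_preserves hi (List.suffix_refl _) hb r hr hrk)
    k le_rfl h ((window_eq_iff u hk _).1 rfl)).2

lemma adjacentCond_of_gammaR {n k : ℕ} (hk : k ≤ n) {u v : SignedPerm n}
    (h : Back (gammaR n k).reverse v u) :
    AdjacentCond le_rfl (window u hk) (window v hk) := by
  have hC := distinctAbs_window u hk
  rw [adjacentCond_iff hk _ hC]
  rw [gammaR_reverse] at h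
  exact (rowCond_of_rows hk stageR
    (fun i u u' hi hb hd hr => rowCond_of_stageR (isTarget_target hC) hi hb hd hr)
    (fun i u u' hi hb r hr hrk => stageR_preserves (List.suffix_refl _) hb r hr)
    k le_rfl h ((window_eq_iff u hk _).1 rfl)).2

lemma separates_gammaL {n k : ℕ} (hk : k ≤ n) :
    Separates (gammaL n k).reverse (fun u u' => window u hk = window u' hk) := by
  rw [gammaL_reverse]
  intro β L' hs v u u' hv hu hu' he
  refine (rows_separates hk (stageL k) (fun i hi => stageL_separates hi)
    (fun i L u u' hi hL hb r hr hrk => stageL_preserves hi hL hb r hr hrk) k le_rfl).2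
    β L' hs v u u' hv hu hu' fun r hr => ?_
  rw [(window_eq_iff u hk _).1 he r hr, (window_eq_iff u' hk _).1 rfl r hr]

lemma separates_gammaR {n k : ℕ} (hk : k ≤ n) :
    Separates (gammaR n k).reverse (fun u u' => window u hk = window u' hk) := by
  rw [gammaR_reverse]
  intro β L' hs v u u' hv hu hu' he
  refine (rows_separates hk stageR (fun i hi => stageR_separates i)
    (fun i L u u' hi hL hb r hr hrk => stageR_preserves hL hb r hr) k le_rfl).2
    β L' hs v u u' hv hu hu' fun r hr => ?_
  rw [(window_eq_iff u hk _).1 he r hr, (window_eq_iff u' hk _).1 rfl r hr]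

/-! ### Counting the entries of a column -/

open Classical in
/-- The number of entries of a column with the property `P`. -/
noncomputable def num {k : ℕ} (P : ℕ → Prop) (c : Fin k → ℕ) : ℕ :=
  ((Finset.univ : Finset (Fin k)).filter (fun r => P (c r))).card

lemma num_add {k : ℕ} {P Q R : ℕ → Prop} (c : Fin k → ℕ) (h : ∀ x, P x ↔ Q x ∨ R x)
    (hd : ∀ x, Q x → ¬ R x) : num P c = num Q c + num R c := by
  classical
  unfold num
  rw [← Finset.card_union_of_disjoint]
  · congr 1
    ext r
    simp [h]
  · rw [Finset.disjoint_left]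
    intro r h1 h2
    simp only [Finset.mem_filter] at h1 h2
    exact hd _ h1.2 h2.2

lemma num_mono {k : ℕ} {P : ℕ → Prop} {c d : Fin k → ℕ} (h : ∀ r, P (c r) → P (d r)) :
    num P c ≤ num P d := by
  classical
  refine Finset.card_le_card fun r hr => ?_
  simp only [Finset.mem_filter] at hr ⊢
  exact ⟨hr.1, h r hr.2⟩

lemma num_congr {k : ℕ} {P Q : ℕ → Prop} {c d : Fin k → ℕ} (h : ∀ r, P (c r) ↔ Q (d r)) :
    num P c = num Q d := by
  classical
  unfold num
  congr 1
  ext r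
  simp [h]

lemma of_num_le {k : ℕ} {P : ℕ → Prop} {c d : Fin k → ℕ} (h : ∀ r, P (c r) → P (d r))
    (hc : num P d ≤ num P c) (r : Fin k) (hr : P (d r)) : P (c r) := by
  classical
  have hsub : (Finset.univ.filter (fun r => P (c r))) ⊆ Finset.univ.filter (fun r => P (d r)) := by
    intro r hr
    simp only [Finset.mem_filter] at hr ⊢
    exact ⟨hr.1, h r hr.2⟩
  have heq := Finset.eq_of_subset_of_card_le hsub hc
  have hmem : r ∈ Finset.univ.filter (fun r => P (d r)) := by simp [hr]
  rw [← heq] at hmem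
  simp only [Finset.mem_filter] at hmem
  exact hmem.2

/-- The entries of a column as natural numbers. -/
def cv {n k : ℕ} (C : Fin k → Letter n) (r : Fin k) : ℕ := (C r).val

/-- The number of unbarred entries of a column which are at least `s`. -/
noncomputable def cnt {n k : ℕ} (C : Fin k → Letter n) (s : ℕ) : ℕ :=
  num (fun x => s ≤ x ∧ x < n) (cv C)

/-- The relation between the columns `lD` and `rD`, up to reordering. -/
structure SplitRel {n k : ℕ} (L R : Fin k → Letter n) : Prop where
  abs : ∀ x, (x ∈ Set.range R ∨ bar x ∈ Set.range R) ↔ (x ∈ Set.range L ∨ bar x ∈ Set.range L)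
  le : ∀ s, cnt L s ≤ cnt R s
  zero : cnt L 0 = cnt R 0
  free : ∀ x : Letter n, x ∉ Set.range L → bar x ∉ Set.range L → cnt L x.val = cnt R x.val

lemma cv_ne {n k : ℕ} {C : Fin k → Letter n} (hC : DistinctAbs C) {r s : Fin k} (h : r ≠ s) :
    cv C r ≠ cv C s ∧ cv C r + cv C s ≠ 2 * n - 1 := by
  have : ¬ absLetter (C r) = absLetter (C s) := fun e => h (hC e)
  rw [absLetter_eq_iff] at this
  exact not_or.1 this

/-- Sending an entry of `R` to the entry of `L` with the same absolute value is injective, and it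
respects sets closed under bars. -/
lemma num_le_of_abs {n k : ℕ} {L R : Fin k → Letter n} (hR : DistinctAbs R)
    (h : ∀ x, (x ∈ Set.range R ∨ bar x ∈ Set.range R) → (x ∈ Set.range L ∨ bar x ∈ Set.range L))
    (M : ℕ → Prop) (hM : ∀ x, x < 2 * n → M x → M (2 * n - 1 - x)) :
    num M (cv R) ≤ num M (cv L) := by
  classical
  have hex : ∀ r : Fin k, ∃ s : Fin k, cv L s = cv R r ∨ cv L s = 2 * n - 1 - cv R r := by
    intro r
    rcases h (R r) (Or.inl ⟨r, rfl⟩) with ⟨s, hs⟩ | ⟨s, hs⟩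
    · exact ⟨s, Or.inl (congrArg Fin.val hs)⟩
    · refine ⟨s, Or.inr ?_⟩
      have := congrArg Fin.val hs
      rwa [val_bar] at this
  choose t ht using hex
  apply Finset.card_le_card_of_injOn t
  · intro r hr
    simp only [Finset.coe_filter, Set.mem_ofPred_eq, Finset.mem_univ, true_and] at hr ⊢
    rcases ht r with e | e
    · rw [e]; exact hr
    · rw [e]; exact hM _ (R r).isLt hr
  · intro r _ s _ e
    by_contra hne
    have h1 := cv_ne hR hne
    have h2 := ht r
    have h3 := ht s
    have h4 : cv R r < 2 * n := (R r).isLt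
    have h5 : cv R s < 2 * n := (R s).isLt
    rw [e] at h2
    omega

/-- The rows of two columns satisfying the adjacency condition and the splitting relation move up
within the unbarred, respectively the barred, letters. -/
lemma sameUp_of_splitRel {n k : ℕ} {L R : Fin k → Letter n} (hR : DistinctAbs R)
    (h : SplitRel L R) (hrow : ∀ p l : Fin k, p < l → Av (cv R l) (cv L p) (cv R p)) (r : Fin k) :
    SameUp n (cv L r) (cv R r) := by
  have hk : 0 < k := lt_of_le_of_lt (Nat.zero_le _) r.isLt
  have hLlt : ∀ r, cv L r < 2 * n := fun r => (L r).isLt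
  have hRlt : ∀ r, cv R r < 2 * n := fun r => (R r).isLt
  -- The target `z` of the last row serves as a cut point of the circle: the arcs of all other rows
  -- avoid it. Rows starting in a linear segment that ends at `z` stay there, and equal counts give
  -- the converse.
  obtain ⟨z, hz, hzlt, hlast⟩ : ∃ z, (∃ q, cv R q = z) ∧ z < 2 * n ∧
      ∀ r, cv R r = z ∨ Av z (cv L r) (cv R r) := by
    refine ⟨cv R ⟨k - 1, by omega⟩, ⟨_, rfl⟩, (R _).isLt, fun r => ?_⟩
    by_cases hr : r = ⟨k - 1, by omega⟩
    · exact Or.inl (by rw [hr])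
    · refine Or.inr (hrow r ⟨k - 1, by omega⟩ ?_)
      rw [Fin.lt_def]
      have : r.val ≠ k - 1 := fun e => hr (Fin.ext e)
      have := r.isLt
      simp only
      omega
  by_cases hzn : n ≤ z
  · have f1 : ∀ r, (n ≤ cv L r ∧ cv L r ≤ z) → (n ≤ cv R r ∧ cv R r ≤ z) := by
      intro r h1
      rcases hlast r with e | e
      · omega
      · simp only [Av] at e; omega
    have f2 : ∀ r, (cv L r ≤ z) → (cv R r ≤ z) := by
      intro r h1
      rcases hlast r with e | e
      · omega
      · simp only [Av] at e; omega
    have c1 : num (fun x => n ≤ x ∧ x ≤ z) (cv R) ≤ num (fun x => n ≤ x ∧ x ≤ z) (cv L) := by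
      have e1 := num_le_of_abs hR (fun x => (h.abs x).1) (fun x => 2 * n - 1 - z ≤ x ∧ x ≤ z)
        (by intro x hx h; omega)
      have e2 : ∀ c : Fin k → ℕ, num (fun x => 2 * n - 1 - z ≤ x ∧ x ≤ z) c =
          num (fun x => 2 * n - 1 - z ≤ x ∧ x < n) c + num (fun x => n ≤ x ∧ x ≤ z) c :=
        fun c => num_add c (fun x => by omega) (fun x => by omega)
      have e3 := h.le (2 * n - 1 - z)
      rw [e2, e2] at e1
      simp only [cnt] at e3
      omega
    have c2 : num (fun x => x ≤ z) (cv R) ≤ num (fun x => x ≤ z) (cv L) := by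
      have e2 : ∀ c : Fin k → ℕ, num (fun x => x ≤ z) c =
          num (fun x => 0 ≤ x ∧ x < n) c + num (fun x => n ≤ x ∧ x ≤ z) c :=
        fun c => num_add c (fun x => by omega) (fun x => by omega)
      have e3 := h.zero
      rw [e2, e2]
      simp only [cnt] at e3
      omega
    have g1 := of_num_le f1 c1 r
    have g2 := of_num_le f2 c2 r
    have g3 := f1 r
    have g4 := f2 r
    simp only [SameUp]
    rcases hlast r with e | e
    · omega
    · simp only [Av] at e; omega
  · have f1 : ∀ r, (cv L r ≤ z) → (cv R r ≤ z) := by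
      intro r h1
      rcases hlast r with e | e
      · omega
      · simp only [Av] at e; omega
    have f2 : ∀ r, (cv L r ≤ z ∨ n ≤ cv L r) → (cv R r ≤ z ∨ n ≤ cv R r) := by
      intro r h1
      rcases hlast r with e | e
      · omega
      · simp only [Av] at e; omega
    have c1 : num (fun x => x ≤ z) (cv R) ≤ num (fun x => x ≤ z) (cv L) := by
      have e2 : ∀ c : Fin k → ℕ, num (fun x => 0 ≤ x ∧ x < n) c =
          num (fun x => x ≤ z) c + num (fun x => z + 1 ≤ x ∧ x < n) c :=
        fun c => num_add c (fun x => by omega) (fun x => by omega)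
      have e3 := h.zero
      have e4 := h.le (z + 1)
      simp only [cnt] at e3 e4
      rw [e2, e2] at e3
      omega
    have c2 : num (fun x => x ≤ z ∨ n ≤ x) (cv R) ≤ num (fun x => x ≤ z ∨ n ≤ x) (cv L) := by
      have e1 : ∀ c : Fin k → ℕ, num (fun x => x ≤ z ∨ n ≤ x) c =
          num (fun x => x ≤ z) c + num (fun x => n ≤ x) c :=
        fun c => num_add c (fun x => by omega) (fun x => by omega)
      have e2 : ∀ c : Fin k → ℕ, num (fun _ => True) c =
          num (fun x => 0 ≤ x ∧ x < n) c + num (fun x => n ≤ x) c :=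
        fun c => num_add c (fun x => by simp only [true_iff]; omega) (fun x => by omega)
      have e3 : num (fun _ => True) (cv R) = num (fun _ => True) (cv L) := num_congr fun _ => Iff.rfl
      have e4 := h.zero
      simp only [cnt] at e4
      rw [e2, e2] at e3
      rw [e1, e1]
      omega
    have g1 := of_num_le f1 c1 r
    have g2 := of_num_le f2 c2 r
    have g3 := f1 r
    have g4 := f2 r
    simp only [SameUp]
    rcases hlast r with e | e
    · omega
    · simp only [Av] at e; omega

/-- Rows only move up, so entries beyond `x` stay beyond it; equality of the counts at the absent
letter `x` means that no row crosses it. For barred `x` the count is transferred from the bar of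
`x`, using that both columns have the same absolute values. -/
lemma av_of_splitRel {n k : ℕ} {L R : Fin k → Letter n} (hR : DistinctAbs R)
    (h : SplitRel L R) (hup : ∀ r, SameUp n (cv L r) (cv R r)) (x : Letter n)
    (h1 : x ∉ Set.range L) (h2 : bar x ∉ Set.range L) (r : Fin k) :
    Av x.val (cv L r) (cv R r) := by
  have hx := x.isLt
  have hxL : ∀ r, cv L r ≠ x.val := fun r e => h1 ⟨r, Fin.ext e⟩
  have hbL : ∀ r, cv L r ≠ 2 * n - 1 - x.val := fun r e => h2 ⟨r, Fin.ext (by rw [val_bar]; exact e)⟩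
  have hnR : ¬ (x ∈ Set.range R ∨ bar x ∈ Set.range R) := fun e => by
    rcases (h.abs x).1 e with e | e
    · exact h1 e
    · exact h2 e
  have hxR : ∀ r, cv R r ≠ x.val := fun r e => hnR (Or.inl ⟨r, Fin.ext e⟩)
  have hbR : ∀ r, cv R r ≠ 2 * n - 1 - x.val := fun r e =>
    hnR (Or.inr ⟨r, Fin.ext (by rw [val_bar]; exact e)⟩)
  have hur := hup r
  have hxr := hxL r
  have hxr' := hxR r
  have hRr : cv R r < 2 * n := (R r).isLt
  simp only [SameUp] at hur
  by_cases hxn : x.val < n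
  · have hf := h.free x h1 h2
    have key := of_num_le (P := fun y => x.val ≤ y ∧ y < n) (c := cv L) (d := cv R)
      (fun r hr => by have := hup r; simp only [SameUp] at this; omega) hf.ge r
    simp only [Av]
    omega
  · have hf := h.free (bar x) h2 (by rwa [bar_bar])
    have key := of_num_le (P := fun y => x.val ≤ y) (c := cv L) (d := cv R)
      (fun r hr => by have := hup r; simp only [SameUp] at this; omega)
      (by
        have e1 := num_le_of_abs hR (fun x => (h.abs x).1)
          (fun y => y ≤ 2 * n - 1 - x.val ∨ x.val ≤ y) (by intro y hy h; omega)
        have e2 : ∀ c : Fin k → ℕ, num (fun y => y ≤ 2 * n - 1 - x.val ∨ x.val ≤ y) c =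
            num (fun y => y ≤ 2 * n - 1 - x.val) c + num (fun y => x.val ≤ y) c :=
          fun c => num_add c (fun x => by omega) (fun x => by omega)
        have e3 : ∀ c : Fin k → ℕ, (∀ r, c r ≠ 2 * n - 1 - x.val) →
            num (fun x => 0 ≤ x ∧ x < n) c =
            num (fun y => y ≤ 2 * n - 1 - x.val) c +
              num (fun y => 2 * n - 1 - x.val ≤ y ∧ y < n) c := by
          intro c hc
          rw [num_congr (P := fun y => y ≤ 2 * n - 1 - x.val)
            (Q := fun y => y < 2 * n - 1 - x.val) (c := c) (d := c)
            (fun r => by have := hc r; omega)]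
          exact num_add c (fun x => by omega) (fun x => by omega)
        have e4 := h.zero
        simp only [cnt] at e4 hf
        rw [e3 _ hbL, e3 _ hbR] at e4
        rw [val_bar] at hf
        rw [e2, e2] at e1
        omega) r
    simp only [Av]
    omega

lemma splitRel_of_freeUp {n k : ℕ} (hk : k ≤ n) {u v : SignedPerm n}
    (hfix : ∀ f : Fin n, k ≤ f.val → vl u f = vl v f)
    (h : ∀ r : Fin n, r.val < k → FreeUp k (vl u) v r) :
    SplitRel (window v hk) (window u hk) := by
  -- A letter and its bar are both absent from the window exactly when a free row carries one of
  -- them; free rows thus encode the absolute values of the column.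
  have hmem : ∀ (w : SignedPerm n) (x : Letter n),
      (x ∈ Set.range (window w hk) ∨ bar x ∈ Set.range (window w hk)) ↔
      ¬ ∃ f : Fin n, k ≤ f.val ∧ (vl w f = x.val ∨ vl w f = 2 * n - 1 - x.val) := by
    intro w x
    have hx := x.isLt
    constructor
    · rintro hh ⟨f, hf, hfx⟩
      obtain ⟨r, hr⟩ : ∃ r : Fin k, vl w (Fin.castLE hk r) = x.val ∨
          vl w (Fin.castLE hk r) = 2 * n - 1 - x.val := by
        rcases hh with ⟨r, hr⟩ | ⟨r, hr⟩
        · exact ⟨r, Or.inl (congrArg Fin.val hr)⟩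
        · have := congrArg Fin.val hr
          rw [val_bar] at this
          exact ⟨r, Or.inr this⟩
      have hne : f ≠ Fin.castLE hk r := by
        intro e
        have := congrArg Fin.val e
        simp only [Fin.val_castLE] at this
        have := r.isLt
        omega
      have := vl_ne w hne
      omega
    · intro hh
      obtain ⟨i, hi⟩ := exists_vl w hx
      have hik : i.val < k := not_le.1 fun hki => hh ⟨i, hki, hi⟩
      rcases hi with hi | hi
      · exact Or.inl ⟨⟨i.val, hik⟩, Fin.ext hi⟩
      · exact Or.inr ⟨⟨i.val, hik⟩, Fin.ext (by rw [val_bar]; exact hi)⟩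
  have hrow : ∀ r : Fin k, FreeUp k (vl u) v (Fin.castLE hk r) := fun r => h _ r.isLt
  have hv : ∀ r, cv (window v hk) r = vl v (Fin.castLE hk r) := fun _ => rfl
  have hu : ∀ r, cv (window u hk) r = vl u (Fin.castLE hk r) := fun _ => rfl
  refine ⟨fun x => ?_, fun s => ?_, ?_, fun x h1 h2 => ?_⟩
  · rw [hmem, hmem]
    refine not_congr (exists_congr fun f => and_congr_right fun hf => ?_)
    rw [hfix f hf]
  · refine num_mono fun r hr => ?_
    have := (hrow r).1
    rw [hv] at hr
    rw [hu]
    simp only [SameUp] at this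
    omega
  · refine num_congr fun r => ?_
    have := (hrow r).1
    rw [hv, hu]
    simp only [SameUp] at this
    omega
  · have hx := x.isLt
    have hnot : ¬ (x ∈ Set.range (window v hk) ∨ bar x ∈ Set.range (window v hk)) := by
      rintro (e | e)
      · exact h1 e
      · exact h2 e
    rw [hmem, not_not] at hnot
    obtain ⟨f, hf, hfx⟩ := hnot
    refine num_congr fun r => ?_
    obtain ⟨g1, g2⟩ := hrow r
    have g3 := g2 f hf
    have hav : Av x.val (vl v (Fin.castLE hk r)) (vl u (Fin.castLE hk r)) := by
      rcases hfx with e | e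
      · rw [← e]; exact g3.1
      · have g4 := g3.2
        rwa [e, show 2 * n - 1 - (2 * n - 1 - x.val) = x.val by omega] at g4
    rw [hv, hu]
    simp only [SameUp, Av] at g1 hav
    omega

/-- Existence for `Γ_r(k)`. -/
lemma exists_back_gammaR {n k : ℕ} (hk : k ≤ n) {C : Fin k → Letter n} (hC : DistinctAbs C)
    {v : SignedPerm n} (h : AdjacentCond le_rfl C (window v hk))
    (hs : SplitRel (window v hk) C) :
    ∃ u, Back (gammaR n k).reverse v u ∧ window u hk = C := by
  rw [adjacentCond_iff hk C hC] at h
  have htar : ∀ r : Fin k, target C (Fin.castLE hk r) = cv C r := fun r =>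
    target_of_lt C (r := Fin.castLE hk r) r.isLt
  have hrow : ∀ p l : Fin k, p < l → Av (cv C l) (cv (window v hk) p) (cv C p) := by
    intro p l hpl
    have := h (Fin.castLE hk p) p.isLt (Fin.castLE hk l) hpl l.isLt
    rwa [htar, htar] at this
  have hup := sameUp_of_splitRel hC hs hrow
  have hfree : ∀ p : Fin n, p.val < k → FreeUp k (target C) v p := by
    intro p hp
    have e : p = Fin.castLE hk ⟨p.val, hp⟩ := rfl
    rw [e]
    constructor
    · rw [htar]
      exact hup _
    · intro f hf
      have h1 : ev v f ∉ Set.range (window v hk) := by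
        rintro ⟨r, hr⟩
        have hne : f ≠ Fin.castLE hk r := by
          intro e
          have := congrArg Fin.val e
          simp only [Fin.val_castLE] at this
          have := r.isLt
          omega
        exact hne (ev_injective v hr).symm
      have h2 : bar (ev v f) ∉ Set.range (window v hk) := by
        rintro ⟨r, hr⟩
        exact ev_ne_bar v _ _ hr
      rw [htar]
      refine ⟨av_of_splitRel hC hs hup _ h1 h2 _, ?_⟩
      have := av_of_splitRel hC hs hup (bar (ev v f)) h2 (by rwa [bar_bar]) ⟨p.val, hp⟩
      rwa [val_bar] at this
  obtain ⟨u, h1, h2⟩ := exists_rowsR (isTarget_target hC) hk k le_rfl v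
    (fun l h1 h2 => absurd h2 (not_lt.2 h1)) h hfree
  exact ⟨u, by rw [gammaR_reverse]; exact h1, (window_eq_iff u hk C).2 h2⟩

lemma splitRel_of_gammaR {n k : ℕ} (hk : k ≤ n) {u v : SignedPerm n}
    (h : Back (gammaR n k).reverse v u) : SplitRel (window v hk) (window u hk) := by
  rw [gammaR_reverse] at h
  obtain ⟨h1, h2⟩ := freeUp_of_rowsR hk k le_rfl h
  exact splitRel_of_freeUp hk h1 h2

/-! ### Split columns -/

lemma isUnbarred_bar {n : ℕ} (x : Letter n) : IsUnbarred (bar x) ↔ ¬ IsUnbarred x := by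
  unfold IsUnbarred
  have h := val_bar x
  have := x.isLt
  omega

lemma num_eq_card {k : ℕ} (P : ℕ → Prop) [DecidablePred P] (c : Fin k → ℕ) :
    num P c = (Finset.univ.filter (fun r => P (c r))).card := by
  unfold num
  congr

lemma num_eq_of_range {n k m : ℕ} {C : Fin k → Letter n} {D : Fin m → Letter n}
    (hC : Function.Injective C) (hD : Function.Injective D) (P : ℕ → Prop)
    (h : ∀ x : Letter n, P x.val → (x ∈ Set.range C ↔ x ∈ Set.range D)) :
    num P (cv C) = num P (cv D) := by
  classical
  rw [num_eq_card, num_eq_card, ← Finset.card_image_of_injective _ hC,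
    ← Finset.card_image_of_injective _ hD]
  congr 1
  ext x
  simp only [Finset.mem_image, Finset.mem_filter, Finset.mem_univ, true_and]
  constructor
  · rintro ⟨r, hr, rfl⟩
    obtain ⟨s, hs⟩ := (h _ hr).1 ⟨r, rfl⟩
    exact ⟨s, by rwa [cv, hs], hs⟩
  · rintro ⟨r, hr, rfl⟩
    obtain ⟨s, hs⟩ := (h _ hr).2 ⟨r, rfl⟩
    exact ⟨s, by rwa [cv, hs], hs⟩

lemma num_append {k m : ℕ} (P : ℕ → Prop) (c : Fin k → ℕ) (d : Fin m → ℕ) :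
    num P (Fin.append c d) = num P c + num P d := by
  classical
  unfold num
  simp only [Finset.card_filter, Fin.sum_univ_add, Fin.append_left, Fin.append_right]

/-- This is applied with the letters `z` removed from `L` and the letters `t` missing from `R`:
joining `z` to `L` and `t` to `R` gives the same unbarred letters. Inequalities between `cnt L` and
`cnt R` thereby become comparisons of `t` with `z`. -/
lemma cnt_add_cnt {n k r m q : ℕ} {L : Fin k → Letter n} {z : Fin r → Letter n}
    {R : Fin m → Letter n} {t : Fin q → Letter n} (hL : Function.Injective L)
    (hz : Function.Injective z) (hR : Function.Injective R) (ht : Function.Injective t)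
    (hLz : ∀ x ∈ Set.range z, x ∉ Set.range L) (hRt : ∀ x ∈ Set.range t, x ∉ Set.range R)
    (h : ∀ x, IsUnbarred x →
      (x ∈ Set.range L ∨ x ∈ Set.range z ↔ x ∈ Set.range R ∨ x ∈ Set.range t)) (s : ℕ) :
    cnt L s + cnt z s = cnt R s + cnt t s := by
  have key : ∀ {a b : ℕ} (A : Fin a → Letter n) (B : Fin b → Letter n), cnt A s + cnt B s =
      num (fun x => s ≤ x ∧ x < n) (cv (Fin.append A B)) := by
    intro a b A B
    rw [cnt, cnt, ← num_append]
    congr 1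
    ext i
    refine Fin.addCases (fun i => ?_) (fun i => ?_) i <;> simp [cv]
  have hrange : ∀ {a b : ℕ} (A : Fin a → Letter n) (B : Fin b → Letter n) (x : Letter n),
      x ∈ Set.range (Fin.append A B) ↔ x ∈ Set.range A ∨ x ∈ Set.range B := by
    intro a b A B x
    constructor
    · rintro ⟨i, rfl⟩
      refine Fin.addCases (fun i => ?_) (fun i => ?_) i
      · exact Or.inl ⟨i, by rw [Fin.append_left]⟩
      · exact Or.inr ⟨i, by rw [Fin.append_right]⟩
    · rintro (⟨i, rfl⟩ | ⟨i, rfl⟩)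
      · exact ⟨Fin.castAdd _ i, by rw [Fin.append_left]⟩
      · exact ⟨Fin.natAdd _ i, by rw [Fin.append_right]⟩
  have hinj : ∀ {a b : ℕ} (A : Fin a → Letter n) (B : Fin b → Letter n),
      Function.Injective A → Function.Injective B →
      (∀ x ∈ Set.range B, x ∉ Set.range A) → Function.Injective (Fin.append A B) := by
    intro a b A B hA hB hAB
    rw [Fin.append_injective_iff]
    exact ⟨hA, hB, fun i j e => hAB _ ⟨j, rfl⟩ ⟨i, e⟩⟩
  rw [key, key]
  refine num_eq_of_range (hinj _ _ hL hz hLz) (hinj _ _ hR ht hRt) _ fun x hx => ?_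
  rw [hrange, hrange]
  exact h x hx.2

/-- In a decreasing sequence, the entries that are at least `s` form an initial segment. Comparing
counts at all `s` therefore compares the sequences entry by entry. -/
lemma lt_cnt_iff {n r : ℕ} {z : Fin r → Letter n} (hz : StrictAnti z)
    (hu : ∀ i, IsUnbarred (z i)) (i : Fin r) (s : ℕ) : i.val < cnt z s ↔ s ≤ (z i).val := by
  unfold cnt
  rw [num_eq_card]
  constructor
  · intro h
    by_contra hs
    have hsub : (Finset.univ.filter (fun j => s ≤ cv z j ∧ cv z j < n)) ⊆ Finset.Iio i := by
      intro j hj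
      simp only [Finset.mem_filter, Finset.mem_univ, true_and] at hj
      rw [Finset.mem_Iio]
      by_contra hji
      have h2 : cv z j ≤ (z i).val := hz.antitone (not_lt.1 hji)
      omega
    have := Finset.card_le_card hsub
    rw [Fin.card_Iio] at this
    omega
  · intro h
    have hsub : Finset.Iic i ⊆ (Finset.univ.filter (fun j => s ≤ cv z j ∧ cv z j < n)) := by
      intro j hj
      rw [Finset.mem_Iic] at hj
      have h2 : (z i).val ≤ (z j).val := hz.antitone hj
      simp only [Finset.mem_filter, Finset.mem_univ, true_and]
      exact ⟨h.trans h2, hu j⟩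
    have := Finset.card_le_card hsub
    rw [Fin.card_Iic] at this
    omega

lemma cnt_zero_of_unbarred {n r : ℕ} {z : Fin r → Letter n} (hu : ∀ i, IsUnbarred (z i)) :
    cnt z 0 = r := by
  unfold cnt
  rw [num_eq_card, Finset.filter_true_of_mem (fun i _ => ⟨Nat.zero_le _, hu i⟩), Finset.card_univ,
    Fintype.card_fin]

lemma DistinctAbs.injective {n k : ℕ} {C : Fin k → Letter n} (hC : DistinctAbs C) :
    Function.Injective C := fun _ _ h => hC (congrArg absLetter h)

lemma DistinctAbs.bar_notMem {n k : ℕ} {C : Fin k → Letter n} (hC : DistinctAbs C)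
    {x : Letter n} (hx : x ∈ Set.range C) : bar x ∉ Set.range C := by
  rintro ⟨j, hj⟩
  obtain ⟨i, rfl⟩ := hx
  by_cases h : i = j
  · subst h
    have h1 := congrArg Fin.val hj
    have := val_bar (C i)
    have := (C i).isLt
    omega
  · refine (cv_ne hC h).2 ?_
    have h1 := congrArg Fin.val hj
    rw [val_bar] at h1
    have := (C i).isLt
    unfold cv
    omega

lemma range_ord {n k : ℕ} (C : Fin k → Letter n) : Set.range (ord C) = Set.range C :=
  (Tuple.sort C).surjective.range_comp C

lemma strictMono_ord {n k : ℕ} {C : Fin k → Letter n} (hC : Function.Injective C) :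
    StrictMono (ord C) :=
  (Tuple.monotone_sort C).strictMono_of_injective (hC.comp (Tuple.sort C).injective)

lemma splitData_strictAnti {n k r : ℕ} {D : Fin k → Letter n} {z t : Fin r → Letter n}
    (h : SplitData D z t) : StrictAnti t := by
  rcases r with _ | r
  · exact fun i => i.elim0
  · rw [Fin.strictAnti_iff_succ_lt]
    intro i
    exact (h.2.2 i.succ).1.2.2.1 i.castSucc (by simp)

/-- `t_i < z_i` gives the inequality of counts. The maximality of the `t_i` means that no letter
absent from `L` together with its bar lies between some `t_i` and `z_i`, which gives equality of the
counts at such letters. -/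
lemma splitRel_of_isSplitting {n k : ℕ} {D R L : Fin k → Letter n} (hR : Function.Injective R)
    (hL : Function.Injective L) (h : IsSplitting D (ord R) (ord L)) : SplitRel L R := by
  obtain ⟨r, z, t, hd, -, hRr, -, hLr⟩ := h
  have hta := splitData_strictAnti hd
  obtain ⟨hza, hzr, ht⟩ := hd
  rw [range_ord] at hRr hLr
  have hz1 : ∀ i, IsUnbarred (z i) ∧ z i ∈ Set.range D ∧ bar (z i) ∈ Set.range D := by
    intro i
    have : z i ∈ Set.range z := ⟨i, rfl⟩
    rw [hzr] at this
    exact this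
  have hzt : ∀ i j, z i ≠ t j := by
    intro i j e
    exact (ht j).1.2.2.2.1 (e ▸ (hz1 i).2.1)
  have hRu : ∀ x, IsUnbarred x → (x ∈ Set.range R ↔ x ∈ Set.range D) := by
    intro x hx
    rw [hRr]
    constructor
    · rintro (h | ⟨i, rfl⟩)
      · exact h.1
      · exact absurd (ht i).1.1 ((isUnbarred_bar _).1 hx)
    · intro h
      refine Or.inl ⟨h, ?_⟩
      rintro ⟨i, rfl⟩
      exact (isUnbarred_bar _).1 hx (hz1 i).1
  have hLb : ∀ x, ¬ IsUnbarred x → (x ∈ Set.range L ↔ x ∈ Set.range D) := by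
    intro x hx
    rw [hLr]
    constructor
    · rintro (h | ⟨i, rfl⟩)
      · exact h.1
      · exact absurd (ht i).1.1 hx
    · intro h
      refine Or.inl ⟨h, ?_⟩
      rintro ⟨i, rfl⟩
      exact hx (hz1 i).1
  have hLu : ∀ x, x ∈ Set.range L ↔ (x ∈ Set.range D ∧ x ∉ Set.range z) ∨ x ∈ Set.range t := by
    intro x; rw [hLr]; rfl
  have hRb : ∀ x, bar x ∈ Set.range R ↔
      (bar x ∈ Set.range D ∧ x ∉ Set.range z) ∨ x ∈ Set.range t := by
    have hbr : ∀ (u : Fin r → Letter n) x, bar x ∈ Set.range (fun i => bar (u i)) ↔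
        x ∈ Set.range u := fun u x =>
      ⟨fun ⟨i, hi⟩ => ⟨i, bar_injective hi⟩, fun ⟨i, hi⟩ => ⟨i, congrArg bar hi⟩⟩
    intro x
    rw [hRr, Set.mem_union, Set.mem_sdiff, hbr, hbr]
  have hcnt := cnt_add_cnt hL hza.injective hR hta.injective
    (by
      rintro _ ⟨i, rfl⟩ hx
      rcases (hLu _).1 hx with h | ⟨j, hj⟩
      · exact h.2 ⟨i, rfl⟩
      · exact hzt i j hj.symm)
    (by
      rintro _ ⟨i, rfl⟩ hx
      exact (ht i).1.2.2.2.1 ((hRu _ (ht i).1.1).1 hx))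
    (by
      intro x hx
      rw [hRu x hx, hLu x]
      have : x ∈ Set.range z → x ∈ Set.range D := by rintro ⟨i, rfl⟩; exact (hz1 i).2.1
      tauto)
  have habs : ∀ x, IsUnbarred x →
      ((x ∈ Set.range R ∨ bar x ∈ Set.range R) ↔ (x ∈ Set.range L ∨ bar x ∈ Set.range L)) := by
    intro x hx
    rw [hRu x hx, hRb, hLu, hLb _ (fun h => (isUnbarred_bar _).1 h hx)]
    have : x ∈ Set.range z → x ∈ Set.range D ∧ bar x ∈ Set.range D := by
      rintro ⟨i, rfl⟩; exact (hz1 i).2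
    tauto
  refine ⟨fun x => ?_, fun s => ?_, ?_, fun x h1 h2 => ?_⟩
  · by_cases hx : IsUnbarred x
    · exact habs x hx
    · have := habs (bar x) ((isUnbarred_bar x).2 hx)
      rw [bar_bar] at this
      tauto
  · have h1 := hcnt s
    have h2 : cnt t s ≤ cnt z s := num_mono fun i hi =>
      ⟨hi.1.trans (Fin.lt_def.1 (ht i).1.2.1).le, (hz1 i).1⟩
    omega
  · have h1 := hcnt 0
    rw [cnt_zero_of_unbarred fun i => (hz1 i).1, cnt_zero_of_unbarred fun i => (ht i).1.1] at h1
    omega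
  · have h3 := hcnt x.val
    suffices cnt z x.val = cnt t x.val by omega
    by_cases hx : IsUnbarred x
    · have hbx : ¬ IsUnbarred (bar x) := fun h => (isUnbarred_bar _).1 h hx
      have hxz : x ∉ Set.range z := by
        rintro ⟨i, rfl⟩
        exact h2 ((hLb _ hbx).2 (hz1 i).2.2)
      have hxD : x ∉ Set.range D := fun h => h1 ((hLu x).2 (Or.inl ⟨h, hxz⟩))
      have hbD : bar x ∉ Set.range D := fun h => h2 ((hLb _ hbx).2 h)
      -- An absent letter below `z_i` is a candidate in the choice of `t_i`: by induction it is at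
      -- most `t_{i-1}`, and it is not equal to it because it does not occur in `L`.
      have key : ∀ m (i : Fin r), i.val = m → x ≤ z i → x ≤ t i := by
        intro m
        induction m with
        | zero =>
          intro i hi hxi
          exact (ht i).2 ⟨hx, lt_of_le_of_ne hxi (fun e => hxz ⟨i, e.symm⟩),
            fun j hj => absurd hj (by omega), hxD, hbD⟩
        | succ m ih =>
          intro i hi hxi
          refine (ht i).2 ⟨hx, lt_of_le_of_ne hxi (fun e => hxz ⟨i, e.symm⟩),
            fun j hj => ?_, hxD, hbD⟩
          refine lt_of_le_of_ne (ih j (by omega) (hxi.trans (hza ?_).le))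
            (fun e => h1 ((hLu x).2 (Or.inr ⟨j, e.symm⟩)))
          rw [Fin.lt_def]; omega
      refine num_congr fun i => ?_
      have e1 := (hz1 i).1
      have e2 := (ht i).1.1
      have e3 := Fin.lt_def.1 (ht i).1.2.1
      have e4 := key _ i rfl
      simp only [Fin.le_def] at e4
      unfold IsUnbarred at e1 e2
      unfold cv
      constructor
      · intro h; exact ⟨e4 h.1, e2⟩
      · intro h; exact ⟨by omega, e1⟩
    · refine num_congr fun i => ?_
      unfold IsUnbarred at hx
      constructor <;> intro h <;> omega

lemma exists_strictAnti {n : ℕ} (S : Set (Letter n)) :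
    ∃ (r : ℕ) (z : Fin r → Letter n), StrictAnti z ∧ Set.range z = S := by
  classical
  have hf : S.Finite := Set.toFinite S
  refine ⟨_, fun i => hf.toFinset.orderEmbOfFin rfl (Fin.rev i), fun i j h => ?_, ?_⟩
  · exact (hf.toFinset.orderEmbOfFin rfl).strictMono (Fin.rev_lt_rev.2 h)
  · have := Fin.revPerm.surjective.range_comp (hf.toFinset.orderEmbOfFin rfl)
    rw [Finset.range_orderEmbOfFin, Set.Finite.coe_toFinset] at this
    exact this

lemma exists_strictMono {n : ℕ} (S : Set (Letter n)) :
    ∃ (r : ℕ) (z : Fin r → Letter n), StrictMono z ∧ Set.range z = S := by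
  obtain ⟨r, z, h1, h2⟩ := exists_strictAnti S
  refine ⟨r, z ∘ Fin.rev, fun i j h => h1 (Fin.rev_lt_rev.2 h), ?_⟩
  rw [← h2]
  exact Fin.revPerm.surjective.range_comp z

/-- `D` consists of the unbarred letters of `R` and the barred letters of `L`. The `z` are the
letters unbarred in `R` and barred in `L`, the `t` the reverse; the count relations give `t_i < z_i`
and the maximality of `t_i`. -/
lemma exists_isSplitting {n k : ℕ} {R L : Fin k → Letter n} (hR : DistinctAbs R)
    (hL : DistinctAbs L) (h : SplitRel L R) :
    ∃ D : Fin k → Letter n, IsKNColumn D ∧ IsSplitting D (ord R) (ord L) := by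
  obtain ⟨r, z, hz, hzr⟩ :=
    exists_strictAnti {x : Letter n | IsUnbarred x ∧ x ∈ Set.range R ∧ bar x ∈ Set.range L}
  obtain ⟨r', t, ht, htr⟩ :=
    exists_strictAnti {x : Letter n | IsUnbarred x ∧ x ∈ Set.range L ∧ bar x ∈ Set.range R}
  obtain ⟨k', D, hD, hDr⟩ := exists_strictMono {x : Letter n |
    (IsUnbarred x ∧ x ∈ Set.range R) ∨ (¬ IsUnbarred x ∧ x ∈ Set.range L)}
  have hzm : ∀ x, x ∈ Set.range z ↔ IsUnbarred x ∧ x ∈ Set.range R ∧ bar x ∈ Set.range L := by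
    intro x; rw [hzr]; rfl
  have htm : ∀ x, x ∈ Set.range t ↔ IsUnbarred x ∧ x ∈ Set.range L ∧ bar x ∈ Set.range R := by
    intro x; rw [htr]; rfl
  have hDm : ∀ x, x ∈ Set.range D ↔
      (IsUnbarred x ∧ x ∈ Set.range R) ∨ (¬ IsUnbarred x ∧ x ∈ Set.range L) := by
    intro x; rw [hDr]; rfl
  have hzu : ∀ i, IsUnbarred (z i) := fun i => ((hzm _).1 ⟨i, rfl⟩).1
  have htu : ∀ i, IsUnbarred (t i) := fun i => ((htm _).1 ⟨i, rfl⟩).1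
  have hLn : ∀ x, x ∈ Set.range L → bar x ∉ Set.range L := fun x => hL.bar_notMem
  have hRn : ∀ x, x ∈ Set.range R → bar x ∉ Set.range R := fun x => hR.bar_notMem
  have hcnt : ∀ s, cnt L s + cnt z s = cnt R s + cnt t s := by
    refine cnt_add_cnt hL.injective hz.injective hR.injective ht.injective ?_ ?_ ?_
    · intro x hx hxL; exact hLn x hxL ((hzm x).1 hx).2.2
    · intro x hx hxR; exact hRn x hxR ((htm x).1 hx).2.2
    · intro x hx
      rw [hzm, htm]
      have := h.abs x
      tauto
  have hrr : r' = r := by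
    have h1 := hcnt 0
    rw [cnt_zero_of_unbarred hzu, cnt_zero_of_unbarred htu, h.zero] at h1
    omega
  -- `R` and `L` have equally many unbarred letters, so `D` has as many entries as `L`.
  have hkk : k' = k := by
    have hsplit : ∀ {m : ℕ} (C : Fin m → Letter n), m = cnt C 0 + num (fun x => n ≤ x) (cv C) := by
      intro m C
      rw [cnt, ← num_add (P := fun _ => True)]
      · simp [num]
      · intro x; have := le_or_gt n x; simp; omega
      · intro x; omega
    rw [hsplit D, hsplit L, h.zero]
    congr 1
    · refine num_eq_of_range hD.injective hR.injective _ fun x hx => ?_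
      have : IsUnbarred x := hx.2
      rw [hDm]
      tauto
    · refine num_eq_of_range hD.injective hL.injective _ fun x hx => ?_
      have : ¬ IsUnbarred x := not_lt.2 hx
      rw [hDm]
      tauto
  subst hrr hkk
  have hsd : SplitData D z t := by
    refine ⟨hz, ?_, fun i => ⟨⟨htu i, ?_, fun j hj => ?_, ?_, ?_⟩, fun x hx => ?_⟩⟩
    · rw [hzr]
      ext x
      simp only [Set.mem_ofPred_eq, hDm, isUnbarred_bar]
      tauto
    · have h1 := (lt_cnt_iff ht htu i (t i).val).2 le_rfl
      have h2 := hcnt (t i).val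
      have h3 := h.le (t i).val
      have h4 := (lt_cnt_iff hz hzu i (t i).val).1 (by omega)
      refine lt_of_le_of_ne h4 fun e => ?_
      have h5 := (htm _).1 ⟨i, rfl⟩
      have h6 := (hzm _).1 ⟨i, rfl⟩
      rw [← e] at h6
      exact hLn _ h5.2.1 h6.2.2
    · exact ht (by rw [Fin.lt_def]; omega)
    · have h5 := (htm _).1 ⟨i, rfl⟩
      have := hRn (t i)
      rw [hDm]
      tauto
    · have h5 := (htm _).1 ⟨i, rfl⟩
      have := hLn (t i)
      rw [hDm, isUnbarred_bar]
      tauto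
    · obtain ⟨hxu, hxz, hx, hxD, hbD⟩ := hx
      rw [hDm] at hxD
      rw [hDm, isUnbarred_bar] at hbD
      have ha := h.abs x
      have h1 := h.free x
      have h2 := hcnt x.val
      by_cases hxt : x ∈ Set.range t
      · obtain ⟨j, rfl⟩ := hxt
        refine ht.antitone (not_lt.1 fun hji => ?_)
        rw [Fin.lt_def] at hji
        have h3 := hx ⟨i.val - 1, by omega⟩ (by simp only; omega)
        have h4 := ht.antitone (show j ≤ ⟨i.val - 1, by omega⟩ by rw [Fin.le_def]; simp only; omega)
        exact absurd h3 (not_lt.2 h4)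
      -- Here neither `x` nor its bar occurs in `L`, so `z` and `t` have equally many entries that
      -- are at least `x`.
      · rw [htm] at hxt
        have h3 := h1 (by clear h2 h1; tauto) (by clear h2 h1; tauto)
        have h4 := (lt_cnt_iff hz hzu i x.val).2 (Fin.lt_def.1 hxz).le
        exact (lt_cnt_iff ht htu i x.val).1 (by omega)
  have hbm : ∀ (u : Fin r' → Letter n) x, x ∈ Set.range (fun i => bar (u i)) ↔
      bar x ∈ Set.range u := fun u x =>
    ⟨fun ⟨i, hi⟩ => ⟨i, by rw [← hi, bar_bar]⟩, fun ⟨i, hi⟩ => ⟨i, by simp only [hi, bar_bar]⟩⟩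
  refine ⟨D, ⟨hD, r', z, t, hsd⟩, r', z, t, hsd, strictMono_ord hR.injective, ?_,
    strictMono_ord hL.injective, ?_⟩
  · ext x
    rw [range_ord, Set.mem_union, Set.mem_sdiff, hbm, hbm, hDm, hzm, htm, isUnbarred_bar, bar_bar]
    have h1 := h.abs x
    have h2 := hLn x
    have h3 := hRn x
    tauto
  · ext x
    rw [range_ord, Set.mem_union, Set.mem_sdiff, hDm, hzm, htm]
    have h1 := h.abs x
    have h2 := hLn x
    have h3 := hRn x
    tauto

/-! ### The columns of a filling -/

/-- The entries of the right-hand column are `1, …, k` in order. No later entry of `C` may equal one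
of these, so `C(l)` is at least `l`; the circular condition then reduces to the absence of descents.
-/
lemma adjacentCond_window_one {n k : ℕ} (hk : k ≤ n) {C : Fin k → Letter n}
    (hC : Function.Injective C) :
    AdjacentCond le_rfl C (window 1 hk) ↔ StrictMono C := by
  have hw : ∀ i : Fin k, (window (1 : SignedPerm n) hk (Fin.castLE le_rfl i)).val = i.val :=
    fun i => rfl
  simp only [AdjacentCond, CircLT, Fin.lt_def, ne_eq, Fin.ext_iff, hw]
  constructor
  · intro h i l hil
    obtain ⟨h1, h2⟩ := h i l hil
    have hne : (C i).val ≠ (C l).val := fun e => (Fin.ne_of_lt hil) (hC (Fin.ext e))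
    rw [Fin.lt_def] at hil ⊢
    -- A letter smaller than the row number `i` is itself the entry of an earlier row of the
    -- identity, so the equality clause for that row is violated.
    have h3 : ¬ (C l).val < i.val := fun hlt =>
      (h ⟨(C l).val, by omega⟩ l (by simp only; omega)).1 rfl
    omega
  · intro h
    have hge : ∀ m (i : Fin k), i.val = m → m ≤ (C i).val := by
      intro m
      induction m with
      | zero => exact fun i _ => Nat.zero_le _
      | succ m ih =>
        intro i hi
        have h1 := ih ⟨m, by omega⟩ rfl
        have h2 : (C ⟨m, by omega⟩).val < (C i).val := h (by rw [Fin.lt_def]; simp only; omega)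
        omega
    intro i l hil
    have h1 := hge _ i rfl
    have h2 : (C i).val < (C l).val := h hil
    omega

/-! ### Positions of the columns in the chain -/

lemma chainSegment_of_lt {n : ℕ} [NeZero n] (μ : Fin n → ℕ) {c : ℕ} (hc : c < μ 0) :
    chainSegment μ c = chainSegment μ (c + 1) ++ gammaR n (height μ c) ++
      gammaL n (height μ c) := by
  obtain ⟨m, hm⟩ : ∃ m, μ 0 - c = m + 1 := ⟨μ 0 - c - 1, by omega⟩
  have hm' : μ 0 - (c + 1) = m := by omega
  rw [chainSegment, chainSegment, hm, hm', List.range'_succ, List.reverse_cons, List.flatMap_append,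
    List.append_assoc]
  simp [gamma]

lemma chainSegment_self {n : ℕ} [NeZero n] (μ : Fin n → ℕ) : chainSegment μ (μ 0) = [] := by
  simp [chainSegment]

/-- The position in the chain of `μ` at which the right column `c` of a filling is read. -/
def rightPos {n : ℕ} [NeZero n] (μ : Fin n → ℕ) (c : ℕ) : ℕ := (chainSegment μ (c + 1)).length

/-- The position in the chain of `μ` at which the left column `c` of a filling is read. -/
def leftPos {n : ℕ} [NeZero n] (μ : Fin n → ℕ) (c : ℕ) : ℕ :=
  (chainSegment μ (c + 1)).length + (gammaR n (height μ c)).length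

lemma length_chainSegment {n : ℕ} [NeZero n] (μ : Fin n → ℕ) {c : ℕ} (hc : c < μ 0) :
    (chainSegment μ c).length = leftPos μ c + (gammaL n (height μ c)).length := by
  rw [chainSegment_of_lt μ hc, List.length_append, List.length_append, leftPos]

lemma rightPos_le_leftPos {n : ℕ} [NeZero n] (μ : Fin n → ℕ) (c : ℕ) :
    rightPos μ c ≤ leftPos μ c := Nat.le_add_right _ _

lemma leftPos_le {n : ℕ} [NeZero n] (μ : Fin n → ℕ) {c : ℕ} (hc : c < μ 0) :
    leftPos μ c ≤ (chainSegment μ c).length := by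
  rw [length_chainSegment μ hc]
  exact Nat.le_add_right _ _

lemma length_chainSegment_le {n : ℕ} [NeZero n] (μ : Fin n → ℕ) {c d : ℕ} (hcd : c ≤ d)
    (hd : d ≤ μ 0) : (chainSegment μ d).length ≤ (chainSegment μ c).length := by
  induction d, hcd using Nat.le_induction with
  | base => exact le_rfl
  | succ d _ ih =>
    exact ((rightPos_le_leftPos μ d).trans (leftPos_le μ hd)).trans (ih (Nat.le_of_succ_le hd))

lemma exists_chain_eq {n : ℕ} [NeZero n] (μ : Fin n → ℕ) {c : ℕ} (hc : c ≤ μ 0) :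
    ∃ B, chain μ = chainSegment μ c ++ B := by
  induction c with
  | zero => exact ⟨[], (List.append_nil _).symm⟩
  | succ c ih =>
    obtain ⟨B, hB⟩ := ih (Nat.le_of_succ_le hc)
    exact ⟨_, by rw [hB, chainSegment_of_lt μ hc, List.append_assoc, List.append_assoc]⟩

lemma exists_chain_split_left {n : ℕ} [NeZero n] (μ : Fin n → ℕ) {c : ℕ} (hc : c < μ 0) :
    ∃ A B, A.length = leftPos μ c ∧ chain μ = A ++ gammaL n (height μ c) ++ B := by
  obtain ⟨B, hB⟩ := exists_chain_eq μ hc.le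
  rw [chainSegment_of_lt μ hc] at hB
  exact ⟨_, B, by rw [List.length_append, leftPos], hB⟩

lemma exists_chain_split_right {n : ℕ} [NeZero n] (μ : Fin n → ℕ) {c : ℕ} (hc : c < μ 0) :
    ∃ B, chain μ = chainSegment μ (c + 1) ++ gammaR n (height μ c) ++ B := by
  obtain ⟨B, hB⟩ := exists_chain_eq μ hc.le
  rw [chainSegment_of_lt μ hc, List.append_assoc] at hB
  exact ⟨_, hB⟩

lemma IsTrace.mono {n : ℕ} {Γ : List (PosRoot n)} {a b : ℕ} {g : ℕ → SignedPerm n}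
    (hg : IsTrace Γ a g) (h : a ≤ b) : IsTrace Γ b g := fun p hp => hg p (h.trans hp)

lemma IsTrace.back_gammaR {n : ℕ} [NeZero n] {μ : Fin n → ℕ} {g : ℕ → SignedPerm n} {c : ℕ}
    (hg : IsTrace (chain μ) (rightPos μ c) g) (hc : c < μ 0) :
    Back (gammaR n (height μ c)).reverse (g (leftPos μ c)) (g (rightPos μ c)) := by
  obtain ⟨B, hB⟩ := exists_chain_split_right μ hc
  rw [hB] at hg
  exact hg.back

lemma IsTrace.back_gammaL {n : ℕ} [NeZero n] {μ : Fin n → ℕ} {g : ℕ → SignedPerm n} {c : ℕ}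
    (hg : IsTrace (chain μ) (leftPos μ c) g) (hc : c < μ 0) :
    Back (gammaL n (height μ c)).reverse (g (chainSegment μ c).length) (g (leftPos μ c)) := by
  obtain ⟨A, B, hA, hB⟩ := exists_chain_split_left μ hc
  rw [hB, ← hA] at hg
  rw [length_chainSegment μ hc, ← hA]
  exact hg.back

lemma IsTrace.extend_gammaR {n : ℕ} [NeZero n] {μ : Fin n → ℕ} {g : ℕ → SignedPerm n} {c : ℕ}
    (hg : IsTrace (chain μ) (leftPos μ c) g) (hc : c < μ 0) {u : SignedPerm n}
    (hu : Back (gammaR n (height μ c)).reverse (g (leftPos μ c)) u) :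
    ∃ g', IsTrace (chain μ) (rightPos μ c) g' ∧ g' (rightPos μ c) = u ∧
      ∀ p, leftPos μ c ≤ p → g' p = g p := by
  obtain ⟨B, hB⟩ := exists_chain_split_right μ hc
  rw [hB] at hg ⊢
  exact hg.extend hu

lemma IsTrace.extend_gammaL {n : ℕ} [NeZero n] {μ : Fin n → ℕ} {g : ℕ → SignedPerm n} {c : ℕ}
    (hg : IsTrace (chain μ) (chainSegment μ c).length g) (hc : c < μ 0) {u : SignedPerm n}
    (hu : Back (gammaL n (height μ c)).reverse (g (chainSegment μ c).length) u) :
    ∃ g', IsTrace (chain μ) (leftPos μ c) g' ∧ g' (leftPos μ c) = u ∧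
      ∀ p, (chainSegment μ c).length ≤ p → g' p = g p := by
  obtain ⟨A, B, hA, hB⟩ := exists_chain_split_left μ hc
  rw [length_chainSegment μ hc, ← hA] at hg hu ⊢
  rw [hB] at hg ⊢
  exact hg.extend hu

/-- Reading backwards, `Γ_l` is settled by the left column; this fixes the common element from which
`Γ_r` is settled by the right column. -/
lemma IsTrace.unique_column {n : ℕ} [NeZero n] {μ : Fin n → ℕ} {g g' : ℕ → SignedPerm n} {c : ℕ}
    (hg : IsTrace (chain μ) (rightPos μ c) g) (hg' : IsTrace (chain μ) (rightPos μ c) g')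
    (hc : c < μ 0) (hend : g (chainSegment μ c).length = g' (chainSegment μ c).length)
    (hr : window (g (rightPos μ c)) (height_le μ c) = window (g' (rightPos μ c)) (height_le μ c))
    (hl : window (g (leftPos μ c)) (height_le μ c) = window (g' (leftPos μ c)) (height_le μ c))
    (p : ℕ) (h1 : rightPos μ c ≤ p) (h2 : p ≤ (chainSegment μ c).length) : g p = g' p := by
  have hL : ∀ p, leftPos μ c ≤ p → p ≤ (chainSegment μ c).length → g p = g' p := by
    obtain ⟨A, B, hA, hB⟩ := exists_chain_split_left μ hc
    have hgl := hg.mono (rightPos_le_leftPos μ c)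
    have hgl' := hg'.mono (rightPos_le_leftPos μ c)
    rw [hB, ← hA] at hgl hgl'
    rw [← hA] at hl
    rw [length_chainSegment μ hc, ← hA] at hend ⊢
    exact hgl.unique (fun u u' h => h.symm) (separates_gammaL (height_le μ c)) hgl' hend hl
  rcases le_total (leftPos μ c) p with h | h
  · exact hL p h h2
  · obtain ⟨B, hB⟩ := exists_chain_split_right μ hc
    rw [hB] at hg hg'
    exact hg.unique (fun u u' h => h.symm) (separates_gammaR (height_le μ c)) hg'
      (hL _ le_rfl (leftPos_le μ hc)) hr p h1 h

/-- The condition on the columns `C_l^{c+1}` and `C_r^c` for windows of signed permutations. -/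
lemma adjacentCond_window_castLE {n k k' : ℕ} (h : k' ≤ k) (hk : k ≤ n) (C : Fin k' → Letter n)
    (v : SignedPerm n) :
    AdjacentCond h C (window v hk) ↔ AdjacentCond le_rfl C (window v (h.trans hk)) := Iff.rfl

/-! ### Injectivity and image of the filling map -/

lemma injOn_fillingMap {n : ℕ} [NeZero n] (μ : Fin n → ℕ) :
    Set.InjOn (fillingMap μ) (FBar (chain μ)) := by
  intro F hF F' hF' h
  -- The induction runs over the columns from right to left, that is, backwards along the chain from
  -- the common end `1`.
  have key : ∀ c ≤ μ 0, ∀ p, (chainSegment μ c).length ≤ p → p ≤ (chain μ).length →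
      walk F p = walk F' p := by
    intro c
    induction c with
    | zero =>
      intro _ p h1 h2
      rw [le_antisymm h2 h1]
      exact ((mem_FBar_iff F).1 hF).1.trans ((mem_FBar_iff F').1 hF').1.symm
    | succ c ih =>
      intro hc p h1 h2
      have ih := ih (Nat.le_of_succ_le hc)
      rcases le_total (chainSegment μ c).length p with h3 | h3
      · exact ih p h3 h2
      · exact ((isTrace_walk hF).mono (Nat.zero_le _)).unique_column
          ((isTrace_walk hF').mono (Nat.zero_le _)) hc
          (ih _ le_rfl (length_chainSegment_le μ (Nat.zero_le c) (Nat.le_of_succ_le hc)))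
          (congrArg (fun σ => σ.right ⟨c, hc⟩) h) (congrArg (fun σ => σ.left ⟨c, hc⟩) h) p h1 h3
  exact foldingPair_ext fun p hp => key (μ 0) le_rfl p (by simp [chainSegment_self]) hp

lemma admissible_fillingMap {n : ℕ} [NeZero n] (μ : Fin n → ℕ) {F : FoldingPair (chain μ)}
    (hF : F ∈ FBar (chain μ)) : Admissible (fillingMap μ F) := by
  have hg : ∀ a, IsTrace (chain μ) a (walk F) := fun a => (isTrace_walk hF).mono (Nat.zero_le a)
  have hR := fun c : Fin (μ 0) => (hg (rightPos μ c)).back_gammaR c.isLt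
  have hL := fun c : Fin (μ 0) => (hg (leftPos μ c)).back_gammaL c.isLt
  refine ⟨fun c => distinctAbs_window _ _, fun c => distinctAbs_window _ _, fun c hc => ?_,
    fun c => ?_, fun c => ?_, fun c h => ?_⟩
  · have h := adjacentCond_of_gammaL (height_le μ c) (hL c)
    have h1 : walk F (chainSegment μ c).length = 1 := by
      rw [hc]
      exact ((mem_FBar_iff F).1 hF).1
    rw [h1] at h
    exact (adjacentCond_window_one (height_le μ c) (distinctAbs_window _ _).injective).1 h
  · exact exists_isSplitting (distinctAbs_window _ _) (distinctAbs_window _ _)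
      (splitRel_of_gammaR (height_le μ c) (hR c))
  · exact adjacentCond_of_gammaR (height_le μ c) (hR c)
  · exact (adjacentCond_window_castLE _ _ _ _).2
      (adjacentCond_of_gammaL (height_le μ (c + 1)) (hL ⟨c + 1, h⟩))

/-- A trace is built backwards from `1`: Condition 1' with the column on the right gives a walk
along `Γ_l`, then Condition 1' together with the splitting gives one along `Γ_r`. -/
lemma Admissible.exists_foldingPair {n : ℕ} [NeZero n] {μ : Fin n → ℕ} {σ : Filling μ}
    (hσ : Admissible σ) : ∃ F ∈ FBar (chain μ), fillingMap μ F = σ := by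
  have key : ∀ c ≤ μ 0, ∃ g, IsTrace (chain μ) (chainSegment μ c).length g ∧
      g (chain μ).length = 1 ∧ ∀ (d : ℕ) (hd : d < μ 0), d < c →
        window (g (rightPos μ d)) (height_le μ d) = σ.right ⟨d, hd⟩ ∧
        window (g (leftPos μ d)) (height_le μ d) = σ.left ⟨d, hd⟩ := by
    intro c
    induction c with
    | zero =>
      intro _
      refine ⟨fun _ => 1, fun p _ β _ => Or.inl rfl, rfl, fun d _ hd => absurd hd (Nat.not_lt_zero _)⟩
    | succ c ih =>
      intro hc
      obtain ⟨g, hg, hg1, hgw⟩ := ih (Nat.le_of_succ_le hc)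
      have hadj : AdjacentCond le_rfl (σ.left ⟨c, hc⟩)
          (window (g (chainSegment μ c).length) (height_le μ c)) := by
        rcases c with _ | c
        · have h1 : g (chainSegment μ 0).length = 1 := hg1
          rw [h1]
          exact (adjacentCond_window_one _ (hσ.distinct_left _).injective).2
            (hσ.first_increasing _ rfl)
        · have h := hσ.adjacent_outer c hc
          rw [← (hgw c (Nat.lt_of_succ_lt hc) (Nat.lt_succ_self c)).1] at h
          exact (adjacentCond_window_castLE _ _ _ _).1 h
      obtain ⟨v, hv, hvw⟩ := exists_back_gammaL (height_le μ c) (hσ.distinct_left ⟨c, hc⟩) hadj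
      obtain ⟨g1, ht1, he1, hp1⟩ := hg.extend_gammaL hc hv
      have hin := hσ.adjacent_inner ⟨c, hc⟩
      obtain ⟨D, -, hs⟩ := hσ.split ⟨c, hc⟩
      have hs := splitRel_of_isSplitting (hσ.distinct_right ⟨c, hc⟩).injective
        (hσ.distinct_left ⟨c, hc⟩).injective hs
      rw [← hvw, ← he1] at hin hs
      obtain ⟨u, hu, huw⟩ := exists_back_gammaR (height_le μ c) (hσ.distinct_right ⟨c, hc⟩) hin hs
      obtain ⟨g2, ht2, he2, hp2⟩ := ht1.extend_gammaR hc hu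
      have hp : ∀ p, (chainSegment μ c).length ≤ p → g2 p = g p := fun p h =>
        (hp2 p ((leftPos_le μ hc).trans h)).trans (hp1 p h)
      refine ⟨g2, ht2, ?_, fun d hd hdc => ?_⟩
      · exact (hp _ (length_chainSegment_le μ (Nat.zero_le c) (Nat.le_of_succ_le hc))).trans hg1
      · rcases (Nat.lt_succ_iff.1 hdc).eq_or_lt with rfl | hdc
        · exact ⟨by rw [he2, huw], by rw [hp2 _ le_rfl, he1, hvw]⟩
        · have h1 : (chainSegment μ c).length ≤ rightPos μ d :=
            length_chainSegment_le μ hdc (Nat.le_of_succ_le hc)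
          rw [hp _ h1, hp _ (h1.trans (rightPos_le_leftPos μ d))]
          exact hgw d hd hdc
  obtain ⟨g, hg, hg1, hgw⟩ := key (μ 0) le_rfl
  rw [chainSegment_self] at hg
  obtain ⟨F, hF, hFg⟩ := TypeC.exists_foldingPair hg hg1
  have hl : ∀ c : Fin (μ 0), leftPos μ c ≤ (chain μ).length := fun c =>
    (leftPos_le μ c.isLt).trans (length_chainSegment_le μ (Nat.zero_le _) c.isLt.le)
  refine ⟨F, hF, Filling.ext (funext fun c => ?_) (funext fun c => ?_)⟩
  · have h := (hgw c c.isLt c.isLt).1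
    rw [← hFg _ ((rightPos_le_leftPos μ c).trans (hl c))] at h
    exact h
  · have h := (hgw c c.isLt c.isLt).2
    rw [← hFg _ (hl c)] at h
    exact h

end TypeC

theorem mainTheorem11 {n : ℕ} [NeZero n] (μ : Fin n → ℕ) (hμ : Antitone μ) :
    Set.InjOn (TypeC.fillingMap μ) (TypeC.FBar (TypeC.chain μ)) ∧
      TypeC.fillingMap μ '' TypeC.FBar (TypeC.chain μ) =
        {σ : TypeC.Filling μ | TypeC.Admissible σ} := by
  refine ⟨TypeC.injOn_fillingMap μ, Set.Subset.antisymm ?_ fun σ hσ => ?_⟩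
  · rintro _ ⟨F, hF, rfl⟩
    exact TypeC.admissible_fillingMap μ hF
  · exact TypeC.Admissible.exists_foldingPair hσ
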